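/- Let $\mathrm{GF}(q)$ be a finite field with $q\neq 2$, and let $D,N$ be integers with $N>2D\geq 6$. Let $\Gamma$ be the bilinear forms graph $H_q(D,N-D)$: its vertex set $X$ is the set of $D\times(N-D)$ matrices over $\mathrm{GF}(q)$, and two vertices are adjacent whenever their difference has rank one. Let $\partial$ be the path-length distance of $\Gamma$, let $\Gamma_i(x)=\{z\in X \mid \partial(x,z)=i\}$ and $\Gamma(x)=\Gamma_1(x)$. Let $V=\mathbb R^X$ with the bilinear form $\langle u,v\rangle=u^tv$; for $z\in X$ let $\hat z\in V$ be the vector with $z$-coordinate $1$ and all other coordinates $0$, and for $\Omega\subseteq X$ let $\widehat\Omega=\sum_{z\in\Omega}\hat z$. Let $A$ be the adjacency matrix of $\Gamma$, let $\theta_1$ be its second largest eigenvalue (the distinct eigenvalues being $\theta_0>\theta_1>\cdots>\theta_D$), and let $E$ be the associated primitive idempotent, that is, the real matrix that acts as the identity on the $\theta_1$-eigenspace of $A$ and as $0$ on every other eigenspace of $A$. The Norton product on $EV$ is $u\star v=E(u\circ v)$, where $\circ$ is the entrywise product. Fix $x,y\in X$ and put $k=\partial(x,y)$; assume $2\leq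 k\leq D-1$. Let $O_1=\Gamma(x)\cap\Gamma_{k-1}(y)$ and $O_6=\Gamma(x)\cap\Gamma_{k+1}(y)$, and for $2\leq i\leq 5$ let $O_i$ be the set of all $z\in\Gamma(x)\cap\Gamma_k(y)$ such that $$\bigl(|\Gamma(x)\cap\Gamma(z)\cap\Gamma_{k-1}(y)|,\ |\Gamma(x)\cap\Gamma(z)\cap\Gamma_{k+1}(y)|\bigr)$$ equals $(2q^{k-1},0)$ for $i=2$, $(2q^{k-1}-1,0)$ for $i=3$, $(q^{k-1},q^D-q^k)$ for $i=4$, and $(q^{k-1},q^{N-D}-q^k)$ for $i=5$. Let $S=\mathrm{Span}\{E\widehat O_i\mid 1\leq i\leq 6\}$ and $\omega=\sum_{i=1}^6\omega_i E\widehat O_i$, where $$\omega_1=\omega_3=\frac{(q^D-q^k)(q^{N-D}-q^k)(q^{k-1}-1)}{q^k(q-1)},\qquad \omega_2=\frac{(q^D-q^k)(q^{N-D}-q^k)}{q(q-1)},$$ $$\omega_4=-\frac{(q^D-q^k)(q^{k-1}-1)}{q-1},\qquad \omega_5=-\frac{(q^{N-D}-q^k)(q^{k-1}-1)}{q-1},\qquad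 \omega_6=\frac{(q^k-1)(q^{k-1}-1)}{q-1},$$ and let $\omega^\perp=\{v\in S\mid \langle\omega,v\rangle=0\}$. Then the subspace $\omega^\perp$ is spanned by the vectors $$E\hat z_1\star(E\hat z_2\star(E\hat z_3\star\cdots\star(E\hat z_{n-1}\star E\hat z_n)\cdots)),\qquad n\geq 1,\quad z_i\in\{x,y\}\ (1\leq i\leq n).$$ -/

import Mathlib

namespace BilinearForms

noncomputable section

/-! ### General notions for a finite graph `G` on `X`; the standard module is `V = X → ℝ`. -/

/-- The standard basis vector `x̂` of `V`. -/
def hat {X : Type*} (x : X) : X → ℝ := by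
  classical exact Pi.single x 1

/-- The vector `Ω̂ = ∑_{z ∈ Ω} ẑ` attached to a set of vertices. -/
def hatSum {X : Type*} (s : Finset X) : X → ℝ := ∑ z ∈ s, hat z

/-- The sphere `Γ_i(x)`: the vertices at path-length distance `i` from `x`. -/
def sphere {X : Type*} [Fintype X] (G : SimpleGraph X) (i : ℕ) (x : X) : Finset X := by
  classical exact Finset.univ.filter fun z => G.dist x z = i

/-- The real adjacency matrix of `G`. -/
def adjacency {X : Type*} (G : SimpleGraph X) : Matrix X X ℝ := by
  classical exact G.adjMatrix ℝ

/-- `θ` is an eigenvalue of the real matrix `A`. -/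
def IsEigenvalue {X : Type*} [Fintype X] (A : Matrix X X ℝ) (θ : ℝ) : Prop := by
  classical exact Module.End.HasEigenvalue (Matrix.toLin' A) θ

/-- The second largest eigenvalue `θ₁` in the list `θ₀ > θ₁ > ⋯` of the distinct eigenvalues:
the largest one among the eigenvalues that are smaller than some other eigenvalue. -/
def secondEigenvalue {X : Type*} [Fintype X] (A : Matrix X X ℝ) : ℝ :=
  sSup {θ : ℝ | IsEigenvalue A θ ∧ ∃ θ' : ℝ, IsEigenvalue A θ' ∧ θ < θ'}

/-- The `θ`-eigenspace of `A`, as a subspace of Euclidean space. -/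
def eigenspace {X : Type*} [Fintype X] (A : Matrix X X ℝ) (θ : ℝ) :
    Submodule ℝ (EuclideanSpace ℝ X) := by
  classical exact Module.End.eigenspace (Matrix.toEuclideanLin A) θ

/-- The primitive idempotent associated with the eigenvalue `θ` of a symmetric matrix `A`: the
matrix of the orthogonal projection of `V` onto the `θ`-eigenspace of `A`. By the two lemmas below
it acts as the identity on the `θ`-eigenspace and as `0` on every other eigenspace. -/
def primitiveIdempotent {X : Type*} [Fintype X] (A : Matrix X X ℝ) (θ : ℝ) : Matrix X X ℝ := by
  classical exact
    Matrix.toEuclideanLin.symm ((eigenspace A θ).starProjection :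
      EuclideanSpace ℝ X →ₗ[ℝ] EuclideanSpace ℝ X)

theorem primitiveIdempotent_mulVec {X : Type*} [Fintype X] (A : Matrix X X ℝ) (θ : ℝ)
    (v : X → ℝ) :
    Matrix.mulVec (primitiveIdempotent A θ) v =
      WithLp.ofLp ((eigenspace A θ).starProjection (WithLp.toLp 2 v)) := by
  classical
  have h : Matrix.mulVec (primitiveIdempotent A θ) v = WithLp.ofLp
      (Matrix.toEuclideanLin (primitiveIdempotent A θ) (WithLp.toLp 2 v)) := rfl
  rw [h]
  simp [primitiveIdempotent]

theorem primitiveIdempotent_mulVec_of_eq {X : Type*} [Fintype X] (A : Matrix X X ℝ) (θ : ℝ)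
    (v : X → ℝ) (hv : Matrix.mulVec A v = θ • v) :
    Matrix.mulVec (primitiveIdempotent A θ) v = v := by
  classical
  rw [primitiveIdempotent_mulVec]
  have hm : WithLp.toLp 2 v ∈ eigenspace A θ := by
    rw [eigenspace, Module.End.mem_eigenspace_iff]
    ext i
    simpa using congrFun hv i
  rw [Submodule.starProjection_eq_self_iff.2 hm]

theorem primitiveIdempotent_mulVec_of_ne {X : Type*} [Fintype X] (A : Matrix X X ℝ)
    (hA : A.IsSymm) (θ μ : ℝ) (hμ : μ ≠ θ) (v : X → ℝ) (hv : Matrix.mulVec A v = μ • v) :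
    Matrix.mulVec (primitiveIdempotent A θ) v = 0 := by
  classical
  rw [primitiveIdempotent_mulVec]
  have hm : WithLp.toLp 2 v ∈ (eigenspace A θ)ᗮ := by
    rw [Submodule.mem_orthogonal]
    intro u hu
    rw [eigenspace, Module.End.mem_eigenspace_iff] at hu
    have hu' : Matrix.mulVec A (WithLp.ofLp u) = θ • WithLp.ofLp u := by
      exact congrArg WithLp.ofLp hu
    have h1 : v ⬝ᵥ Matrix.mulVec A (WithLp.ofLp u) = Matrix.mulVec A v ⬝ᵥ WithLp.ofLp u := by
      rw [Matrix.dotProduct_mulVec, ← Matrix.mulVec_transpose, hA.eq]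
    rw [hu', hv, dotProduct_smul, smul_dotProduct, smul_eq_mul, smul_eq_mul] at h1
    have h2 : v ⬝ᵥ WithLp.ofLp u = 0 := by
      have : (θ - μ) * (v ⬝ᵥ WithLp.ofLp u) = 0 := by linarith
      rcases mul_eq_zero.1 this with h | h
      · exact absurd (sub_eq_zero.1 h).symm hμ
      · exact h
    rw [EuclideanSpace.inner_eq_star_dotProduct]
    simpa using h2
  rw [(Submodule.starProjection_apply_eq_zero_iff _).2 hm]
  rfl

/-- The Norton product `u ⋆ v = E (u ∘ v)`, where `∘` is the entrywise product. It is used only for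
vectors `u, v` in `EV`. -/
def norton {X : Type*} [Fintype X] (E : Matrix X X ℝ) (u v : X → ℝ) : X → ℝ :=
  Matrix.mulVec E (u * v)

/-- The right-nested product `E ẑ₁ ⋆ (E ẑ₂ ⋆ (⋯ ⋆ E ẑₙ))` with first factor given by `z = z₁` and
the remaining factors by the list `[z₂, …, zₙ]`. -/
def nestedNorton {X : Type*} [Fintype X] (E : Matrix X X ℝ) : X → List X → (X → ℝ)
  | z, [] => Matrix.mulVec E (hat z)
  | z, z' :: l => norton E (Matrix.mulVec E (hat z)) (nestedNorton E z' l)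

/-! ### The bilinear forms graph -/

/-- The bilinear forms graph on the `D × M` matrices over `F`: two matrices are adjacent whenever
their difference has rank one. -/
def graph (F : Type*) [Field F] (D M : ℕ) : SimpleGraph (Matrix (Fin D) (Fin M) F) where
  Adj x y := (x - y).rank = 1
  symm := ⟨fun x y h => by
    have h1 : (y - x).mulVecLin = -(x - y).mulVecLin := by
      ext v; simp
    rw [Matrix.rank, h1, LinearMap.range_neg]
    exact h⟩
  loopless := ⟨fun x h => by simp at h⟩

variable {F : Type*} [Field F] [Fintype F] {D M : ℕ}

/-- For vertices `x, y, z` and `j`, the number `|Γ(x) ∩ Γ(z) ∩ Γ_j(y)|`. -/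
def tripleCount (x y z : Matrix (Fin D) (Fin M) F) (j : ℕ) : ℕ := by
  classical exact
    (sphere (graph F D M) 1 x ∩ sphere (graph F D M) 1 z ∩ sphere (graph F D M) j y).card

/-- The set of `z ∈ Γ(x) ∩ Γ_k(y)`, where `k = ∂(x,y)`, such that
`|Γ(x) ∩ Γ(z) ∩ Γ_{k-1}(y)| = a` and `|Γ(x) ∩ Γ(z) ∩ Γ_{k+1}(y)| = b`. -/
def middleCell (x y : Matrix (Fin D) (Fin M) F) (a b : ℕ) : Finset (Matrix (Fin D) (Fin M) F) := by
  classical exact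
    (sphere (graph F D M) 1 x ∩ sphere (graph F D M) ((graph F D M).dist x y) y).filter fun z =>
      tripleCount x y z ((graph F D M).dist x y - 1) = a ∧
      tripleCount x y z ((graph F D M).dist x y + 1) = b

/-- The `y`-partition `O₁, …, O₆` of `Γ(x)` (indexed by `0, …, 5` here), for vertices `x, y` at
distance `k` with `2 ≤ k ≤ D - 1`; `q = |F|` and `M` plays the role of `N - D`. -/
def yPartition (x y : Matrix (Fin D) (Fin M) F) : Fin 6 → Finset (Matrix (Fin D) (Fin M) F) := by
  classical exact
    let q : ℕ := Fintype.card F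
    let k : ℕ := (graph F D M).dist x y
    ![sphere (graph F D M) 1 x ∩ sphere (graph F D M) (k - 1) y,
      middleCell x y (2 * q ^ (k - 1)) 0,
      middleCell x y (2 * q ^ (k - 1) - 1) 0,
      middleCell x y (q ^ (k - 1)) (q ^ D - q ^ k),
      middleCell x y (q ^ (k - 1)) (q ^ M - q ^ k),
      sphere (graph F D M) 1 x ∩ sphere (graph F D M) (k + 1) y]

/-- The primitive idempotent `E` of the bilinear forms graph associated with `θ₁`. -/
def idempotent (F : Type*) [Field F] [Fintype F] (D M : ℕ) :
    Matrix (Matrix (Fin D) (Fin M) F) (Matrix (Fin D) (Fin M) F) ℝ :=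
  primitiveIdempotent (adjacency (graph F D M)) (secondEigenvalue (adjacency (graph F D M)))

/-- The vector `E Ô_i`, for the `y`-partition of `Γ(x)`. -/
def cellVector (x y : Matrix (Fin D) (Fin M) F) (i : Fin 6) : Matrix (Fin D) (Fin M) F → ℝ :=
  Matrix.mulVec (idempotent F D M) (hatSum (yPartition x y i))

/-- The subspace `S = S(x,y)` spanned by the vectors `E Ô_i`. -/
def S (x y : Matrix (Fin D) (Fin M) F) : Submodule ℝ (Matrix (Fin D) (Fin M) F → ℝ) :=
  Submodule.span ℝ (Set.range (cellVector x y))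

/-- The scalars `ω₁, …, ω₆` (indexed by `0, …, 5`), where `M` plays the role of `N - D`. -/
def omegaCoeff (q : ℝ) (D M k : ℕ) : Fin 6 → ℝ :=
  ![(q ^ D - q ^ k) * (q ^ M - q ^ k) * (q ^ (k - 1) - 1) / (q ^ k * (q - 1)),
    (q ^ D - q ^ k) * (q ^ M - q ^ k) / (q * (q - 1)),
    (q ^ D - q ^ k) * (q ^ M - q ^ k) * (q ^ (k - 1) - 1) / (q ^ k * (q - 1)),
    -((q ^ D - q ^ k) * (q ^ (k - 1) - 1) / (q - 1)),
    -((q ^ M - q ^ k) * (q ^ (k - 1) - 1) / (q - 1)),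
    (q ^ k - 1) * (q ^ (k - 1) - 1) / (q - 1)]

/-- The vector `ω = ω(x,y) = ∑ ω_i E Ô_i`. -/
def omega (x y : Matrix (Fin D) (Fin M) F) : Matrix (Fin D) (Fin M) F → ℝ :=
  ∑ i : Fin 6, omegaCoeff (Fintype.card F : ℝ) D M ((graph F D M).dist x y) i • cellVector x y i

/-- `ω^⊥`, the orthogonal complement of `ω` in `S` for the standard bilinear form of `V`. -/
def omegaPerp (x y : Matrix (Fin D) (Fin M) F) :
    Submodule ℝ (Matrix (Fin D) (Fin M) F → ℝ) where
  carrier := {v | v ∈ S x y ∧ omega x y ⬝ᵥ v = 0}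
  zero_mem' := ⟨Submodule.zero_mem _, dotProduct_zero _⟩
  add_mem' := fun {u v} hu hv =>
    ⟨Submodule.add_mem _ hu.1 hv.1, by rw [dotProduct_add, hu.2, hv.2, add_zero]⟩
  smul_mem' := fun c v hv =>
    ⟨Submodule.smul_mem _ c hv.1, by rw [dotProduct_smul, hv.2, smul_zero]⟩

end

end BilinearForms

namespace BilinearForms
open Matrix Function

set_option linter.unusedSectionVars false

/-! ### Rank of a matrix after subtracting a rank-one matrix -/

section Rank

variable {F : Type*} [Field F] {m n k : Type*} [Fintype m] [Fintype n] [Fintype k]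

/-! The vertices form an additive group on which the graph is a Cayley graph, so everything can be
read from Fourier coefficients at the characters `z ↦ ψ(⟨B, z - x⟩)`. The eigenvalue at `B` depends
only on the rank of `B` and strictly decreases with it. Hence `E` becomes restriction to the
matrices `B` of rank one (`fourier_idempotent`), and the Norton product by `E p̂` becomes a sum over
the common neighbours `C` of `0` and `B`, weighted by the phase `ψ(⟨B - C, p - x⟩)`
(`fourier_norton`).

Write `y - x = P * Q`, a full-rank factorization through dimension `k`. Distance is the rank of the
difference, so the cell of `x + u vᵀ` is decided by whether `u` lies in the column space of `P`,
whether `v` lies in the row space of `Q` and, if `u = P c` and `v = Qᵀ d`, by the scalar `d ⬝ᵥ c`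
(`mem_yPartition_iff`). Character sums then show that, on rank-one `C`, the transform of each `E
Ô_i` is a combination of six functions: `1`, `ψ(⟨C, PQ⟩)`, the indicators of `Pᵀ C = 0`, of `C Qᵀ =
0` and of `⟨C, PQ⟩ = 0`, and the product of the first two indicators (`represents_cellVector`).
Conversely the cells yield every coefficient vector (`cellCoeff_span`).

What remains is linear algebra in `ℝ⁶`. Norton products by `E x̂` and `E ŷ` preserve the hyperplane
where the last coefficient vanishes (`Represents.norton_left`, `Represents.norton_right`), and `E
x̂`, `E ŷ` themselves lie there. Repeated multiplication by `E x̂` alone already generates the whole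
hyperplane from these two, because `q ^ D ≠ q ^ M` (`actLeft_span`). Finally, by Parseval, the inner
product with `ω` is a nonzero multiple of the last coefficient (`omega_dotProduct_eq_zero_iff`), so
`ω^⊥` is the same hyperplane. Linear independence of the six functions is never needed: it is enough
that coefficients determine the vector. -/

theorem rank_eq_card_iff_injective (A : Matrix m n F) :
    A.rank = Fintype.card n ↔ Injective A.mulVec := by
  have h := LinearMap.finrank_range_add_finrank_ker A.mulVecLin
  rw [Module.finrank_fintype_fun_eq_card] at h
  change A.rank + _ = _ at h
  have h2 : Injective A.mulVecLin ↔ LinearMap.ker A.mulVecLin = ⊥ := LinearMap.ker_eq_bot.symm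
  change _ ↔ Injective A.mulVecLin
  rw [h2, ← Submodule.finrank_eq_zero]
  omega

theorem injective_mulVec_of_forall (A : Matrix m n F) (h : ∀ s, A *ᵥ s = 0 → s = 0) :
    Injective A.mulVec := by
  change Injective A.mulVecLin
  rw [← LinearMap.ker_eq_bot, LinearMap.ker_eq_bot']
  exact h

theorem mulVec_eq_zero_iff_of_injective {A : Matrix m n F} (h : Injective A.mulVec) {s : n → F} :
    A *ᵥ s = 0 ↔ s = 0 :=
  ⟨fun hs => h (by simpa using hs), fun hs => by simp [hs]⟩

theorem rank_mul_of_injective_left {P : Matrix m k F} (hP : Injective P.mulVec)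
    (A : Matrix k n F) : (P * A).rank = A.rank := by
  rw [Matrix.rank, Matrix.rank, Matrix.mulVecLin_mul, LinearMap.range_comp]
  exact (Submodule.equivMapOfInjective P.mulVecLin hP _).finrank_eq.symm

theorem rank_mul_of_injective_right {Q : Matrix k n F} (hQ : Injective Qᵀ.mulVec)
    (A : Matrix m k F) : (A * Q).rank = A.rank := by
  rw [← rank_transpose, transpose_mul, rank_mul_of_injective_left hQ, rank_transpose]

theorem rank_mul_of_injective {P : Matrix m k F} {Q : Matrix k n F}
    (hP : Injective P.mulVec) (hQ : Injective Qᵀ.mulVec) : (P * Q).rank = Fintype.card k := by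
  rw [rank_mul_of_injective_right hQ, rank_eq_card_iff_injective]
  exact hP

theorem rank_add_le (A B : Matrix m n F) : (A + B).rank ≤ A.rank + B.rank := by
  rw [Matrix.rank, Matrix.rank, Matrix.rank, Matrix.mulVecLin_add]
  refine le_trans (Submodule.finrank_mono ?_) (Submodule.finrank_add_le_finrank_add_finrank _ _)
  rintro _ ⟨s, rfl⟩
  exact Submodule.add_mem_sup ⟨s, rfl⟩ ⟨s, rfl⟩

theorem rank_neg (A : Matrix m n F) : (-A).rank = A.rank := by
  have h : (-A).mulVecLin = -A.mulVecLin := by ext v; simp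
  rw [Matrix.rank, h, LinearMap.range_neg]; rfl

theorem rank_sub_comm (A B : Matrix m n F) : (A - B).rank = (B - A).rank := by
  rw [← neg_sub, rank_neg]

theorem rank_eq_zero_iff (A : Matrix m n F) : A.rank = 0 ↔ A = 0 := by
  classical
  constructor
  · intro h
    rw [Matrix.rank, Submodule.finrank_eq_zero, LinearMap.range_eq_bot] at h
    ext i j
    have := congrFun (LinearMap.congr_fun h (Pi.single j 1)) i
    simpa using this
  · rintro rfl; exact rank_zero

/-- The columns of `P` are a basis of the column space of `B`, and `Q` records the coordinates of
the columns of `B`. The rows of `Q` are independent because `rank B ≤ rank Q`. -/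
theorem exists_rank_factorization (B : Matrix m n F) :
    ∃ (P : Matrix m (Fin B.rank) F) (Q : Matrix (Fin B.rank) n F),
      B = P * Q ∧ Injective P.mulVec ∧ Injective Qᵀ.mulVec := by
  classical
  let b : Module.Basis (Fin B.rank) F (LinearMap.range B.mulVecLin) :=
    Module.finBasisOfFinrankEq F _ rfl
  let P : Matrix m (Fin B.rank) F := Matrix.of fun i j => (b j : m → F) i
  let Q : Matrix (Fin B.rank) n F :=
    Matrix.of fun j l => b.repr ⟨B *ᵥ Pi.single l 1, ⟨Pi.single l 1, rfl⟩⟩ j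
  have hB : B = P * Q := by
    ext i l
    have h := b.sum_repr ⟨B *ᵥ Pi.single l 1, ⟨Pi.single l 1, rfl⟩⟩
    have h2 := congrFun (congrArg Subtype.val h) i
    simp only [AddSubmonoidClass.coe_finsetSum, Submodule.coe_smul, Finset.sum_apply,
      Pi.smul_apply, smul_eq_mul] at h2
    rw [Matrix.mul_apply]
    simp only [P, Q, Matrix.of_apply]
    rw [Finset.sum_congr rfl fun j _ => mul_comm _ _, h2]
    simp
  refine ⟨P, Q, hB, ?_, ?_⟩
  · apply injective_mulVec_of_forall
    intro s hs
    have h : ∑ j, s j • b j = 0 := by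
      apply Subtype.ext
      ext i
      have := congrFun hs i
      simp only [Matrix.mulVec, dotProduct, P, Matrix.of_apply, Pi.zero_apply] at this
      simp only [AddSubmonoidClass.coe_finsetSum, Submodule.coe_smul, Finset.sum_apply,
        Pi.smul_apply, smul_eq_mul, ZeroMemClass.coe_zero, Pi.zero_apply]
      rw [← this]
      exact Finset.sum_congr rfl fun j _ => mul_comm _ _
    ext j
    exact Fintype.linearIndependent_iff.1 b.linearIndependent s h j
  · rw [← rank_eq_card_iff_injective, rank_transpose]
    apply le_antisymm (rank_le_card_height Q)
    rw [Fintype.card_fin]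
    calc B.rank = (P * Q).rank := by rw [← hB]
      _ ≤ Q.rank := rank_mul_le_right P Q

theorem vecMulVec_eq_zero_iff {a : m → F} {b : n → F} :
    vecMulVec a b = 0 ↔ a = 0 ∨ b = 0 := by
  constructor
  · intro h
    by_contra hc
    push Not at hc
    obtain ⟨i, hi⟩ := Function.ne_iff.1 hc.1
    obtain ⟨j, hj⟩ := Function.ne_iff.1 hc.2
    exact mul_ne_zero hi hj (congrFun (congrFun h i) j)
  · rintro (rfl | rfl) <;> ext <;> simp [vecMulVec_apply]

theorem exists_eq_vecMulVec_of_rank_eq_one {B : Matrix m n F} (h : B.rank = 1) :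
    ∃ a b, a ≠ 0 ∧ b ≠ 0 ∧ B = vecMulVec a b := by
  obtain ⟨P, Q, hB, -, -⟩ := exists_rank_factorization B
  have hB' : B = vecMulVec (fun i => P i ⟨0, by omega⟩) (Q ⟨0, by omega⟩) := by
    refine hB.trans ?_
    ext i j
    rw [Matrix.mul_apply, vecMulVec_apply]
    refine Fintype.sum_eq_single (⟨0, by omega⟩ : Fin B.rank) fun l hl => ?_
    exact absurd (Fin.ext (by have := l.2; simp; omega)) hl
  refine ⟨_, _, ?_, ?_, hB'⟩ <;> intro h0 <;>
    rw [vecMulVec_eq_zero_iff.2 (by simp [h0])] at hB' <;> simp [hB'] at h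

theorem rank_vecMulVec_eq_one {a : m → F} {b : n → F} (ha : a ≠ 0) (hb : b ≠ 0) :
    (vecMulVec a b).rank = 1 := by
  apply le_antisymm (rank_vecMulVec_le a b)
  rw [Nat.one_le_iff_ne_zero, Ne, rank_eq_zero_iff, vecMulVec_eq_zero_iff]
  exact not_or.2 ⟨ha, hb⟩

variable {P : Matrix m k F} {Q : Matrix k n F}

/-- A vector `s` killed by the transpose satisfies `Qᵀ s = (c ⬝ᵥ s) v`; a nonzero scalar here would
put `v` in the row space of `Q`. -/
theorem rank_sub_vecMulVec_of_notMem {v : n → F} (hQ : Injective Qᵀ.mulVec)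
    (hv : v ∉ Set.range Qᵀ.mulVec) (c : k → F) :
    (Q - vecMulVec c v).rank = Fintype.card k := by
  rw [← rank_transpose, rank_eq_card_iff_injective]
  apply injective_mulVec_of_forall
  intro s hs
  rw [transpose_sub, transpose_vecMulVec, sub_mulVec, vecMulVec_mulVec, sub_eq_zero] at hs
  have h0 : c ⬝ᵥ s = 0 := by
    by_contra h
    apply hv
    refine ⟨(c ⬝ᵥ s)⁻¹ • s, ?_⟩
    rw [mulVec_smul, hs]
    ext i
    simp
    field_simp
  rw [h0] at hs
  exact (mulVec_eq_zero_iff_of_injective hQ).1 (by simpa using hs)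

/-- A kernel vector has the form `s = (d ⬝ᵥ s) c`; pairing with `d` gives `d ⬝ᵥ s = (d ⬝ᵥ c)(d ⬝ᵥ
s)`, so `d ⬝ᵥ s = 0`. -/
theorem rank_one_sub_vecMulVec_of_ne [DecidableEq k] {c d : k → F} (h : d ⬝ᵥ c ≠ 1) :
    ((1 : Matrix k k F) - vecMulVec c d).rank = Fintype.card k := by
  rw [rank_eq_card_iff_injective]
  apply injective_mulVec_of_forall
  intro s hs
  rw [sub_mulVec, one_mulVec, vecMulVec_mulVec, sub_eq_zero] at hs
  have h1 : d ⬝ᵥ s = (d ⬝ᵥ c) * (d ⬝ᵥ s) := by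
    conv_lhs => rw [hs]
    rw [dotProduct_smul]
    simp
  have h0 : d ⬝ᵥ s = 0 := by
    by_contra h2
    exact h (mul_right_cancel₀ h2 (by rw [one_mul, ← h1]))
  rw [hs, h0]
  simp

theorem rank_le_rank_sub_vecMulVec (A : Matrix m n F) (u : m → F) (v : n → F) :
    A.rank ≤ (A - vecMulVec u v).rank + 1 := by
  calc A.rank = ((A - vecMulVec u v) + vecMulVec u v).rank := by rw [sub_add_cancel]
    _ ≤ _ := (rank_add_le _ _).trans (by gcongr; exact rank_vecMulVec_le u v)

/-- Now `c` itself is a nonzero kernel vector, while subtracting a rank-one matrix lowers the rank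
by at most one. -/
theorem rank_one_sub_vecMulVec_of_eq [DecidableEq k] {c d : k → F} (h : d ⬝ᵥ c = 1) :
    ((1 : Matrix k k F) - vecMulVec c d).rank + 1 = Fintype.card k := by
  have h1 := rank_le_rank_sub_vecMulVec (1 : Matrix k k F) c d
  rw [rank_one] at h1
  have h2 : ((1 : Matrix k k F) - vecMulVec c d).rank ≠ Fintype.card k := by
    rw [Ne, rank_eq_card_iff_injective]
    intro hi
    have : c = 0 := (mulVec_eq_zero_iff_of_injective hi).1 (by
      rw [sub_mulVec, one_mulVec, vecMulVec_mulVec, h]; simp)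
    simp [this] at h
  have h3 := rank_le_card_width ((1 : Matrix k k F) - vecMulVec c d)
  omega

theorem rank_mul_sub_of_mem_left (hP : Injective P.mulVec) (c : k → F) (v : n → F) :
    (P * Q - vecMulVec (P *ᵥ c) v).rank = (Q - vecMulVec c v).rank := by
  rw [← mul_vecMulVec, ← Matrix.mul_sub, rank_mul_of_injective_left hP]

theorem rank_mul_sub_transpose (u : m → F) (v : n → F) :
    (P * Q - vecMulVec u v).rank = (Qᵀ * Pᵀ - vecMulVec v u).rank := by
  rw [← rank_transpose, transpose_sub, transpose_mul, transpose_vecMulVec]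

theorem rank_mul_sub_of_mem_of_notMem (hP : Injective P.mulVec) (hQ : Injective Qᵀ.mulVec)
    {u : m → F} {v : n → F} (hu : u ∈ Set.range P.mulVec) (hv : v ∉ Set.range Qᵀ.mulVec) :
    (P * Q - vecMulVec u v).rank = Fintype.card k := by
  obtain ⟨c, rfl⟩ := hu
  rw [rank_mul_sub_of_mem_left hP, rank_sub_vecMulVec_of_notMem hQ hv]

theorem rank_mul_sub_of_notMem_of_mem (hP : Injective P.mulVec) (hQ : Injective Qᵀ.mulVec)
    {u : m → F} {v : n → F} (hu : u ∉ Set.range P.mulVec) (hv : v ∈ Set.range Qᵀ.mulVec) :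
    (P * Q - vecMulVec u v).rank = Fintype.card k := by
  rw [rank_mul_sub_transpose, rank_mul_sub_of_mem_of_notMem hQ _ hv]
  · exact hu
  · exact hP

theorem replicateCol_unit_mulVec (u : m → F) (s : Unit → F) :
    replicateCol Unit u *ᵥ s = s () • u := by
  ext i; simp [mulVec, dotProduct, mul_comm]

theorem injective_mulVec_replicateCol {a : m → F} (ha : a ≠ 0) :
    Injective (replicateCol Unit a).mulVec := by
  apply injective_mulVec_of_forall
  intro s hs
  rw [replicateCol_unit_mulVec, smul_eq_zero] at hs
  ext i
  exact hs.resolve_right ha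

theorem injective_mulVec_fromCols {A : Matrix m k F} {u : m → F} (hA : Injective A.mulVec)
    (hu : u ∉ Set.range A.mulVec) : Injective (fromCols A (replicateCol Unit u)).mulVec := by
  apply injective_mulVec_of_forall
  intro s hs
  rw [fromCols_mulVec, replicateCol_unit_mulVec] at hs
  have h0 : s (Sum.inr ()) = 0 := by
    by_contra h
    apply hu
    refine ⟨-(s (Sum.inr ()))⁻¹ • (s ∘ Sum.inl), ?_⟩
    rw [mulVec_smul, eq_neg_of_add_eq_zero_left hs]
    ext i
    simp
    field_simp
  rw [Function.comp_apply, h0, zero_smul, add_zero, mulVec_eq_zero_iff_of_injective hA] at hs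
  ext (i | i)
  · exact congrFun hs i
  · exact h0

/-- The difference is again a full-rank factorization, through dimension `k + 1`: border `P` by the
column `u` and `Q` by the row `-v`. -/
theorem rank_mul_sub_of_notMem (hP : Injective P.mulVec) (hQ : Injective Qᵀ.mulVec)
    {u : m → F} {v : n → F} (hu : u ∉ Set.range P.mulVec) (hv : v ∉ Set.range Qᵀ.mulVec) :
    (P * Q - vecMulVec u v).rank = Fintype.card k + 1 := by
  have hv' : -v ∉ Set.range Qᵀ.mulVec := by
    rintro ⟨c, hc⟩
    exact hv ⟨-c, by rw [mulVec_neg, hc, neg_neg]⟩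
  have hQ' : Injective (fromRows Q (replicateRow Unit (-v)))ᵀ.mulVec := by
    rw [transpose_fromRows, transpose_replicateRow]
    exact injective_mulVec_fromCols hQ hv'
  have h := rank_mul_of_injective (injective_mulVec_fromCols hP hu) hQ'
  rw [fromCols_mul_fromRows] at h
  have e : P * Q + replicateCol Unit u * replicateRow Unit (-v) = P * Q - vecMulVec u v := by
    rw [← vecMulVec_eq, vecMulVec_neg, sub_eq_add_neg]
  rw [e] at h
  simpa using h

/-- The difference is `P (1 - c dᵀ) Q`, and the outer factors do not change the rank. -/
theorem rank_mul_sub_of_mem [DecidableEq k] (hP : Injective P.mulVec) (hQ : Injective Qᵀ.mulVec)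
    (c d : k → F) : (P * Q - vecMulVec (P *ᵥ c) (Qᵀ *ᵥ d)).rank =
      ((1 : Matrix k k F) - vecMulVec c d).rank := by
  rw [rank_mul_sub_of_mem_left hP]
  have : Q - vecMulVec c (Qᵀ *ᵥ d) = ((1 : Matrix k k F) - vecMulVec c d) * Q := by
    rw [Matrix.sub_mul, Matrix.one_mul, vecMulVec_mul, mulVec_transpose]
  rw [this, rank_mul_of_injective_right hQ]

theorem rank_mul_sub_eq_succ_iff (hP : Injective P.mulVec) (hQ : Injective Qᵀ.mulVec)
    (u : m → F) (v : n → F) :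
    (P * Q - vecMulVec u v).rank = Fintype.card k + 1 ↔
      u ∉ Set.range P.mulVec ∧ v ∉ Set.range Qᵀ.mulVec := by
  classical
  refine ⟨fun h => ?_, fun h => rank_mul_sub_of_notMem hP hQ h.1 h.2⟩
  by_cases hu : u ∈ Set.range P.mulVec
  · by_cases hv : v ∈ Set.range Qᵀ.mulVec
    · obtain ⟨c, rfl⟩ := hu
      obtain ⟨d, rfl⟩ := hv
      rw [rank_mul_sub_of_mem hP hQ] at h
      have := rank_le_card_width ((1 : Matrix k k F) - vecMulVec c d)
      omega
    · rw [rank_mul_sub_of_mem_of_notMem hP hQ hu hv] at h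
      omega
  · by_cases hv : v ∈ Set.range Qᵀ.mulVec
    · rw [rank_mul_sub_of_notMem_of_mem hP hQ hu hv] at h
      omega
    · exact ⟨hu, hv⟩

theorem rank_mul_sub_eq_pred_iff (hP : Injective P.mulVec) (hQ : Injective Qᵀ.mulVec)
    (u : m → F) (v : n → F) :
    (P * Q - vecMulVec u v).rank + 1 = Fintype.card k ↔
      ∃ c d, u = P *ᵥ c ∧ v = Qᵀ *ᵥ d ∧ d ⬝ᵥ c = 1 := by
  classical
  constructor
  · intro h
    by_cases hu : u ∈ Set.range P.mulVec
    · by_cases hv : v ∈ Set.range Qᵀ.mulVec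
      · obtain ⟨c, rfl⟩ := hu
        obtain ⟨d, rfl⟩ := hv
        refine ⟨c, d, rfl, rfl, ?_⟩
        rw [rank_mul_sub_of_mem hP hQ] at h
        by_contra hcd
        rw [rank_one_sub_vecMulVec_of_ne hcd] at h
        omega
      · rw [rank_mul_sub_of_mem_of_notMem hP hQ hu hv] at h
        omega
    · by_cases hv : v ∈ Set.range Qᵀ.mulVec
      · rw [rank_mul_sub_of_notMem_of_mem hP hQ hu hv] at h
        omega
      · rw [rank_mul_sub_of_notMem hP hQ hu hv] at h
        omega
  · rintro ⟨c, d, rfl, rfl, h⟩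
    rw [rank_mul_sub_of_mem hP hQ, rank_one_sub_vecMulVec_of_eq h]

/-- Otherwise the bordering criterion, applied to `a bᵀ` as a factorization through dimension one,
makes the rank equal to two. -/
theorem exists_smul_of_rank_vecMulVec_sub {a c : m → F} {b d : n → F} (ha : a ≠ 0) (hb : b ≠ 0)
    (h : (vecMulVec a b - vecMulVec c d).rank = 1) : (∃ r : F, c = r • a) ∨ ∃ r : F, d = r • b := by
  by_contra hcon
  push Not at hcon
  rw [vecMulVec_eq Unit a b] at h
  have hQ : Injective (replicateRow Unit b)ᵀ.mulVec := by
    rw [transpose_replicateRow]; exact injective_mulVec_replicateCol hb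
  have := (rank_mul_sub_eq_succ_iff (injective_mulVec_replicateCol ha) hQ c d).2 ⟨?_, ?_⟩
  · simp at this
    omega
  · rintro ⟨s, rfl⟩
    exact hcon.1 (s ()) (by ext i; simp [mulVec, dotProduct, mul_comm])
  · rintro ⟨s, rfl⟩
    exact hcon.2 (s ()) (by ext i; simp [mulVec, dotProduct, mul_comm])

theorem vecMulVec_left_inj {a c : m → F} {b : n → F} (hb : b ≠ 0) :
    vecMulVec a b = vecMulVec c b ↔ a = c := by
  refine ⟨fun h => ?_, fun h => by rw [h]⟩
  rw [← sub_eq_zero, ← sub_vecMulVec, vecMulVec_eq_zero_iff] at h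
  exact sub_eq_zero.1 (h.resolve_right hb)

theorem vecMulVec_right_inj {a : m → F} {b d : n → F} (ha : a ≠ 0) :
    vecMulVec a b = vecMulVec a d ↔ b = d := by
  refine ⟨fun h => ?_, fun h => by rw [h]⟩
  rw [← sub_eq_zero, ← vecMulVec_sub, vecMulVec_eq_zero_iff] at h
  exact sub_eq_zero.1 (h.resolve_left ha)

/-- The edge from `0` to `a bᵀ` lies in two cliques, the matrices `c bᵀ` and the matrices `a dᵀ`,
and these contain all common neighbours. -/
theorem rank_one_common_iff {a : m → F} {b : n → F} (ha : a ≠ 0) (hb : b ≠ 0) (C : Matrix m n F) :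
    C.rank = 1 ∧ (vecMulVec a b - C).rank = 1 ↔
      (∃ c, c ≠ 0 ∧ c ≠ a ∧ vecMulVec c b = C) ∨ ∃ d, d ≠ 0 ∧ d ≠ b ∧ vecMulVec a d = C := by
  constructor
  · rintro ⟨h1, h2⟩
    obtain ⟨c, d, hc, hd, rfl⟩ := exists_eq_vecMulVec_of_rank_eq_one h1
    rcases exists_smul_of_rank_vecMulVec_sub ha hb h2 with ⟨r, rfl⟩ | ⟨r, rfl⟩
    · right
      have hr : r ≠ 0 := by rintro rfl; simp at hc
      refine ⟨r • d, smul_ne_zero hr hd, ?_, by rw [vecMulVec_smul, smul_vecMulVec]⟩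
      rintro rfl
      rw [vecMulVec_smul, smul_vecMulVec, sub_self] at h2
      simp at h2
    · left
      have hr : r ≠ 0 := by rintro rfl; simp at hd
      refine ⟨r • c, smul_ne_zero hr hc, ?_, by rw [vecMulVec_smul, smul_vecMulVec]⟩
      rintro rfl
      rw [vecMulVec_smul, smul_vecMulVec, sub_self] at h2
      simp at h2
  · rintro (⟨c, hc, hca, rfl⟩ | ⟨d, hd, hdb, rfl⟩)
    · refine ⟨rank_vecMulVec_eq_one hc hb, ?_⟩
      rw [← sub_vecMulVec]
      exact rank_vecMulVec_eq_one (sub_ne_zero.2 hca.symm) hb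
    · refine ⟨rank_vecMulVec_eq_one ha hd, ?_⟩
      rw [← vecMulVec_sub]
      exact rank_vecMulVec_eq_one ha (sub_ne_zero.2 hdb.symm)

end Rank

/-! ### Path-length distance is the rank of the difference -/

section Distance

variable {F : Type*} [Field F] {D M : ℕ}

theorem rank_sub_le_length {x y : Matrix (Fin D) (Fin M) F} (p : (graph F D M).Walk x y) :
    (x - y).rank ≤ p.length := by
  induction p with
  | nil => simp
  | @cons u v w h p ih =>
    have h1 : (u - v).rank = 1 := h
    calc (u - w).rank = ((u - v) + (v - w)).rank := by rw [sub_add_sub_cancel]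
      _ ≤ (u - v).rank + (v - w).rank := rank_add_le _ _
      _ ≤ _ := by rw [h1, SimpleGraph.Walk.length_cons]; omega

/-- With `x - y = P Q` and `e` a coordinate vector, `e ⬝ᵥ e = 1`, so subtracting the rank-one matrix
`(P e)(Qᵀ e)ᵀ` from `x` lowers the rank of the difference by exactly one. -/
theorem exists_walk_length_eq_rank (r : ℕ) : ∀ (x y : Matrix (Fin D) (Fin M) F),
    (x - y).rank = r → ∃ p : (graph F D M).Walk x y, p.length = r := by
  induction r with
  | zero =>
    intro x y h
    rw [rank_eq_zero_iff, sub_eq_zero] at h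
    subst h
    exact ⟨.nil, rfl⟩
  | succ r ih =>
    intro x y h
    obtain ⟨P, Q, hB, hP, hQ⟩ := exists_rank_factorization (x - y)
    let e : Fin (x - y).rank → F := Pi.single ⟨0, by omega⟩ 1
    have he : e ⬝ᵥ e = 1 := by simp [e]
    have h1 := (rank_mul_sub_eq_pred_iff hP hQ (P *ᵥ e) (Qᵀ *ᵥ e)).2 ⟨e, e, rfl, rfl, he⟩
    rw [← hB, Fintype.card_fin] at h1
    have he0 : e ≠ 0 := fun h => by simp [h] at he
    have hadj : (graph F D M).Adj x (x - vecMulVec (P *ᵥ e) (Qᵀ *ᵥ e)) := by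
      change (x - (x - _)).rank = 1
      rw [sub_sub_cancel]
      exact rank_vecMulVec_eq_one (fun h => he0 ((mulVec_eq_zero_iff_of_injective hP).1 h))
        (fun h => he0 ((mulVec_eq_zero_iff_of_injective hQ).1 h))
    obtain ⟨p, hp⟩ := ih (x - vecMulVec (P *ᵥ e) (Qᵀ *ᵥ e)) y (by
      rw [sub_right_comm]; omega)
    exact ⟨.cons hadj p, by rw [SimpleGraph.Walk.length_cons, hp]⟩

theorem dist_eq_rank (x y : Matrix (Fin D) (Fin M) F) :
    (graph F D M).dist x y = (x - y).rank := by
  obtain ⟨p, hp⟩ := exists_walk_length_eq_rank _ x y rfl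
  apply le_antisymm
  · rw [← hp]; exact SimpleGraph.dist_le p
  · obtain ⟨p', hp'⟩ := SimpleGraph.Reachable.exists_walk_length_eq_dist ⟨p⟩
    rw [← hp']; exact rank_sub_le_length p'

end Distance

/-! ### Complex-valued indicators -/

section Indicator

/-- The complex number `1` or `0` according to whether `p` holds. -/
noncomputable def ind (p : Prop) : ℂ := by
  classical exact if p then 1 else 0

theorem ind_of {p : Prop} (h : p) : ind p = 1 := if_pos h

theorem ind_of_not {p : Prop} (h : ¬p) : ind p = 0 := if_neg h

theorem ind_eq_ite (p : Prop) [Decidable p] : ind p = if p then 1 else 0 := by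
  by_cases h : p <;> simp [ind_of, ind_of_not, h]

theorem ind_congr {p p' : Prop} (h : p ↔ p') : ind p = ind p' := by rw [propext h]

theorem ind_not (p : Prop) : ind (¬p) = 1 - ind p := by
  by_cases h : p <;> simp [ind_of, ind_of_not, h]

theorem ind_and (p p' : Prop) : ind (p ∧ p') = ind p * ind p' := by
  by_cases h : p <;> by_cases h' : p' <;> simp [ind_of, ind_of_not, h, h']

theorem ind_or (p p' : Prop) : ind (p ∨ p') = ind p + ind p' - ind p * ind p' := by
  by_cases h : p <;> by_cases h' : p' <;> simp [ind_of, ind_of_not, h, h']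

theorem ind_mul_self (p : Prop) : ind p * ind p = ind p := by
  by_cases h : p <;> simp [ind_of, ind_of_not, h]

theorem sum_ind_eq {ι : Type*} [Fintype ι] (i : ι) : ∑ j, ind (j = i) = 1 := by
  classical simp [ind_eq_ite]

theorem sum_ind_mul_eq {ι : Type*} [Fintype ι] (i : ι) (f : ι → ℂ) :
    ∑ j, ind (j = i) * f j = f i := by
  classical simp [ind_eq_ite]

theorem sum_ind_mem_range {ι κ : Type*} [Fintype ι] [Fintype κ] {f : κ → ι}
    (hf : Injective f) (h : ι → ℂ) : ∑ i, ind (i ∈ Set.range f) * h i = ∑ c, h (f c) := by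
  classical
  simp only [ind_eq_ite, ite_mul, one_mul, zero_mul]
  rw [← Finset.sum_filter, ← Finset.sum_image (s := Finset.univ) (g := f) (f := h)
    (fun a _ b _ hab => hf hab)]
  congr 1
  ext i
  simp

end Indicator

/-! ### Character sums over vectors -/

section CharacterSums

variable {F : Type*} [Field F] [Fintype F] {ψ : AddChar F ℂ}

local notation "q" => ((Fintype.card F : ℕ) : ℂ)

theorem card_cast_ne_zero : q ≠ 0 := by
  simp

theorem sum_char_linear {V : Type*} [Fintype V] [AddCommGroup V] [Module F V] (hψ : ψ ≠ 1)
    (l : V →ₗ[F] F) : ∑ v, ψ (l v) = Fintype.card V * ind (l = 0) := by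
  by_cases h : l = 0
  · simp [h, ind_of]
  · rw [ind_of_not h, mul_zero]
    have h1 : ψ.compAddMonoidHom l.toAddMonoidHom ≠ 1 := by
      obtain ⟨r, hr⟩ := AddChar.ne_one_iff.1 hψ
      obtain ⟨v, hv⟩ : ∃ v, l v ≠ 0 := by
        by_contra hc
        push Not at hc
        exact h (LinearMap.ext hc)
      rw [AddChar.ne_one_iff]
      -- This multiple of `v` is sent by `l` to `r`, where `ψ` is nontrivial.
      refine ⟨(r * (l v)⁻¹) • v, ?_⟩
      simpa [hv] using hr
    exact AddChar.sum_eq_zero_of_ne_one h1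

theorem sum_char_dotProduct {n : Type*} [Fintype n] [DecidableEq n] (hψ : ψ ≠ 1) (w : n → F) :
    ∑ v : n → F, ψ (w ⬝ᵥ v) = q ^ Fintype.card n * ind (w = 0) := by
  classical
  have h := sum_char_linear hψ (dotProductBilin F F w)
  have h2 : dotProductBilin F F w = 0 ↔ w = 0 := by
    constructor
    · intro h
      ext i
      simpa using LinearMap.congr_fun h (Pi.single i 1)
    · rintro rfl; ext; simp
  rw [ind_congr h2] at h
  simpa using h

theorem sum_char_mul (hψ : ψ ≠ 1) (t : F) : ∑ r, ψ (r * t) = q * ind (t = 0) := by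
  have h := sum_char_linear hψ (LinearMap.mulLeft F t)
  have h2 : LinearMap.mulLeft F t = 0 ↔ t = 0 := by simp
  rw [ind_congr h2] at h
  simpa [mul_comm] using h

theorem ind_eq_sum_char (hψ : ψ ≠ 1) (t : F) : ind (t = 0) = q⁻¹ * ∑ r, ψ (r * t) := by
  rw [sum_char_mul hψ, inv_mul_cancel_left₀ card_cast_ne_zero]

variable {n k : Type*} [Fintype n] [Fintype k] [DecidableEq n] [DecidableEq k]

theorem smul_eq_zero_ind (r : F) (w : n → F) :
    ind (r • w = 0) = ind (r = 0) + ind (w = 0) - ind (r = 0) * ind (w = 0) := by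
  rw [ind_congr smul_eq_zero, ind_or]

theorem exists_char_ne_one : ∃ ψ : AddChar F ℂ, ψ ≠ 1 :=
  ⟨AddChar.FiniteField.primitiveChar_to_Complex F, by
    have h := AddChar.FiniteField.primitiveChar_to_Complex_isPrimitive F
    simpa using h one_ne_zero⟩

/-- The number of solutions of a linear equation `w ⬝ᵥ v = s`. -/
theorem sum_ind_dotProduct_eq {w : n → F} (hw : w ≠ 0) (s : F) :
    ∑ v : n → F, ind (w ⬝ᵥ v = s) = q ^ Fintype.card n / q := by
  obtain ⟨ψ, hψ⟩ := exists_char_ne_one (F := F)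
  -- The equation is detected by averaging characters over `r`; after summing over `v` only `r = 0`
  -- survives, as `w ≠ 0`.
  have h : ∀ v, ind (w ⬝ᵥ v = s) = q⁻¹ * ∑ r, ψ (-(r * s)) * ψ ((r • w) ⬝ᵥ v) := by
    intro v
    rw [← ind_congr sub_eq_zero, ind_eq_sum_char hψ]
    congr 1
    refine Finset.sum_congr rfl fun r _ => ?_
    rw [← AddChar.map_add_eq_mul, smul_dotProduct, smul_eq_mul]
    congr 1
    ring
  simp_rw [h]
  rw [← Finset.mul_sum, Finset.sum_comm]
  simp_rw [← Finset.mul_sum, sum_char_dotProduct hψ, smul_eq_zero_ind, ind_of_not hw]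
  have : ∀ r : F, ψ (-(r * s)) * (q ^ Fintype.card n * (ind (r = 0) + 0 - ind (r = 0) * 0)) =
      ind (r = 0) * (ψ (-(r * s)) * q ^ Fintype.card n) := fun r => by ring
  simp_rw [this, sum_ind_mul_eq]
  simp
  ring

theorem sum_ind_dotProduct_eq_zero (w : n → F) :
    ∑ v : n → F, ind (w ⬝ᵥ v = 0) = q ^ Fintype.card n / q +
      (q ^ Fintype.card n - q ^ Fintype.card n / q) * ind (w = 0) := by
  by_cases hw : w = 0
  · simp [hw, ind_of]
  · rw [sum_ind_dotProduct_eq hw, ind_of_not hw]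
    ring

theorem sum_ind_transpose_mulVec_eq_zero {P : Matrix n k F} (hP : Injective P.mulVec) :
    ∑ c : n → F, ind (Pᵀ *ᵥ c = 0) = q ^ Fintype.card n / q ^ Fintype.card k := by
  obtain ⟨ψ, hψ⟩ := exists_char_ne_one (F := F)
  have h : ∀ c, ind (Pᵀ *ᵥ c = 0) = (q ^ Fintype.card k)⁻¹ * ∑ e : k → F, ψ ((P *ᵥ e) ⬝ᵥ c) := by
    intro c
    have : ∀ e, (P *ᵥ e) ⬝ᵥ c = (Pᵀ *ᵥ c) ⬝ᵥ e := fun e => by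
      rw [dotProduct_comm, dotProduct_mulVec, mulVec_transpose]
    simp_rw [this]
    rw [sum_char_dotProduct hψ, inv_mul_cancel_left₀ (pow_ne_zero _ card_cast_ne_zero)]
  simp_rw [h]
  rw [← Finset.mul_sum, Finset.sum_comm]
  simp_rw [sum_char_dotProduct hψ, ind_congr (mulVec_eq_zero_iff_of_injective hP)]
  rw [← Finset.mul_sum, sum_ind_eq]
  ring

theorem sum_sum_char {m : Type*} [Fintype m] [DecidableEq m] (hψ : ψ ≠ 1) (a : m → F) (b : n → F) :
    ∑ u, ∑ v, ψ ((a ⬝ᵥ u) * (b ⬝ᵥ v)) = q ^ Fintype.card n * (q ^ Fintype.card m / q +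
      (q ^ Fintype.card m - q ^ Fintype.card m / q) *
        (ind (a = 0) + ind (b = 0) - ind (a = 0) * ind (b = 0))) := by
  have h : ∀ u, ∑ v, ψ ((a ⬝ᵥ u) * (b ⬝ᵥ v)) = q ^ Fintype.card n *
      (ind (a ⬝ᵥ u = 0) * (1 - ind (b = 0)) + ind (b = 0)) := by
    intro u
    have : ∀ v, (a ⬝ᵥ u) * (b ⬝ᵥ v) = ((a ⬝ᵥ u) • b) ⬝ᵥ v := fun v => by
      rw [smul_dotProduct, smul_eq_mul]
    simp_rw [this]
    rw [sum_char_dotProduct hψ, smul_eq_zero_ind]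
    ring
  simp_rw [h]
  rw [← Finset.mul_sum, Finset.sum_add_distrib, ← Finset.sum_mul, sum_ind_dotProduct_eq_zero]
  simp only [Finset.sum_const, Finset.card_univ, nsmul_eq_mul, Fintype.card_fun, Nat.cast_pow]
  ring

/-- The solutions `c` form the eigenspace, for the value `-r`, of the operator `c ↦ (a ⬝ᵥ c) b`. For
`r = -(a ⬝ᵥ b) ≠ 0` it is the line through `b`; for any other nonzero `r` it is zero. At `r = 0` it
is the kernel, and the last summand replaces the generic count by its size. -/
theorem sum_ind_eigenvector (a b : n → F) (r : F) :
    ∑ c, ind ((a ⬝ᵥ c) • b + r • c = 0) = 1 + (q - 1) * ind (r = -(a ⬝ᵥ b)) + ind (r = 0) *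
      (q ^ Fintype.card n / q + (q ^ Fintype.card n - q ^ Fintype.card n / q) *
        (ind (a = 0) + ind (b = 0) - ind (a = 0) * ind (b = 0)) - 1 -
          (q - 1) * ind (a ⬝ᵥ b = 0)) := by
  by_cases hr : r = 0
  · subst hr
    simp_rw [zero_smul, add_zero, smul_eq_zero_ind]
    rw [Finset.sum_sub_distrib, Finset.sum_add_distrib, ← Finset.sum_mul,
      sum_ind_dotProduct_eq_zero]
    have : (0 : F) = -(a ⬝ᵥ b) ↔ a ⬝ᵥ b = 0 := by rw [zero_eq_neg]
    rw [ind_congr this, ind_of (p := True) trivial]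
    simp
    ring
  · rw [ind_of_not hr, zero_mul, add_zero]
    by_cases ht : r = -(a ⬝ᵥ b)
    · rw [ind_of ht]
      have hab : a ⬝ᵥ b ≠ 0 := by rintro h; exact hr (by rw [ht, h, neg_zero])
      have hinj : Injective fun s : F => s • b := by
        intro s s' h
        have : (s - s') • b = 0 := by rw [sub_smul]; exact sub_eq_zero.2 h
        rcases smul_eq_zero.1 this with h | h
        · exact sub_eq_zero.1 h
        · simp [h] at hab
      have h : ∀ c, (a ⬝ᵥ c) • b + r • c = 0 ↔ c ∈ Set.range fun s : F => s • b := by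
        intro c
        constructor
        · intro h
          refine ⟨-(r⁻¹ * (a ⬝ᵥ c)), ?_⟩
          simp only
          rw [neg_smul, mul_smul, eq_neg_of_add_eq_zero_left h, smul_neg, neg_neg,
            inv_smul_smul₀ hr]
        · rintro ⟨s, rfl⟩
          rw [ht, dotProduct_smul, smul_smul, ← add_smul]
          simp [mul_comm]
      simp_rw [fun c => ind_congr (h c)]
      have := sum_ind_mem_range hinj fun _ => 1
      simp only [mul_one] at this
      rw [this]
      simp
    · rw [ind_of_not ht]
      have h : ∀ c, (a ⬝ᵥ c) • b + r • c = 0 ↔ c = 0 := by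
        intro c
        constructor
        · intro h
          have h1 := congrArg (a ⬝ᵥ ·) h
          simp only [dotProduct_add, dotProduct_smul, smul_eq_mul, dotProduct_zero] at h1
          have h2 : (a ⬝ᵥ c) * (r + a ⬝ᵥ b) = 0 := by linear_combination h1
          have h3 : a ⬝ᵥ c = 0 :=
            (mul_eq_zero.1 h2).resolve_right fun h => ht (eq_neg_of_add_eq_zero_left h)
          rw [h3, zero_smul, zero_add] at h
          exact (smul_eq_zero.1 h).resolve_left hr
        · rintro rfl; simp
      simp_rw [fun c => ind_congr (h c), sum_ind_eq]
      ring

/-- Detecting `d ⬝ᵥ c = s` by characters indexed by `r` and summing over `d` leaves the eigenvector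
equation of `sum_ind_eigenvector`. The exceptional values `r = -(a ⬝ᵥ b)` and `r = 0` are what
produce the functions `ψ(⟨C, PQ⟩)` and the indicator of `⟨C, PQ⟩ = 0` in the transforms of the
cells. -/
theorem sum_sum_ind_dotProduct_mul_char (hψ : ψ ≠ 1) (a b : n → F) (s : F) :
    ∑ c, ∑ d, ind (d ⬝ᵥ c = s) * ψ ((a ⬝ᵥ c) * (b ⬝ᵥ d)) = q ^ Fintype.card n / q *
      (q ^ Fintype.card n / q + (q ^ Fintype.card n - q ^ Fintype.card n / q) *
        (ind (a = 0) + ind (b = 0) - ind (a = 0) * ind (b = 0)) + (q * ind (s = 0) - 1) +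
          (q - 1) * (ψ ((a ⬝ᵥ b) * s) - ind (a ⬝ᵥ b = 0))) := by
  have h : ∀ c d, ind (d ⬝ᵥ c = s) * ψ ((a ⬝ᵥ c) * (b ⬝ᵥ d)) =
      q⁻¹ * ∑ r, ψ (-(r * s)) * ψ (((a ⬝ᵥ c) • b + r • c) ⬝ᵥ d) := by
    intro c d
    rw [← ind_congr sub_eq_zero, ind_eq_sum_char hψ, mul_assoc, Finset.sum_mul]
    congr 1
    refine Finset.sum_congr rfl fun r _ => ?_
    rw [← AddChar.map_add_eq_mul, ← AddChar.map_add_eq_mul, add_dotProduct, smul_dotProduct,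
      smul_dotProduct, smul_eq_mul, smul_eq_mul, dotProduct_comm d c]
    congr 1
    ring
  simp_rw [h, ← Finset.mul_sum]
  simp_rw [Finset.sum_comm (γ := n → F) (α := F), ← Finset.mul_sum, sum_char_dotProduct hψ]
  simp_rw [← Finset.mul_sum, sum_ind_eigenvector]
  have e : ∀ (r : F) (X : ℂ), ψ (-(r * s)) * (q ^ Fintype.card n * (1 + (q - 1) *
      ind (r = -(a ⬝ᵥ b)) + ind (r = 0) * X)) = q ^ Fintype.card n * (ψ (r * -s) +
        ind (r = -(a ⬝ᵥ b)) * ((q - 1) * ψ (-(r * s))) + ind (r = 0) * (ψ (-(r * s)) * X)) := by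
    intro r X
    rw [← mul_neg]
    ring
  simp_rw [e, ← Finset.mul_sum, Finset.sum_add_distrib, sum_ind_mul_eq, sum_char_mul hψ,
    ind_congr neg_eq_zero]
  by_cases hab : a ⬝ᵥ b = 0
  · simp [hab, ind_of]
    ring
  · simp [ind_of_not hab]
    ring

theorem exists_smul_of_vecMulVec_eq {m : Type*} {a u : m → F} {b v : n → F} (hu : u ≠ 0)
    (hv : v ≠ 0) (h : vecMulVec u v = vecMulVec a b) :
    ∃ r : F, r ≠ 0 ∧ u = r • a ∧ v = r⁻¹ • b := by
  have h' : ∀ i j, u i * v j = a i * b j := fun i j => congrFun (congrFun h i) j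
  obtain ⟨j, hj⟩ := Function.ne_iff.1 hv
  obtain ⟨i, hi⟩ := Function.ne_iff.1 hu
  simp only [Pi.zero_apply] at hi hj
  have hbj : b j ≠ 0 := by
    intro h0
    have := h' i j
    rw [h0, mul_zero] at this
    exact mul_ne_zero hi hj this
  have hu' : u = (b j / v j) • a := by
    ext l
    rw [Pi.smul_apply, smul_eq_mul]
    field_simp
    rw [h']; ring
  refine ⟨b j / v j, div_ne_zero hbj hj, hu', ?_⟩
  have hai : a i ≠ 0 := by
    intro h0
    rw [hu', Pi.smul_apply, h0] at hi
    simp at hi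
  ext l
  have := h' i l
  rw [hu', Pi.smul_apply, smul_eq_mul] at this
  rw [Pi.smul_apply, smul_eq_mul]
  field_simp at this ⊢
  linear_combination this

end CharacterSums

/-! ### Sums over rank-one matrices -/

section RankOneSums

variable {F : Type*} [Field F] [Fintype F] {m n : Type*} [Fintype m] [Fintype n]
  [DecidableEq m] [DecidableEq n]

local notation "q" => ((Fintype.card F : ℕ) : ℂ)

/-- Each rank-one matrix `a bᵀ` has exactly `q - 1` factorizations, namely `(r a, r⁻¹ b)` with `r ≠
0`. -/
theorem sum_nonzero_pairs (g : Matrix m n F → ℂ) :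
    ∑ u, ∑ v, ind (u ≠ 0) * ind (v ≠ 0) * g (vecMulVec u v) =
      (q - 1) * ∑ z, ind (z.rank = 1) * g z := by
  classical
  have h1 : ∑ u, ∑ v, ind (u ≠ 0) * ind (v ≠ 0) * g (vecMulVec u v) =
      ∑ p ∈ Finset.univ.filter fun p : (m → F) × (n → F) => p.1 ≠ 0 ∧ p.2 ≠ 0,
        g (vecMulVec p.1 p.2) := by
    rw [Finset.sum_filter, Fintype.sum_prod_type]
    refine Finset.sum_congr rfl fun u _ => Finset.sum_congr rfl fun v _ => ?_
    rw [← ind_and, ind_eq_ite]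
    simp
  have h2 : ∑ z : Matrix m n F, ind (z.rank = 1) * g z =
      ∑ z ∈ Finset.univ.filter fun z : Matrix m n F => z.rank = 1, g z := by
    rw [Finset.sum_filter]
    refine Finset.sum_congr rfl fun u _ => ?_
    rw [ind_eq_ite]
    simp
  rw [h1, h2, Finset.mul_sum, ← Finset.sum_fiberwise_of_maps_to (g := fun p => vecMulVec p.1 p.2)
    (t := Finset.univ.filter fun z : Matrix m n F => z.rank = 1)]
  · refine Finset.sum_congr rfl fun z hz => ?_
    rw [Finset.sum_congr rfl (g := fun _ => g z)
      (fun p hp => by rw [(Finset.mem_filter.1 hp).2]), Finset.sum_const, nsmul_eq_mul]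
    congr 1
    obtain ⟨a, b, ha, hb, rfl⟩ := exists_eq_vecMulVec_of_rank_eq_one (Finset.mem_filter.1 hz).2
    have hc : (Finset.univ.erase (0 : F)).card = Fintype.card F - 1 := by
      rw [Finset.card_erase_of_mem (Finset.mem_univ _), Finset.card_univ]
    have hq : 1 ≤ Fintype.card F := Fintype.card_pos
    rw [← Nat.cast_one, ← Nat.cast_sub hq, ← hc]
    congr 1
    symm
    refine Finset.card_bij (fun r _ => (r • a, r⁻¹ • b)) ?_ ?_ ?_
    · intro r hr
      have hr0 : r ≠ 0 := Finset.ne_of_mem_erase hr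
      simp [ha, hb, hr0, smul_vecMulVec, vecMulVec_smul, smul_smul]
    · intro r _ s _ h
      have h' := congrArg Prod.fst h
      simp only at h'
      have : (r - s) • a = 0 := by rw [sub_smul]; exact sub_eq_zero.2 h'
      exact sub_eq_zero.1 ((smul_eq_zero.1 this).resolve_right ha)
    · rintro ⟨u, v⟩ hp
      simp only [Finset.mem_filter, Finset.mem_univ, true_and] at hp
      obtain ⟨r, hr, hu, hv⟩ := exists_smul_of_vecMulVec_eq hp.1.1 hp.1.2 hp.2
      exact ⟨r, by simp [hr], by rw [hu, hv]⟩
  · intro p hp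
    simp only [Finset.mem_filter, Finset.mem_univ, true_and] at hp ⊢
    exact rank_vecMulVec_eq_one hp.1 hp.2

end RankOneSums

/-! ### Fourier transform on the group of matrices -/

section Fourier

variable {F : Type*} [Field F] {m n : Type*} [Fintype m] [Fintype n]

/-- The trace form on matrices. -/
def pairing (B z : Matrix m n F) : F := ∑ i, B i ⬝ᵥ z i

theorem pairing_comm (B z : Matrix m n F) : pairing B z = pairing z B := by
  simp only [pairing, dotProduct_comm]

theorem pairing_add_right (B z z' : Matrix m n F) :
    pairing B (z + z') = pairing B z + pairing B z' := by
  simp only [pairing, ← Finset.sum_add_distrib]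
  exact Finset.sum_congr rfl fun i _ => dotProduct_add _ _ _

theorem pairing_add_left (B C z : Matrix m n F) :
    pairing (B + C) z = pairing B z + pairing C z := by
  rw [pairing_comm, pairing_add_right, pairing_comm z, pairing_comm z]

theorem pairing_smul_right (r : F) (B z : Matrix m n F) :
    pairing B (r • z) = r * pairing B z := by
  simp only [pairing, Finset.mul_sum]
  exact Finset.sum_congr rfl fun i _ => dotProduct_smul r (B i) (z i)

theorem pairing_smul_left (r : F) (B z : Matrix m n F) :
    pairing (r • B) z = r * pairing B z := by
  rw [pairing_comm, pairing_smul_right, pairing_comm]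

theorem pairing_neg_left (B z : Matrix m n F) : pairing (-B) z = -pairing B z := by
  rw [← neg_one_smul F B, pairing_smul_left, neg_one_mul]

theorem pairing_neg_right (B z : Matrix m n F) : pairing B (-z) = -pairing B z := by
  rw [pairing_comm, pairing_neg_left, pairing_comm]

theorem pairing_sub_left (B C z : Matrix m n F) :
    pairing (B - C) z = pairing B z - pairing C z := by
  rw [sub_eq_add_neg, pairing_add_left, pairing_neg_left, sub_eq_add_neg]

theorem pairing_zero_left (z : Matrix m n F) : pairing 0 z = 0 := by
  rw [← zero_smul F (0 : Matrix m n F), pairing_smul_left, zero_mul]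

theorem pairing_zero_right (B : Matrix m n F) : pairing B 0 = 0 := by
  rw [pairing_comm, pairing_zero_left]

theorem pairing_vecMulVec_left (a : m → F) (b : n → F) (z : Matrix m n F) :
    pairing (vecMulVec a b) z = a ⬝ᵥ z *ᵥ b := by
  simp only [pairing, dotProduct, mulVec, vecMulVec_apply, Finset.mul_sum]
  exact Finset.sum_congr rfl fun i _ => Finset.sum_congr rfl fun j _ => by ring

theorem pairing_vecMulVec (a u : m → F) (b v : n → F) :
    pairing (vecMulVec a b) (vecMulVec u v) = (a ⬝ᵥ u) * (b ⬝ᵥ v) := by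
  rw [pairing_vecMulVec_left, vecMulVec_mulVec, dotProduct_comm v b]
  simp [dotProduct_smul, mul_comm]

variable [Fintype F] [DecidableEq m] [DecidableEq n] {ψ : AddChar F ℂ}

local notation "q" => ((Fintype.card F : ℕ) : ℂ)

theorem sum_char_pairing (hψ : ψ ≠ 1) (z : Matrix m n F) :
    ∑ B, ψ (pairing B z) = Fintype.card (Matrix m n F) * ind (z = 0) := by
  let l : Matrix m n F →ₗ[F] F :=
    { toFun := fun B => pairing B z
      map_add' := fun B C => pairing_add_left B C z
      map_smul' := fun r B => pairing_smul_left r B z }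
  have h : l = 0 ↔ z = 0 := by
    constructor
    · intro h
      ext i j
      have := LinearMap.congr_fun h (vecMulVec (Pi.single i 1) (Pi.single j 1))
      change pairing _ z = 0 at this
      rw [pairing_vecMulVec_left] at this
      simpa using this
    · rintro rfl
      ext B
      simp [l, pairing_zero_right]
  rw [← ind_congr h]
  exact sum_char_linear hψ l

/-- The Fourier transform of a real vector on the space of matrices, centred at `x`. -/
noncomputable def fourier (ψ : AddChar F ℂ) (x : Matrix m n F) (v : Matrix m n F → ℝ)
    (B : Matrix m n F) : ℂ :=
  ∑ z, (v z : ℂ) * ψ (pairing B (z - x))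

variable (x : Matrix m n F)

theorem fourier_add (u v : Matrix m n F → ℝ) (B : Matrix m n F) :
    fourier ψ x (u + v) B = fourier ψ x u B + fourier ψ x v B := by
  simp [fourier, add_mul, Finset.sum_add_distrib]

theorem fourier_smul (r : ℝ) (v : Matrix m n F → ℝ) (B : Matrix m n F) :
    fourier ψ x (r • v) B = r * fourier ψ x v B := by
  simp [fourier, mul_assoc, Finset.mul_sum]

theorem fourier_zero (B : Matrix m n F) : fourier ψ x 0 B = 0 := by
  simp [fourier]

theorem fourier_sub (u v : Matrix m n F → ℝ) (B : Matrix m n F) :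
    fourier ψ x (u - v) B = fourier ψ x u B - fourier ψ x v B := by
  simp [fourier, sub_mul, Finset.sum_sub_distrib]

theorem ind_re_cast (p : Prop) : (((ind p).re : ℝ) : ℂ) = ind p := by
  by_cases h : p <;> simp [ind_of, ind_of_not, h]

theorem hat_apply {X : Type*} (p z : X) : hat p z = (ind (z = p)).re := by
  classical
  by_cases h : z = p
  · subst h
    simp [hat, ind_of]
  · simp [hat, ind_of_not h, Pi.single_eq_of_ne h]

theorem fourier_hat (p B : Matrix m n F) : fourier ψ x (hat p) B = ψ (pairing B (p - x)) := by
  simp_rw [fourier, hat_apply, ind_re_cast, sum_ind_mul_eq]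

theorem card_matrix_ne_zero : (Fintype.card (Matrix m n F) : ℂ) ≠ 0 := by
  simp

theorem fourier_inversion (hψ : ψ ≠ 1) (v : Matrix m n F → ℝ) (z : Matrix m n F) :
    (v z : ℂ) = (Fintype.card (Matrix m n F) : ℂ)⁻¹ *
      ∑ B, ψ (-pairing B (z - x)) * fourier ψ x v B := by
  rw [eq_inv_mul_iff_mul_eq₀ card_matrix_ne_zero]
  simp only [fourier, Finset.mul_sum]
  rw [Finset.sum_comm]
  have h : ∀ z', ∑ B, ψ (-pairing B (z - x)) * ((v z' : ℂ) * ψ (pairing B (z' - x))) =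
      ind (z' = z) * (Fintype.card (Matrix m n F) * (v z' : ℂ)) := by
    intro z'
    have e : ∀ B, ψ (-pairing B (z - x)) * ((v z' : ℂ) * ψ (pairing B (z' - x))) =
        (v z' : ℂ) * ψ (pairing B (z' - z)) := by
      intro B
      rw [mul_left_comm, ← AddChar.map_add_eq_mul, ← pairing_neg_right, ← pairing_add_right]
      congr 3
      abel
    simp_rw [e]
    rw [← Finset.mul_sum, sum_char_pairing hψ, ind_congr sub_eq_zero]
    ring
  simp_rw [h]
  rw [sum_ind_mul_eq]

theorem eq_of_fourier_eq (hψ : ψ ≠ 1) {u v : Matrix m n F → ℝ}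
    (h : ∀ B, fourier ψ x u B = fourier ψ x v B) : u = v := by
  ext z
  have := fourier_inversion x hψ u z
  simp_rw [h] at this
  rw [← fourier_inversion x hψ v z] at this
  exact_mod_cast this

theorem parseval (hψ : ψ ≠ 1) (u v : Matrix m n F → ℝ) :
    ((u ⬝ᵥ v : ℝ) : ℂ) = (Fintype.card (Matrix m n F) : ℂ)⁻¹ *
      ∑ B, fourier ψ x u (-B) * fourier ψ x v B := by
  have h : ((u ⬝ᵥ v : ℝ) : ℂ) = ∑ z, (u z : ℂ) * (v z : ℂ) := by simp [dotProduct]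
  simp_rw [h, fourier_inversion x hψ v, mul_left_comm _ ((_ : ℂ)⁻¹)]
  rw [← Finset.mul_sum]
  congr 1
  simp_rw [Finset.mul_sum]
  rw [Finset.sum_comm]
  refine Finset.sum_congr rfl fun B _ => ?_
  conv_rhs => rw [fourier, Finset.sum_mul]
  refine Finset.sum_congr rfl fun z _ => ?_
  rw [pairing_neg_left]
  ring

theorem sum_nonzero (f : (m → F) → (n → F) → ℂ) :
    ∑ u, ∑ v, ind (u ≠ 0) * ind (v ≠ 0) * f u v =
      ∑ u, ∑ v, f u v - ∑ v, f 0 v - ∑ u, f u 0 + f 0 0 := by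
  have e : ∀ u v, ind (u ≠ 0) * ind (v ≠ 0) * f u v = f u v - ind (u = 0) * f u v -
      ind (v = 0) * f u v + ind (v = 0) * (ind (u = 0) * f u v) := by
    intro u v
    simp only [Ne, ind_not]
    ring
  simp_rw [e, Finset.sum_add_distrib, Finset.sum_sub_distrib, sum_ind_mul_eq,
    ← Finset.mul_sum, sum_ind_mul_eq]

/-- Summing over all pairs `(u, v)`, the sum over `u` forces `B v = 0`, so the size of the kernel of
`B` brings in its rank; the pairs with a zero entry account for the remaining terms. -/
theorem sum_char_rank_one (hψ : ψ ≠ 1) (B : Matrix m n F) :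
    (q - 1) * ∑ C : Matrix m n F, ind (C.rank = 1) * ψ (pairing B C) =
      q ^ Fintype.card m * q ^ Fintype.card n / q ^ B.rank -
        q ^ Fintype.card m - q ^ Fintype.card n + 1 := by
  rw [← sum_nonzero_pairs, sum_nonzero]
  have e : ∀ u v, pairing B (vecMulVec u v) = (B *ᵥ v) ⬝ᵥ u := fun u v => by
    rw [pairing_comm, pairing_vecMulVec_left, dotProduct_comm]
  simp_rw [e]
  obtain ⟨P, Q, hB, hP, hQ⟩ := exists_rank_factorization B
  have h0 : ∀ v, B *ᵥ v = 0 ↔ Qᵀᵀ *ᵥ v = 0 := by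
    intro v
    rw [transpose_transpose]
    conv_lhs => rw [hB, ← mulVec_mulVec]
    exact mulVec_eq_zero_iff_of_injective hP
  rw [Finset.sum_comm]
  simp_rw [sum_char_dotProduct hψ, ind_congr (h0 _)]
  rw [← Finset.mul_sum, sum_ind_transpose_mulVec_eq_zero hQ]
  simp [ind_of]
  ring

end Fourier

/-! ### Spectrum of the graph, and `E` on the Fourier side -/

section Spectrum

variable {F : Type*} [Field F] [Fintype F] {D M : ℕ} {ψ : AddChar F ℂ}

theorem one_lt_card : (1 : ℝ) < Fintype.card F := by
  exact_mod_cast Fintype.one_lt_card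

/-- The eigenvalue of the bilinear forms graph on the characters attached to rank `r` matrices. -/
noncomputable def rankEigenvalue (F : Type*) [Fintype F] (D M r : ℕ) : ℝ :=
  ((Fintype.card F : ℝ) ^ D * (Fintype.card F : ℝ) ^ M / (Fintype.card F : ℝ) ^ r -
    (Fintype.card F : ℝ) ^ D - (Fintype.card F : ℝ) ^ M + 1) / ((Fintype.card F : ℝ) - 1)

/-- Strictness means that eigenvalues separate ranks: the second eigenspace involves only characters
attached to rank-one matrices. -/
theorem rankEigenvalue_strictAnti : StrictAnti (rankEigenvalue F D M) := by
  intro r s h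
  have hq := one_lt_card (F := F)
  have hq0 : (0 : ℝ) < Fintype.card F := by linarith
  unfold rankEigenvalue
  gcongr

theorem sum_char_rank_one_eq (hψ : ψ ≠ 1) (B : Matrix (Fin D) (Fin M) F) :
    ∑ C : Matrix (Fin D) (Fin M) F, ind (C.rank = 1) * ψ (pairing B C) =
      (rankEigenvalue F D M B.rank : ℂ) := by
  have h := sum_char_rank_one hψ B
  have hq : ((Fintype.card F : ℕ) : ℂ) - 1 ≠ 0 := by
    have := one_lt_card (F := F)
    have h2 : ((Fintype.card F : ℝ) - 1 : ℝ) ≠ 0 := by linarith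
    exact_mod_cast h2
  rw [rankEigenvalue]
  push_cast
  rw [eq_div_iff hq, mul_comm, h]
  simp

theorem adjacency_mulVec (v : Matrix (Fin D) (Fin M) F → ℝ) (z : Matrix (Fin D) (Fin M) F) :
    ((adjacency (graph F D M) *ᵥ v) z : ℂ) = ∑ z', ind ((z - z').rank = 1) * (v z' : ℂ) := by
  classical
  unfold adjacency
  simp only [mulVec, dotProduct, SimpleGraph.adjMatrix_apply]
  push_cast
  refine Finset.sum_congr rfl fun z' _ => ?_
  by_cases h : (z - z').rank = 1
  · rw [ind_of h, if_pos (show (graph F D M).Adj z z' from h), Complex.ofReal_one]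
  · rw [ind_of_not h, if_neg (show ¬(graph F D M).Adj z z' from h), Complex.ofReal_zero]

theorem fourier_adjacency (hψ : ψ ≠ 1) (x : Matrix (Fin D) (Fin M) F)
    (v : Matrix (Fin D) (Fin M) F → ℝ) (B : Matrix (Fin D) (Fin M) F) :
    fourier ψ x (adjacency (graph F D M) *ᵥ v) B =
      rankEigenvalue F D M B.rank * fourier ψ x v B := by
  unfold fourier
  simp_rw [adjacency_mulVec, Finset.sum_mul]
  rw [Finset.sum_comm, Finset.mul_sum]
  refine Finset.sum_congr rfl fun z' _ => ?_
  rw [← Equiv.sum_comp (Equiv.addRight z'), ← sum_char_rank_one_eq hψ, Finset.sum_mul]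
  refine Finset.sum_congr rfl fun C _ => ?_
  simp only [Equiv.coe_addRight, add_sub_cancel_right]
  rw [add_sub_assoc, pairing_add_right, AddChar.map_add_eq_mul]
  ring

theorem adjacency_char (hψ : ψ ≠ 1) (x B z : Matrix (Fin D) (Fin M) F) :
    ∑ z', ind ((z - z').rank = 1) * ψ (pairing B (z' - x)) =
      rankEigenvalue F D M B.rank * ψ (pairing B (z - x)) := by
  rw [← Equiv.sum_comp (Equiv.addRight z), ← sum_char_rank_one_eq hψ, Finset.sum_mul]
  refine Finset.sum_congr rfl fun C _ => ?_
  simp only [Equiv.coe_addRight]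
  rw [rank_sub_comm, add_sub_cancel_right, add_sub_assoc, pairing_add_right,
    AddChar.map_add_eq_mul]
  ring

theorem ind_mul_re (p : Prop) (w : ℂ) : (ind p * w).re = (ind p).re * w.re := by
  by_cases h : p <;> simp [ind_of, ind_of_not, h]

theorem ind_mul_im (p : Prop) (w : ℂ) : (ind p * w).im = (ind p).re * w.im := by
  by_cases h : p <;> simp [ind_of, ind_of_not, h]

/-- The idempotent is a real projection, so complex characters have to be used through their real
and imaginary parts, both real eigenvectors. -/
theorem adjacency_mulVec_re (v : Matrix (Fin D) (Fin M) F → ℝ) (z : Matrix (Fin D) (Fin M) F) :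
    (adjacency (graph F D M) *ᵥ v) z = ∑ z', (ind ((z - z').rank = 1)).re * v z' := by
  have h := adjacency_mulVec v z
  have e : ∀ z', ind ((z - z').rank = 1) * (v z' : ℂ) =
      (((ind ((z - z').rank = 1)).re * v z' : ℝ) : ℂ) := fun z' => by
    rw [Complex.ofReal_mul, ind_re_cast]
  simp_rw [e] at h
  exact_mod_cast h

theorem adjacency_mulVec_char_re (hψ : ψ ≠ 1) (x B : Matrix (Fin D) (Fin M) F) :
    adjacency (graph F D M) *ᵥ (fun z => (ψ (pairing B (z - x))).re) =
      rankEigenvalue F D M B.rank • fun z => (ψ (pairing B (z - x))).re := by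
  ext z
  rw [adjacency_mulVec_re]
  have h := congrArg Complex.re (adjacency_char hψ x B z)
  rw [Complex.re_sum] at h
  simp_rw [ind_mul_re] at h
  rw [h]
  simp

theorem adjacency_mulVec_char_im (hψ : ψ ≠ 1) (x B : Matrix (Fin D) (Fin M) F) :
    adjacency (graph F D M) *ᵥ (fun z => (ψ (pairing B (z - x))).im) =
      rankEigenvalue F D M B.rank • fun z => (ψ (pairing B (z - x))).im := by
  ext z
  rw [adjacency_mulVec_re]
  have h := congrArg Complex.im (adjacency_char hψ x B z)
  rw [Complex.im_sum] at h
  simp_rw [ind_mul_im] at h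
  rw [h]
  simp

theorem isEigenvalue_iff {X : Type*} [Fintype X] (A : Matrix X X ℝ) (θ : ℝ) :
    IsEigenvalue A θ ↔ ∃ v, v ≠ 0 ∧ A *ᵥ v = θ • v := by
  classical
  unfold IsEigenvalue
  constructor
  · intro h
    obtain ⟨v, hv⟩ := h.exists_hasEigenvector
    exact ⟨v, hv.2, hv.apply_eq_smul⟩
  · rintro ⟨v, hv, h⟩
    exact Module.End.hasEigenvalue_of_hasEigenvector (x := v)
      ⟨Module.End.mem_eigenspace_iff.2 h, hv⟩

theorem isEigenvalue_adjacency_iff (θ : ℝ) :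
    IsEigenvalue (adjacency (graph F D M)) θ ↔
      ∃ B : Matrix (Fin D) (Fin M) F, θ = rankEigenvalue F D M B.rank := by
  obtain ⟨ψ, hψ⟩ := exists_char_ne_one (F := F)
  rw [isEigenvalue_iff]
  constructor
  · rintro ⟨v, hv, h⟩
    by_contra hc
    push Not at hc
    apply hv
    apply eq_of_fourier_eq 0 hψ
    intro B
    rw [fourier_zero]
    have h1 := fourier_adjacency hψ 0 v B
    rw [h, fourier_smul] at h1
    have h2 : ((θ : ℂ) - rankEigenvalue F D M B.rank) * fourier ψ 0 v B = 0 := by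
      linear_combination h1
    refine (mul_eq_zero.1 h2).resolve_left ?_
    rw [← Ne, sub_ne_zero]
    exact_mod_cast hc B
  · rintro ⟨B, rfl⟩
    refine ⟨_, ?_, adjacency_mulVec_char_re hψ 0 B⟩
    intro h
    simpa [pairing_zero_right] using congrFun h 0

theorem secondEigenvalue_adjacency (hD : 0 < D) (hM : 0 < M) :
    secondEigenvalue (adjacency (graph F D M)) = rankEigenvalue F D M 1 := by
  have h0 : IsEigenvalue (adjacency (graph F D M)) (rankEigenvalue F D M 0) :=
    (isEigenvalue_adjacency_iff _).2 ⟨0, by rw [rank_zero]⟩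
  have h1 : IsEigenvalue (adjacency (graph F D M)) (rankEigenvalue F D M 1) := by
    refine (isEigenvalue_adjacency_iff _).2
      ⟨vecMulVec (Pi.single ⟨0, hD⟩ 1) (Pi.single ⟨0, hM⟩ 1), ?_⟩
    rw [rank_vecMulVec_eq_one] <;> simp
  apply IsGreatest.csSup_eq
  refine ⟨⟨h1, _, h0, rankEigenvalue_strictAnti Nat.zero_lt_one⟩, ?_⟩
  rintro θ ⟨hθ, θ', hθ', hlt⟩
  obtain ⟨B, rfl⟩ := (isEigenvalue_adjacency_iff _).1 hθ
  obtain ⟨B', rfl⟩ := (isEigenvalue_adjacency_iff _).1 hθ'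
  apply rankEigenvalue_strictAnti.antitone
  have := rankEigenvalue_strictAnti.lt_iff_gt.1 hlt
  omega

/-- At rank `r`, the projection differs from `v` by a vector orthogonal to the real and imaginary
parts of the character, so the coefficients agree. At other ranks, the projection has a different
eigenvalue from the character, so its coefficient vanishes. -/
theorem fourier_primitiveIdempotent (hψ : ψ ≠ 1) (r : ℕ) (x : Matrix (Fin D) (Fin M) F)
    (v : Matrix (Fin D) (Fin M) F → ℝ) (B : Matrix (Fin D) (Fin M) F) :
    fourier ψ x (primitiveIdempotent (adjacency (graph F D M)) (rankEigenvalue F D M r) *ᵥ v) B =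
      ind (B.rank = r) * fourier ψ x v B := by
  classical
  set A := adjacency (graph F D M) with hA
  set θ := rankEigenvalue F D M r with hθ
  set w := primitiveIdempotent A θ *ᵥ v with hw
  rw [primitiveIdempotent_mulVec] at hw
  have hmem : WithLp.toLp 2 w ∈ eigenspace A θ := by
    rw [hw]
    exact Submodule.starProjection_apply_mem _ _
  have hAw : A *ᵥ w = θ • w := by
    rw [eigenspace, Module.End.mem_eigenspace_iff] at hmem
    exact congrArg WithLp.ofLp hmem
  by_cases hB : B.rank = r
  · rw [ind_of hB, one_mul, ← sub_eq_zero, ← fourier_sub]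
    have horth : ∀ u : Matrix (Fin D) (Fin M) F → ℝ, A *ᵥ u = θ • u → u ⬝ᵥ (w - v) = 0 := by
      intro u hu
      have hu' : WithLp.toLp 2 u ∈ eigenspace A θ := by
        rw [eigenspace, Module.End.mem_eigenspace_iff]
        exact congrArg (WithLp.toLp 2) hu
      have h := Submodule.sub_starProjection_mem_orthogonal (K := eigenspace A θ)
        (WithLp.toLp 2 v)
      rw [Submodule.mem_orthogonal] at h
      have h2 := h _ hu'
      rw [EuclideanSpace.inner_eq_star_dotProduct] at h2
      have h3 : (v - w) ⬝ᵥ u = 0 := by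
        rw [hw]
        simpa using h2
      rw [dotProduct_comm, ← neg_sub, neg_dotProduct, h3, neg_zero]
    have hre := horth _ (by rw [hA, adjacency_mulVec_char_re hψ x B, hB])
    have him := horth _ (by rw [hA, adjacency_mulVec_char_im hψ x B, hB])
    simp only [dotProduct] at hre him
    apply Complex.ext
    · rw [fourier, Complex.re_sum]
      simpa [mul_comm] using hre
    · rw [fourier, Complex.im_sum]
      simpa [mul_comm] using him
  · rw [ind_of_not hB, zero_mul]
    have h1 := fourier_adjacency hψ x w B
    rw [← hA, hAw, fourier_smul] at h1
    have h2 : ((θ : ℂ) - rankEigenvalue F D M B.rank) * fourier ψ x w B = 0 := by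
      linear_combination h1
    refine (mul_eq_zero.1 h2).resolve_left ?_
    rw [← Ne, sub_ne_zero]
    intro h
    apply hB
    exact (rankEigenvalue_strictAnti (F := F) (D := D) (M := M)).injective
      (by exact_mod_cast h.symm)

theorem fourier_idempotent (hD : 0 < D) (hM : 0 < M) (hψ : ψ ≠ 1)
    (x : Matrix (Fin D) (Fin M) F) (v : Matrix (Fin D) (Fin M) F → ℝ)
    (B : Matrix (Fin D) (Fin M) F) :
    fourier ψ x (idempotent F D M *ᵥ v) B = ind (B.rank = 1) * fourier ψ x v B := by
  rw [idempotent, secondEigenvalue_adjacency hD hM, fourier_primitiveIdempotent hψ]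

/-- The transform of an entrywise product is a convolution, and `E p̂` has coefficient `ψ(⟨B, p -
x⟩)` on rank-one `B` and zero elsewhere. -/
theorem fourier_norton (hD : 0 < D) (hM : 0 < M) (hψ : ψ ≠ 1)
    (x p : Matrix (Fin D) (Fin M) F) (w : Matrix (Fin D) (Fin M) F → ℝ)
    (B : Matrix (Fin D) (Fin M) F) (hB : B.rank = 1) :
    fourier ψ x (norton (idempotent F D M) (idempotent F D M *ᵥ hat p) w) B =
      (Fintype.card (Matrix (Fin D) (Fin M) F) : ℂ)⁻¹ *
        ∑ C, ind ((B - C).rank = 1) * (ψ (pairing (B - C) (p - x)) * fourier ψ x w C) := by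
  rw [norton, fourier_idempotent hD hM hψ, ind_of hB, one_mul, fourier]
  simp only [Pi.mul_apply]
  push_cast
  simp_rw [fourier_inversion x hψ (idempotent F D M *ᵥ hat p), fourier_idempotent hD hM hψ,
    fourier_hat, mul_assoc]
  rw [← Finset.mul_sum]
  congr 1
  simp_rw [Finset.sum_mul]
  rw [Finset.sum_comm, ← Equiv.sum_comp (Equiv.subLeft B)]
  refine Finset.sum_congr rfl fun C _ => ?_
  simp only [Equiv.subLeft_apply, fourier, Finset.mul_sum]
  refine Finset.sum_congr rfl fun z _ => ?_
  have h : ψ (pairing C (z - x)) = ψ (-pairing (B - C) (z - x)) * ψ (pairing B (z - x)) := by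
    rw [← AddChar.map_add_eq_mul, pairing_sub_left]
    congr 1
    ring
  rw [h]
  ring

end Spectrum

/-! ### Sums over common neighbours -/

section CommonNeighbours

variable {F : Type*} [Field F] [Fintype F] {m n : Type*} [Fintype m] [Fintype n]
  [DecidableEq m] [DecidableEq n]

theorem sum_ind_exists {ι κ : Type*} [Fintype ι] [Fintype κ] {f : κ → ι} (hf : Injective f)
    (p : κ → Prop) (h : ι → ℂ) :
    ∑ i, ind (∃ c, p c ∧ f c = i) * h i = ∑ c, ind (p c) * h (f c) := by
  have e : ∀ i, ind (∃ c, p c ∧ f c = i) * h i =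
      ind (i ∈ Set.range f) * (ind (∃ c, p c ∧ f c = i) * h i) := by
    intro i
    by_cases hi : i ∈ Set.range f
    · rw [ind_of hi, one_mul]
    · rw [ind_of_not (p := ∃ c, p c ∧ f c = i), zero_mul, mul_zero]
      rintro ⟨c, -, hc⟩
      exact hi ⟨c, hc⟩
  rw [Finset.sum_congr rfl fun i _ => e i, sum_ind_mem_range hf]
  refine Finset.sum_congr rfl fun c _ => ?_
  congr 1
  apply ind_congr
  exact ⟨fun ⟨c', h1, h2⟩ => hf h2 ▸ h1, fun h => ⟨c, h, rfl⟩⟩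

theorem sum_ind_ne_ne {ι : Type*} [Fintype ι] {i j : ι} (hij : i ≠ j) (f : ι → ℂ) :
    ∑ c, ind (c ≠ i ∧ c ≠ j) * f c = ∑ c, f c - f i - f j := by
  have e : ∀ c, ind (c ≠ i ∧ c ≠ j) * f c = f c - ind (c = i) * f c - ind (c = j) * f c := by
    intro c
    rw [ind_and, ind_not, ind_not]
    by_cases h : c = i
    · rw [ind_of h, ind_of_not (p := c = j) (h ▸ hij)]
      ring
    · rw [ind_of_not h]
      ring
  simp_rw [e, Finset.sum_sub_distrib, sum_ind_mul_eq]

/-- Summation over the common neighbours of `0` and a matrix of rank one. -/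
theorem sum_common_neighbours {a : m → F} {b : n → F} (ha : a ≠ 0) (hb : b ≠ 0)
    (g : Matrix m n F → ℂ) :
    ∑ C : Matrix m n F, ind (C.rank = 1 ∧ (vecMulVec a b - C).rank = 1) * g C =
      ∑ c, g (vecMulVec c b) + ∑ d, g (vecMulVec a d) - ∑ r : F, g (r • vecMulVec a b) -
        g 0 - g (vecMulVec a b) := by
  have h1 : Injective fun c : m → F => vecMulVec c b := fun c c' h =>
    (vecMulVec_left_inj hb).1 h
  have h2 : Injective fun d : n → F => vecMulVec a d := fun c c' h =>
    (vecMulVec_right_inj ha).1 h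
  have h3 : Injective fun r : F => r • vecMulVec a b := by
    intro r s h
    have h' : (r - s) • vecMulVec a b = 0 := by rw [sub_smul]; exact sub_eq_zero.2 h
    refine sub_eq_zero.1 ((smul_eq_zero.1 h').resolve_right ?_)
    rw [vecMulVec_eq_zero_iff]
    exact not_or.2 ⟨ha, hb⟩
  -- The two cliques meet in the scalar multiples of `a bᵀ`, which inclusion-exclusion must subtract
  -- once.
  have hand : ∀ C : Matrix m n F, ((∃ c, (c ≠ 0 ∧ c ≠ a) ∧ vecMulVec c b = C) ∧
      ∃ d, (d ≠ 0 ∧ d ≠ b) ∧ vecMulVec a d = C) ↔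
        ∃ r : F, (r ≠ 0 ∧ r ≠ 1) ∧ r • vecMulVec a b = C := by
    intro C
    constructor
    · rintro ⟨⟨c, ⟨hc, hca⟩, rfl⟩, d, ⟨hd, hdb⟩, h⟩
      obtain ⟨r, hr, hcr, -⟩ := exists_smul_of_vecMulVec_eq hc hb h.symm
      refine ⟨r, ⟨hr, ?_⟩, ?_⟩
      · rintro rfl
        exact hca (by rw [hcr, one_smul])
      · rw [hcr, smul_vecMulVec]
    · rintro ⟨r, ⟨hr0, hr1⟩, rfl⟩
      refine ⟨⟨r • a, ⟨smul_ne_zero hr0 ha, ?_⟩, by rw [smul_vecMulVec]⟩,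
        r • b, ⟨smul_ne_zero hr0 hb, ?_⟩, by rw [vecMulVec_smul]⟩
      · intro h
        have h' : (r - 1) • a = 0 := by rw [sub_smul, one_smul, h, sub_self]
        exact hr1 (sub_eq_zero.1 ((smul_eq_zero.1 h').resolve_right ha))
      · intro h
        have h' : (r - 1) • b = 0 := by rw [sub_smul, one_smul, h, sub_self]
        exact hr1 (sub_eq_zero.1 ((smul_eq_zero.1 h').resolve_right hb))
  have key : ∀ C : Matrix m n F, ind (C.rank = 1 ∧ (vecMulVec a b - C).rank = 1) * g C =
      ind (∃ c, (c ≠ 0 ∧ c ≠ a) ∧ vecMulVec c b = C) * g C +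
      ind (∃ d, (d ≠ 0 ∧ d ≠ b) ∧ vecMulVec a d = C) * g C -
      ind (∃ r : F, (r ≠ 0 ∧ r ≠ 1) ∧ r • vecMulVec a b = C) * g C := by
    intro C
    have := rank_one_common_iff ha hb C
    simp only [← and_assoc] at this
    rw [ind_congr this, ind_or, ← ind_and, ind_congr (hand C)]
    ring
  simp_rw [key]
  rw [Finset.sum_sub_distrib, Finset.sum_add_distrib, sum_ind_exists h1, sum_ind_exists h2,
    sum_ind_exists h3, sum_ind_ne_ne ha.symm, sum_ind_ne_ne hb.symm, sum_ind_ne_ne zero_ne_one]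
  simp only [zero_vecMulVec, zero_smul, one_smul, vecMulVec_eq_zero_iff.2 (Or.inr rfl)]
  ring

end CommonNeighbours

/-! ### The partition of the neighbourhood of `x` in terms of `P` and `Q` -/

section Cells

variable {F : Type*} [Field F] [Fintype F] {D M k : ℕ} {x y : Matrix (Fin D) (Fin M) F}
  {P : Matrix (Fin D) (Fin k) F} {Q : Matrix (Fin k) (Fin M) F}

local notation "q" => ((Fintype.card F : ℕ) : ℂ)

theorem mem_sphere {X : Type*} [Fintype X] (G : SimpleGraph X) (i : ℕ) (p z : X) :
    z ∈ sphere G i p ↔ G.dist p z = i := by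
  classical simp [sphere]

theorem tripleCount_eq_sum (hw : y - x = P * Q) (B : Matrix (Fin D) (Fin M) F) (j : ℕ) :
    (tripleCount x y (x + B) j : ℂ) =
      ∑ C : Matrix (Fin D) (Fin M) F, ind (C.rank = 1 ∧ (B - C).rank = 1) *
        ind ((P * Q - C).rank = j) := by
  classical
  have h : (tripleCount x y (x + B) j : ℂ) = ∑ w, ind (w ∈ sphere (graph F D M) 1 x ∩
      sphere (graph F D M) 1 (x + B) ∩ sphere (graph F D M) j y) := by
    simp only [ind_eq_ite, Finset.sum_boole, Finset.filter_mem_eq_inter, Finset.univ_inter]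
    unfold tripleCount
    congr!
  rw [h, ← Equiv.sum_comp (Equiv.addLeft x)]
  refine Finset.sum_congr rfl fun C _ => ?_
  rw [← ind_and]
  apply ind_congr
  simp only [Finset.mem_inter, mem_sphere, dist_eq_rank, Equiv.coe_addLeft]
  rw [rank_sub_comm x, add_sub_cancel_left, add_sub_add_left_eq_sub, ← sub_sub, hw]

theorem exists_pair_iff (hP : Injective P.mulVec) (hQ : Injective Qᵀ.mulVec)
    (c d : Fin k → F) (p : F → Prop) :
    (∃ c' d', P *ᵥ c = P *ᵥ c' ∧ Qᵀ *ᵥ d = Qᵀ *ᵥ d' ∧ p (d' ⬝ᵥ c')) ↔ p (d ⬝ᵥ c) := by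
  constructor
  · rintro ⟨c', d', hc, hd, h⟩
    rwa [hP hc, hQ hd]
  · exact fun h => ⟨c, d, rfl, rfl, h⟩

theorem sum_ind_exists_pair_left (hP : Injective P.mulVec) (hQ : Injective Qᵀ.mulVec)
    {v : Fin M → F} (hv : v ≠ 0) :
    ∑ u, ind (∃ c d, u = P *ᵥ c ∧ v = Qᵀ *ᵥ d ∧ d ⬝ᵥ c = 1) =
      q ^ k / q * ind (v ∈ Set.range Qᵀ.mulVec) := by
  by_cases h : v ∈ Set.range Qᵀ.mulVec
  · obtain ⟨d, rfl⟩ := h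
    have hd : d ≠ 0 := by rintro rfl; simp at hv
    have e : ∀ u, ind (∃ c d', u = P *ᵥ c ∧ Qᵀ *ᵥ d = Qᵀ *ᵥ d' ∧ d' ⬝ᵥ c = 1) =
        ind (∃ c, d ⬝ᵥ c = 1 ∧ P *ᵥ c = u) * 1 := by
      intro u
      rw [mul_one]
      apply ind_congr
      constructor
      · rintro ⟨c, d', rfl, hd, h⟩
        exact ⟨c, by rwa [hQ hd], rfl⟩
      · rintro ⟨c, h, rfl⟩
        exact ⟨c, d, rfl, rfl, h⟩
    simp_rw [e]
    rw [sum_ind_exists hP (fun c => d ⬝ᵥ c = 1) fun _ => 1]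
    simp_rw [mul_one]
    rw [sum_ind_dotProduct_eq hd, ind_of ⟨d, rfl⟩]
    simp
  · rw [ind_of_not h, mul_zero]
    refine Finset.sum_eq_zero fun u _ => ind_of_not ?_
    rintro ⟨c, d, -, rfl, -⟩
    exact h ⟨d, rfl⟩

theorem sum_ind_exists_pair_right (hP : Injective P.mulVec) (hQ : Injective Qᵀ.mulVec)
    {u : Fin D → F} (hu : u ≠ 0) :
    ∑ v, ind (∃ c d, u = P *ᵥ c ∧ v = Qᵀ *ᵥ d ∧ d ⬝ᵥ c = 1) =
      q ^ k / q * ind (u ∈ Set.range P.mulVec) := by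
  have h := sum_ind_exists_pair_left (P := Qᵀ) (Q := Pᵀ) hQ hP hu
  rw [transpose_transpose] at h
  rw [← h]
  refine Finset.sum_congr rfl fun v _ => ind_congr ?_
  constructor
  · rintro ⟨c, d, h1, h2, h3⟩
    exact ⟨d, c, h2, h1, by rwa [dotProduct_comm]⟩
  · rintro ⟨c, d, h1, h2, h3⟩
    exact ⟨d, c, h2, h1, by rwa [dotProduct_comm]⟩

/-- The only scalar that can work is `(d ⬝ᵥ c)⁻¹`. This is the overlap term in `tripleCount_pred`,
responsible for the `-1` in `2 q ^ (k - 1) - 1`. -/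
theorem sum_ind_exists_pair_smul (hP : Injective P.mulVec) (hQ : Injective Qᵀ.mulVec)
    (u : Fin D → F) (v : Fin M → F) :
    ∑ r : F, ind (∃ c d, r • u = P *ᵥ c ∧ v = Qᵀ *ᵥ d ∧ d ⬝ᵥ c = 1) =
      ind (∃ c d, u = P *ᵥ c ∧ v = Qᵀ *ᵥ d ∧ d ⬝ᵥ c ≠ 0) := by
  by_cases h : ∃ c d, u = P *ᵥ c ∧ v = Qᵀ *ᵥ d ∧ d ⬝ᵥ c ≠ 0
  · rw [ind_of h]
    obtain ⟨c, d, rfl, rfl, h⟩ := h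
    have e : ∀ r : F, (∃ c' d', r • P *ᵥ c = P *ᵥ c' ∧ Qᵀ *ᵥ d = Qᵀ *ᵥ d' ∧ d' ⬝ᵥ c' = 1) ↔
        r = (d ⬝ᵥ c)⁻¹ := by
      intro r
      rw [← mulVec_smul, exists_pair_iff hP hQ (r • c) d fun t => t = 1, dotProduct_smul,
        smul_eq_mul, mul_eq_one_iff_eq_inv₀ h]
    simp_rw [ind_congr (e _), sum_ind_eq]
  · rw [ind_of_not h]
    refine Finset.sum_eq_zero fun r _ => ind_of_not ?_
    rintro ⟨c, d, h1, h2, h3⟩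
    apply h
    have hr : r ≠ 0 := by
      rintro rfl
      rw [zero_smul] at h1
      rw [(mulVec_eq_zero_iff_of_injective hP).1 h1.symm, dotProduct_zero] at h3
      exact zero_ne_one h3
    refine ⟨r⁻¹ • c, d, ?_, h2, ?_⟩
    · rw [mulVec_smul, ← h1, inv_smul_smul₀ hr]
    · rw [dotProduct_smul, h3, smul_eq_mul, mul_one]
      exact inv_ne_zero hr

theorem sum_ind_mem_range_mulVec (hP : Injective P.mulVec) :
    ∑ u, ind (u ∈ Set.range P.mulVec) = q ^ k := by
  have h := sum_ind_mem_range hP fun _ => 1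
  simp only [mul_one] at h
  rw [h]
  simp

/-- A clique through `0` and `u vᵀ` whose fixed vector lies in the relevant range contributes the `q
^ k / q` solutions of one affine equation `d ⬝ᵥ c = 1`; otherwise it contributes nothing. -/
theorem tripleCount_pred (hk : 1 ≤ k) (hw : y - x = P * Q) (hP : Injective P.mulVec)
    (hQ : Injective Qᵀ.mulVec) {u : Fin D → F} {v : Fin M → F} (hu : u ≠ 0) (hv : v ≠ 0)
    (hr : (P * Q - vecMulVec u v).rank = k) :
    (tripleCount x y (x + vecMulVec u v) (k - 1) : ℂ) =
      q ^ k / q * ind (v ∈ Set.range Qᵀ.mulVec) + q ^ k / q * ind (u ∈ Set.range P.mulVec) -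
        ind (∃ c d, u = P *ᵥ c ∧ v = Qᵀ *ᵥ d ∧ d ⬝ᵥ c ≠ 0) := by
  have e : ∀ u v, ind ((P * Q - vecMulVec u v).rank = k - 1) =
      ind (∃ c d, u = P *ᵥ c ∧ v = Qᵀ *ᵥ d ∧ d ⬝ᵥ c = 1) := by
    intro u v
    rw [← rank_mul_sub_eq_pred_iff hP hQ, Fintype.card_fin]
    apply ind_congr
    omega
  rw [tripleCount_eq_sum hw, sum_common_neighbours hu hv]
  have h0 : ind ((P * Q - vecMulVec u v).rank = k - 1) = 0 := ind_of_not (by omega)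
  have h1 : ind ((P * Q - (0 : Matrix (Fin D) (Fin M) F)).rank = k - 1) = 0 := by
    apply ind_of_not
    rw [sub_zero, rank_mul_of_injective hP hQ, Fintype.card_fin]
    omega
  rw [h0, h1]
  simp_rw [← smul_vecMulVec, e]
  rw [sum_ind_exists_pair_left hP hQ hv, sum_ind_exists_pair_right hP hQ hu,
    sum_ind_exists_pair_smul hP hQ]
  ring

/-- In each clique the distance goes up exactly when both vectors leave the two ranges. No multiple
of `u vᵀ` does so, hence there is no overlap to subtract. -/
theorem tripleCount_succ (hw : y - x = P * Q) (hP : Injective P.mulVec)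
    (hQ : Injective Qᵀ.mulVec) {u : Fin D → F} {v : Fin M → F} (hu : u ≠ 0) (hv : v ≠ 0)
    (hr : (P * Q - vecMulVec u v).rank = k) :
    (tripleCount x y (x + vecMulVec u v) (k + 1) : ℂ) =
      (q ^ D - q ^ k) * ind (v ∉ Set.range Qᵀ.mulVec) +
        (q ^ M - q ^ k) * ind (u ∉ Set.range P.mulVec) := by
  have e : ∀ u v, ind ((P * Q - vecMulVec u v).rank = k + 1) =
      ind (u ∉ Set.range P.mulVec) * ind (v ∉ Set.range Qᵀ.mulVec) := by
    intro u v
    rw [← ind_and, ← rank_mul_sub_eq_succ_iff hP hQ, Fintype.card_fin]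
  rw [tripleCount_eq_sum hw, sum_common_neighbours hu hv]
  have h0 : ind ((P * Q - vecMulVec u v).rank = k + 1) = 0 := ind_of_not (by omega)
  have h1 : ind ((P * Q - (0 : Matrix (Fin D) (Fin M) F)).rank = k + 1) = 0 := by
    apply ind_of_not
    rw [sub_zero, rank_mul_of_injective hP hQ, Fintype.card_fin]
    omega
  have h2 : ∀ r : F, ind ((P * Q - r • vecMulVec u v).rank = k + 1) = 0 := by
    intro r
    rw [← smul_vecMulVec, e, ← ind_and]
    apply ind_of_not
    rintro ⟨h, h'⟩
    have : (P * Q - vecMulVec u v).rank = k + 1 := by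
      have h3 := rank_mul_sub_eq_succ_iff hP hQ u v
      rw [Fintype.card_fin] at h3
      refine h3.2 ⟨?_, h'⟩
      rintro ⟨c, rfl⟩
      exact h ⟨r • c, mulVec_smul _ _ _⟩
    omega
  rw [h0, h1, Finset.sum_congr rfl fun r _ => h2 r]
  simp_rw [e]
  rw [← Finset.sum_mul, ← Finset.mul_sum]
  simp_rw [ind_not]
  rw [Finset.sum_sub_distrib, Finset.sum_sub_distrib, sum_ind_mem_range_mulVec hP,
    sum_ind_mem_range_mulVec hQ]
  simp
  ring

/-- The six kinds of pairs of vectors, in terms of a rank factorization `P * Q`. -/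
def cellCond (P : Matrix (Fin D) (Fin k) F) (Q : Matrix (Fin k) (Fin M) F) (u : Fin D → F)
    (v : Fin M → F) : Fin 6 → Prop :=
  ![∃ c d, u = P *ᵥ c ∧ v = Qᵀ *ᵥ d ∧ d ⬝ᵥ c = 1,
    ∃ c d, u = P *ᵥ c ∧ v = Qᵀ *ᵥ d ∧ d ⬝ᵥ c = 0,
    ∃ c d, u = P *ᵥ c ∧ v = Qᵀ *ᵥ d ∧ (d ⬝ᵥ c ≠ 0 ∧ d ⬝ᵥ c ≠ 1),
    u ∈ Set.range P.mulVec ∧ v ∉ Set.range Qᵀ.mulVec,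
    u ∉ Set.range P.mulVec ∧ v ∈ Set.range Qᵀ.mulVec,
    u ∉ Set.range P.mulVec ∧ v ∉ Set.range Qᵀ.mulVec]

theorem mem_middleCell (hw : y - x = P * Q) (hP : Injective P.mulVec)
    (hQ : Injective Qᵀ.mulVec) {C : Matrix (Fin D) (Fin M) F} (hC : C.rank = 1) (a b : ℕ) :
    x + C ∈ middleCell x y a b ↔ (P * Q - C).rank = k ∧
      tripleCount x y (x + C) (k - 1) = a ∧ tripleCount x y (x + C) (k + 1) = b := by
  classical
  have hd : (graph F D M).dist x y = k := by
    rw [dist_eq_rank, rank_sub_comm, hw, rank_mul_of_injective hP hQ, Fintype.card_fin]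
  simp only [middleCell, Finset.mem_filter, Finset.mem_inter, mem_sphere, hd]
  rw [dist_eq_rank, dist_eq_rank, rank_sub_comm x, add_sub_cancel_left, ← sub_sub, hw]
  simp [hC]

/-- Distance to `y` isolates the first and last cells. Among the middle ones the second count is `0`
when both vectors lie in the ranges and positive otherwise, since `k < D < M`; as `q ^ D ≠ q ^ M`,
it also tells the two mixed cases apart. When both vectors lie in the ranges, the first count
detects whether `d ⬝ᵥ c = 0`. -/
theorem mem_yPartition_iff (hk : 1 ≤ k) (hkD : k < D) (hDM : D < M) (hw : y - x = P * Q)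
    (hP : Injective P.mulVec) (hQ : Injective Qᵀ.mulVec) {u : Fin D → F} {v : Fin M → F}
    (hu : u ≠ 0) (hv : v ≠ 0) (i : Fin 6) :
    x + vecMulVec u v ∈ yPartition x y i ↔ cellCond P Q u v i := by
  have hq : 1 < Fintype.card F := Fintype.one_lt_card
  have hC := rank_vecMulVec_eq_one hu hv
  have hd : (graph F D M).dist x y = k := by
    rw [dist_eq_rank, rank_sub_comm, hw, rank_mul_of_injective hP hQ, Fintype.card_fin]
  have hs1 : x + vecMulVec u v ∈ sphere (graph F D M) 1 x := by
    rw [mem_sphere, dist_eq_rank, rank_sub_comm, add_sub_cancel_left, hC]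
  have hs : ∀ j, x + vecMulVec u v ∈ sphere (graph F D M) j y ↔
      (P * Q - vecMulVec u v).rank = j := by
    intro j
    rw [mem_sphere, dist_eq_rank, ← sub_sub, hw]
  have hkD' : Fintype.card F ^ k < Fintype.card F ^ D := Nat.pow_lt_pow_right hq hkD
  have hDM' : Fintype.card F ^ D < Fintype.card F ^ M := Nat.pow_lt_pow_right hq hDM
  have hk0 : 0 < Fintype.card F ^ (k - 1) := Nat.pow_pos (by omega)
  have hkq : q ^ k / q = q ^ (k - 1) := by
    rw [pow_sub₀ _ card_cast_ne_zero hk, pow_one, div_eq_mul_inv]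
  have h0 := rank_mul_sub_eq_pred_iff hP hQ u v
  have h5 := rank_mul_sub_eq_succ_iff hP hQ u v
  rw [Fintype.card_fin] at h0 h5
  have hpred := tripleCount_pred hk hw hP hQ hu hv
  have hsucc := tripleCount_succ hw hP hQ hu hv
  rw [hkq] at hpred
  have hcast : ∀ {N : ℕ}, k ≤ N → k < N → q ^ N - q ^ k =
      ((Fintype.card F ^ N - Fintype.card F ^ k : ℕ) : ℂ) := by
    intro N _ hN
    rw [Nat.cast_sub (Nat.pow_lt_pow_right hq hN).le]
    push_cast
    rfl
  rw [hcast hkD.le hkD, hcast (hkD.trans hDM).le (hkD.trans hDM)] at hsucc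
  have hmain : (x + vecMulVec u v ∈ yPartition x y i) ↔
      (![(P * Q - vecMulVec u v).rank = k - 1,
        x + vecMulVec u v ∈ middleCell x y (2 * Fintype.card F ^ (k - 1)) 0,
        x + vecMulVec u v ∈ middleCell x y (2 * Fintype.card F ^ (k - 1) - 1) 0,
        x + vecMulVec u v ∈ middleCell x y (Fintype.card F ^ (k - 1))
          (Fintype.card F ^ D - Fintype.card F ^ k),
        x + vecMulVec u v ∈ middleCell x y (Fintype.card F ^ (k - 1))
          (Fintype.card F ^ M - Fintype.card F ^ k),
        (P * Q - vecMulVec u v).rank = k + 1] : Fin 6 → Prop) i := by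
    unfold yPartition
    simp only [hd]
    fin_cases i <;> simp [hs, hs1]
  rw [hmain]
  simp only [mem_middleCell hw hP hQ hC]
  by_cases hU : u ∈ Set.range P.mulVec
  · by_cases hV : v ∈ Set.range Qᵀ.mulVec
    · have hU' := hU
      have hV' := hV
      obtain ⟨c, rfl⟩ := hU'
      obtain ⟨d, rfl⟩ := hV'
      rw [exists_pair_iff hP hQ c d fun t => t = 1] at h0
      rw [exists_pair_iff hP hQ c d fun t => t ≠ 0] at hpred
      have hcond : cellCond P Q (P *ᵥ c) (Qᵀ *ᵥ d) = ![d ⬝ᵥ c = 1, d ⬝ᵥ c = 0,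
          d ⬝ᵥ c ≠ 0 ∧ d ⬝ᵥ c ≠ 1, False, False, False] := by
        unfold cellCond
        rw [propext (exists_pair_iff hP hQ c d fun t => t = 1),
          propext (exists_pair_iff hP hQ c d fun t => t = 0),
          propext (exists_pair_iff hP hQ c d fun t => t ≠ 0 ∧ t ≠ 1)]
        simp [hU, hV]
      rw [hcond]
      have h5' : (P * Q - vecMulVec (P *ᵥ c) (Qᵀ *ᵥ d)).rank ≠ k + 1 := fun h =>
        (h5.1 h).1 hU
      have hlow : k ≤ (P * Q - vecMulVec (P *ᵥ c) (Qᵀ *ᵥ d)).rank + 1 := by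
        have := rank_le_rank_sub_vecMulVec (P * Q) (P *ᵥ c) (Qᵀ *ᵥ d)
        rwa [rank_mul_of_injective hP hQ, Fintype.card_fin] at this
      have hup : (P * Q - vecMulVec (P *ᵥ c) (Qᵀ *ᵥ d)).rank ≤ k := by
        rw [rank_mul_sub_of_mem hP hQ]
        exact (rank_le_card_width _).trans (by rw [Fintype.card_fin])
      by_cases hr : (P * Q - vecMulVec (P *ᵥ c) (Qᵀ *ᵥ d)).rank = k
      · have hcd : d ⬝ᵥ c ≠ 1 := fun h => by have := h0.2 h; omega
        have hp := hpred hr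
        have hs := hsucc hr
        rw [ind_of hU, ind_of hV] at hp
        rw [ind_of_not (not_not.2 hU), ind_of_not (not_not.2 hV), mul_zero, mul_zero,
          add_zero] at hs
        have hs' : tripleCount x y (x + vecMulVec (P *ᵥ c) (Qᵀ *ᵥ d)) (k + 1) = 0 := by
          exact_mod_cast hs
        by_cases hcd0 : d ⬝ᵥ c = 0
        · have hp' : tripleCount x y (x + vecMulVec (P *ᵥ c) (Qᵀ *ᵥ d)) (k - 1) =
              2 * Fintype.card F ^ (k - 1) := by
            rw [ind_of_not (not_not.2 hcd0)] at hp
            have : (tripleCount x y (x + vecMulVec (P *ᵥ c) (Qᵀ *ᵥ d)) (k - 1) : ℂ) =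
              2 * q ^ (k - 1) := by rw [hp]; ring
            exact_mod_cast this
          rw [hr, hs', hp']
          fin_cases i <;> simp [hcd0] <;> omega
        · have hp' : tripleCount x y (x + vecMulVec (P *ᵥ c) (Qᵀ *ᵥ d)) (k - 1) =
              2 * Fintype.card F ^ (k - 1) - 1 := by
            rw [ind_of hcd0] at hp
            have : (tripleCount x y (x + vecMulVec (P *ᵥ c) (Qᵀ *ᵥ d)) (k - 1) : ℂ) + 1 =
              2 * q ^ (k - 1) := by rw [hp]; ring
            have h' : tripleCount x y (x + vecMulVec (P *ᵥ c) (Qᵀ *ᵥ d)) (k - 1) + 1 =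
              2 * Fintype.card F ^ (k - 1) := by exact_mod_cast this
            omega
          rw [hr, hs', hp']
          fin_cases i <;> simp [hcd0, hcd] <;> omega
      · have hcd : d ⬝ᵥ c = 1 := h0.1 (by omega)
        have hr' : (P * Q - vecMulVec (P *ᵥ c) (Qᵀ *ᵥ d)).rank = k - 1 := by omega
        simp only [hr', hcd]
        fin_cases i <;> simp <;> omega
    · have hr : (P * Q - vecMulVec u v).rank = k := by
        rw [rank_mul_sub_of_mem_of_notMem hP hQ hU hV, Fintype.card_fin]
      have hex : ∀ p : F → Prop, ¬∃ c d, u = P *ᵥ c ∧ v = Qᵀ *ᵥ d ∧ p (d ⬝ᵥ c) := by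
        rintro p ⟨c, d, -, rfl, -⟩
        exact hV ⟨d, rfl⟩
      have hp := hpred hr
      have hs := hsucc hr
      rw [ind_of hU, ind_of_not hV, ind_of_not (hex fun t => t ≠ 0)] at hp
      rw [ind_of hV, ind_of_not (not_not.2 hU)] at hs
      have hs' : tripleCount x y (x + vecMulVec u v) (k + 1) =
          Fintype.card F ^ D - Fintype.card F ^ k := by
        rw [mul_one, mul_zero, add_zero] at hs
        exact Nat.cast_injective hs
      have hp' : tripleCount x y (x + vecMulVec u v) (k - 1) = Fintype.card F ^ (k - 1) := by
        have : (tripleCount x y (x + vecMulVec u v) (k - 1) : ℂ) = q ^ (k - 1) := by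
          rw [hp]; ring
        exact_mod_cast this
      have hcond : cellCond P Q u v = ![False, False, False, True, False, False] := by
        unfold cellCond
        rw [eq_false (hex fun t => t = 1), eq_false (hex fun t => t = 0),
          eq_false (hex fun t => t ≠ 0 ∧ t ≠ 1), eq_true hU, eq_false hV]
        simp
      rw [hcond, hr, hs', hp']
      fin_cases i <;> simp <;> omega
  · have hex : ∀ p : F → Prop, ¬∃ c d, u = P *ᵥ c ∧ v = Qᵀ *ᵥ d ∧ p (d ⬝ᵥ c) := by
      rintro p ⟨c, d, rfl, -, -⟩
      exact hU ⟨c, rfl⟩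
    by_cases hV : v ∈ Set.range Qᵀ.mulVec
    · have hr : (P * Q - vecMulVec u v).rank = k := by
        rw [rank_mul_sub_of_notMem_of_mem hP hQ hU hV, Fintype.card_fin]
      have hp := hpred hr
      have hs := hsucc hr
      rw [ind_of hV, ind_of_not hU, ind_of_not (hex fun t => t ≠ 0)] at hp
      rw [ind_of hU, ind_of_not (not_not.2 hV)] at hs
      have hs' : tripleCount x y (x + vecMulVec u v) (k + 1) =
          Fintype.card F ^ M - Fintype.card F ^ k := by
        rw [mul_one, mul_zero, zero_add] at hs
        exact Nat.cast_injective hs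
      have hp' : tripleCount x y (x + vecMulVec u v) (k - 1) = Fintype.card F ^ (k - 1) := by
        have : (tripleCount x y (x + vecMulVec u v) (k - 1) : ℂ) = q ^ (k - 1) := by
          rw [hp]; ring
        exact_mod_cast this
      have hcond : cellCond P Q u v = ![False, False, False, False, True, False] := by
        unfold cellCond
        rw [eq_false (hex fun t => t = 1), eq_false (hex fun t => t = 0),
          eq_false (hex fun t => t ≠ 0 ∧ t ≠ 1), eq_false hU, eq_true hV]
        simp
      rw [hcond, hr, hs', hp']
      fin_cases i <;> simp <;> omega
    · have hr : (P * Q - vecMulVec u v).rank = k + 1 := h5.2 ⟨hU, hV⟩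
      have hcond : cellCond P Q u v = ![False, False, False, False, False, True] := by
        unfold cellCond
        rw [eq_false (hex fun t => t = 1), eq_false (hex fun t => t = 0),
          eq_false (hex fun t => t ≠ 0 ∧ t ≠ 1), eq_false hU, eq_false hV]
        simp
      rw [hcond, hr]
      fin_cases i <;> simp
      omega

theorem yPartition_subset (i : Fin 6) : yPartition x y i ⊆ sphere (graph F D M) 1 x := by
  classical
  unfold yPartition
  fin_cases i
  · exact Finset.inter_subset_left
  · exact (Finset.filter_subset _ _).trans Finset.inter_subset_left
  · exact (Finset.filter_subset _ _).trans Finset.inter_subset_left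
  · exact (Finset.filter_subset _ _).trans Finset.inter_subset_left
  · exact (Finset.filter_subset _ _).trans Finset.inter_subset_left
  · exact Finset.inter_subset_left

theorem fourier_hatSum {ψ : AddChar F ℂ} (s : Finset (Matrix (Fin D) (Fin M) F))
    (B : Matrix (Fin D) (Fin M) F) :
    fourier ψ x (hatSum s) B = ∑ C, ind (x + C ∈ s) * ψ (pairing B C) := by
  classical
  have h : fourier ψ x (hatSum s) B = ∑ p ∈ s, fourier ψ x (hat p) B := by
    unfold hatSum
    induction s using Finset.induction_on with
    | empty => simp [fourier_zero]
    | insert p s hp ih => rw [Finset.sum_insert hp, Finset.sum_insert hp, fourier_add, ih]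
  rw [h, ← Equiv.sum_comp (Equiv.subRight x)]
  simp_rw [fourier_hat]
  simp [ind_eq_ite, Finset.sum_ite_mem]

theorem fourier_yPartition (hk : 1 ≤ k) (hkD : k < D) (hDM : D < M) (hw : y - x = P * Q)
    (hP : Injective P.mulVec) (hQ : Injective Qᵀ.mulVec) {ψ : AddChar F ℂ} (i : Fin 6)
    (a : Fin D → F) (b : Fin M → F) :
    (q - 1) * fourier ψ x (hatSum (yPartition x y i)) (vecMulVec a b) =
      ∑ u, ∑ v, ind (u ≠ 0) * ind (v ≠ 0) *
        (ind (cellCond P Q u v i) * ψ ((a ⬝ᵥ u) * (b ⬝ᵥ v))) := by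
  have e : ∀ C, ind (x + C ∈ yPartition x y i) * ψ (pairing (vecMulVec a b) C) =
      ind (C.rank = 1) * (ind (x + C ∈ yPartition x y i) *
        ψ (pairing (vecMulVec a b) C)) := by
    intro C
    by_cases h : x + C ∈ yPartition x y i
    · have := yPartition_subset i h
      rw [mem_sphere, dist_eq_rank, rank_sub_comm, add_sub_cancel_left] at this
      rw [ind_of this, one_mul]
    · rw [ind_of_not h]
      ring
  rw [fourier_hatSum, Finset.sum_congr rfl fun C _ => e C, ← sum_nonzero_pairs]
  refine Finset.sum_congr rfl fun u _ => Finset.sum_congr rfl fun v _ => ?_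
  by_cases hu : u = 0
  · rw [ind_of_not (not_not.2 hu)]
    ring
  by_cases hv : v = 0
  · rw [ind_of_not (not_not.2 hv)]
    ring
  rw [ind_congr (mem_yPartition_iff hk hkD hDM hw hP hQ hu hv i), pairing_vecMulVec]

end Cells

/-! ### The six functions and the transforms of the cells -/

section Coordinates

variable {F : Type*} [Field F] [Fintype F] {D M k : ℕ} {x y : Matrix (Fin D) (Fin M) F}
  {P : Matrix (Fin D) (Fin k) F} {Q : Matrix (Fin k) (Fin M) F} {ψ : AddChar F ℂ}

local notation "q" => ((Fintype.card F : ℕ) : ℂ)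

theorem transpose_mul_vecMulVec_eq_zero (a : Fin D → F) (b : Fin M → F) :
    Pᵀ * vecMulVec a b = 0 ↔ Pᵀ *ᵥ a = 0 ∨ b = 0 := by
  rw [mul_vecMulVec, vecMulVec_eq_zero_iff]

theorem vecMulVec_mul_transpose_eq_zero (a : Fin D → F) (b : Fin M → F) :
    vecMulVec a b * Qᵀ = 0 ↔ a = 0 ∨ Q *ᵥ b = 0 := by
  rw [vecMulVec_mul, vecMulVec_eq_zero_iff, vecMul_transpose]

theorem pairing_vecMulVec_mul (a : Fin D → F) (b : Fin M → F) :
    pairing (vecMulVec a b) (P * Q) = (Pᵀ *ᵥ a) ⬝ᵥ (Q *ᵥ b) := by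
  rw [pairing_vecMulVec_left, ← mulVec_mulVec, dotProduct_mulVec, mulVec_transpose]

/-- The pairing is the trace of `Cᵀ P Q = (Pᵀ C)ᵀ Q`. Thus the phase is trivial wherever this
indicator is nonzero. -/
theorem pairing_eq_zero_of_transpose_mul {C : Matrix (Fin D) (Fin M) F} (h : Pᵀ * C = 0) :
    pairing C (P * Q) = 0 := by
  have : pairing C (P * Q) = (Cᵀ * (P * Q)).trace := by
    simp [pairing, trace, mul_apply, dotProduct, Finset.sum_comm (γ := Fin D)]
  rw [this, ← Matrix.mul_assoc, ← transpose_transpose P, ← transpose_mul, h]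
  simp

theorem pairing_eq_zero_of_mul_transpose {C : Matrix (Fin D) (Fin M) F} (h : C * Qᵀ = 0) :
    pairing C (P * Q) = 0 := by
  have : pairing C (P * Q) = (C * (P * Q)ᵀ).trace := by
    simp [pairing, trace, mul_apply, dotProduct, mul_comm (Q _ _)]
  rw [this, transpose_mul, ← Matrix.mul_assoc, h]
  simp

/-- The linear combination with coefficients `c` of six functions on matrices attached to a rank
factorization `P * Q`. -/
noncomputable def combo (ψ : AddChar F ℂ) (P : Matrix (Fin D) (Fin k) F)
    (Q : Matrix (Fin k) (Fin M) F) (c : Fin 6 → ℝ) (C : Matrix (Fin D) (Fin M) F) : ℂ :=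
  c 0 + c 1 * ψ (pairing C (P * Q)) + c 2 * ind (Pᵀ * C = 0) + c 3 * ind (C * Qᵀ = 0) +
    c 4 * ind (pairing C (P * Q) = 0) + c 5 * (ind (Pᵀ * C = 0) * ind (C * Qᵀ = 0))

theorem combo_add (c d : Fin 6 → ℝ) (C : Matrix (Fin D) (Fin M) F) :
    combo ψ P Q (c + d) C = combo ψ P Q c C + combo ψ P Q d C := by
  simp only [combo, Pi.add_apply]
  push_cast
  ring

theorem combo_smul (r : ℝ) (c : Fin 6 → ℝ) (C : Matrix (Fin D) (Fin M) F) :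
    combo ψ P Q (r • c) C = r * combo ψ P Q c C := by
  simp only [combo, Pi.smul_apply, smul_eq_mul]
  push_cast
  ring

theorem combo_zero (C : Matrix (Fin D) (Fin M) F) : combo ψ P Q 0 C = 0 := by
  simp [combo]

theorem combo_vecMulVec (c : Fin 6 → ℝ) {a : Fin D → F} {b : Fin M → F} (ha : a ≠ 0)
    (hb : b ≠ 0) : combo ψ P Q c (vecMulVec a b) =
      c 0 + c 1 * ψ ((Pᵀ *ᵥ a) ⬝ᵥ (Q *ᵥ b)) + c 2 * ind (Pᵀ *ᵥ a = 0) + c 3 * ind (Q *ᵥ b = 0) +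
        c 4 * ind ((Pᵀ *ᵥ a) ⬝ᵥ (Q *ᵥ b) = 0) +
          c 5 * (ind (Pᵀ *ᵥ a = 0) * ind (Q *ᵥ b = 0)) := by
  rw [combo, pairing_vecMulVec_mul, ind_congr (transpose_mul_vecMulVec_eq_zero a b),
    ind_congr (vecMulVec_mul_transpose_eq_zero a b), ind_congr (or_iff_left hb),
    ind_congr (or_iff_right ha)]

/-- The vector `v` lies in the second eigenspace, and its Fourier transform is `combo c`. -/
def Represents (ψ : AddChar F ℂ) (x : Matrix (Fin D) (Fin M) F) (P : Matrix (Fin D) (Fin k) F)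
    (Q : Matrix (Fin k) (Fin M) F) (v : Matrix (Fin D) (Fin M) F → ℝ) (c : Fin 6 → ℝ) : Prop :=
  ∀ C, fourier ψ x v C = ind (C.rank = 1) * combo ψ P Q c C

theorem Represents.add {v w : Matrix (Fin D) (Fin M) F → ℝ} {c d : Fin 6 → ℝ}
    (hv : Represents ψ x P Q v c) (hw : Represents ψ x P Q w d) :
    Represents ψ x P Q (v + w) (c + d) := fun C => by
  rw [fourier_add, hv, hw, combo_add, mul_add]

theorem Represents.smul {v : Matrix (Fin D) (Fin M) F → ℝ} {c : Fin 6 → ℝ} (r : ℝ)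
    (hv : Represents ψ x P Q v c) : Represents ψ x P Q (r • v) (r • c) := fun C => by
  rw [fourier_smul, hv, combo_smul]
  ring

theorem Represents.zero : Represents ψ x P Q 0 0 := fun C => by
  rw [fourier_zero, combo_zero, mul_zero]

theorem Represents.sum {ι : Type*} {s : Finset ι} {v : ι → Matrix (Fin D) (Fin M) F → ℝ}
    {c : ι → Fin 6 → ℝ} (h : ∀ i ∈ s, Represents ψ x P Q (v i) (c i)) :
    Represents ψ x P Q (∑ i ∈ s, v i) (∑ i ∈ s, c i) := by
  classical
  induction s using Finset.induction_on with
  | empty => exact Represents.zero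
  | insert i s hi ih =>
    rw [Finset.sum_insert hi, Finset.sum_insert hi]
    exact (h i (Finset.mem_insert_self i s)).add
      (ih fun j hj => h j (Finset.mem_insert_of_mem hj))

/-- Only this direction is used: it transfers membership in a subspace between vectors with a common
coefficient vector. -/
theorem Represents.unique (hψ : ψ ≠ 1) {v w : Matrix (Fin D) (Fin M) F → ℝ} {c : Fin 6 → ℝ}
    (hv : Represents ψ x P Q v c) (hw : Represents ψ x P Q w c) : v = w :=
  eq_of_fourier_eq x hψ fun B => by rw [hv, hw]

theorem represents_of_forall {v : Matrix (Fin D) (Fin M) F → ℝ} {c : Fin 6 → ℝ}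
    (h0 : ∀ C, C.rank ≠ 1 → fourier ψ x v C = 0)
    (h1 : ∀ a b, a ≠ 0 → b ≠ 0 →
      fourier ψ x v (vecMulVec a b) = combo ψ P Q c (vecMulVec a b)) :
    Represents ψ x P Q v c := by
  intro C
  by_cases hC : C.rank = 1
  · obtain ⟨a, b, ha, hb, rfl⟩ := exists_eq_vecMulVec_of_rank_eq_one hC
    rw [ind_of hC, one_mul, h1 a b ha hb]
  · rw [ind_of_not hC, zero_mul, h0 C hC]

/-! ### The cells -/

theorem sum_ind_pair (hP : Injective P.mulVec) (hQ : Injective Qᵀ.mulVec) (p : F → Prop)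
    (f : (Fin D → F) → (Fin M → F) → ℂ) :
    ∑ u, ∑ v, ind (∃ c d, u = P *ᵥ c ∧ v = Qᵀ *ᵥ d ∧ p (d ⬝ᵥ c)) * f u v =
      ∑ c, ∑ d, ind (p (d ⬝ᵥ c)) * f (P *ᵥ c) (Qᵀ *ᵥ d) := by
  have hinj : Injective fun cd : (Fin k → F) × (Fin k → F) => (P *ᵥ cd.1, Qᵀ *ᵥ cd.2) :=
    hP.prodMap hQ
  have h := sum_ind_exists hinj (fun cd => p (cd.2 ⬝ᵥ cd.1)) fun uv => f uv.1 uv.2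
  simp only [Fintype.sum_prod_type] at h
  rw [← h]
  refine Finset.sum_congr rfl fun u _ => Finset.sum_congr rfl fun v _ => ?_
  congr 1
  apply ind_congr
  constructor
  · rintro ⟨c, d, rfl, rfl, h⟩
    exact ⟨(c, d), h, rfl⟩
  · rintro ⟨⟨c, d⟩, h, he⟩
    rw [Prod.mk.injEq] at he
    exact ⟨c, d, he.1.symm, he.2.symm, h⟩

theorem dotProduct_mulVec_transpose {m n : Type*} [Fintype m] [Fintype n] (A : Matrix m n F)
    (a : m → F) (c : n → F) : a ⬝ᵥ A *ᵥ c = (Aᵀ *ᵥ a) ⬝ᵥ c := by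
  rw [dotProduct_mulVec, mulVec_transpose]

/-- The `2 q ^ k - 1` pairs with `c = 0` or `d = 0` all have `d ⬝ᵥ c = 0` and character value `1`;
they are removed from the full sum. -/
theorem sum_pair_char (hP : Injective P.mulVec) (hQ : Injective Qᵀ.mulVec) (p : F → Prop)
    (a : Fin D → F) (b : Fin M → F) :
    ∑ u, ∑ v, ind (u ≠ 0) * ind (v ≠ 0) *
      (ind (∃ c d, u = P *ᵥ c ∧ v = Qᵀ *ᵥ d ∧ p (d ⬝ᵥ c)) * ψ ((a ⬝ᵥ u) * (b ⬝ᵥ v))) =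
      ∑ c, ∑ d, ind (p (d ⬝ᵥ c)) * ψ (((Pᵀ *ᵥ a) ⬝ᵥ c) * ((Q *ᵥ b) ⬝ᵥ d)) -
        (2 * q ^ k - 1) * ind (p 0) := by
  have e : ∀ u v, ind (u ≠ 0) * ind (v ≠ 0) *
      (ind (∃ c d, u = P *ᵥ c ∧ v = Qᵀ *ᵥ d ∧ p (d ⬝ᵥ c)) * ψ ((a ⬝ᵥ u) * (b ⬝ᵥ v))) =
      ind (∃ c d, u = P *ᵥ c ∧ v = Qᵀ *ᵥ d ∧ p (d ⬝ᵥ c)) *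
        (ind (u ≠ 0) * ind (v ≠ 0) * ψ ((a ⬝ᵥ u) * (b ⬝ᵥ v))) := fun u v => by ring
  simp_rw [e]
  rw [sum_ind_pair hP hQ]
  have e' : ∀ c d, ind (p (d ⬝ᵥ c)) * (ind (P *ᵥ c ≠ 0) * ind (Qᵀ *ᵥ d ≠ 0) *
      ψ ((a ⬝ᵥ P *ᵥ c) * (b ⬝ᵥ Qᵀ *ᵥ d))) = ind (c ≠ 0) * ind (d ≠ 0) *
        (ind (p (d ⬝ᵥ c)) * ψ (((Pᵀ *ᵥ a) ⬝ᵥ c) * ((Q *ᵥ b) ⬝ᵥ d))) := by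
    intro c d
    rw [ind_congr (mulVec_eq_zero_iff_of_injective hP).not,
      ind_congr (mulVec_eq_zero_iff_of_injective hQ).not, dotProduct_mulVec_transpose,
      dotProduct_mulVec_transpose, transpose_transpose]
    ring
  simp_rw [e']
  rw [sum_nonzero]
  simp
  ring

theorem sum_ind_range_mul_char (hP : Injective P.mulVec) (hQ : Injective Qᵀ.mulVec) (hψ : ψ ≠ 1)
    (a : Fin D → F) (b : Fin M → F) :
    ∑ u, ∑ v, ind (u ∈ Set.range P.mulVec) * (ind (v ∈ Set.range Qᵀ.mulVec) *
      ψ ((a ⬝ᵥ u) * (b ⬝ᵥ v))) = q ^ k * (q ^ k / q + (q ^ k - q ^ k / q) *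
        (ind (Pᵀ *ᵥ a = 0) + ind (Q *ᵥ b = 0) - ind (Pᵀ *ᵥ a = 0) * ind (Q *ᵥ b = 0))) := by
  simp_rw [← Finset.mul_sum]
  rw [sum_ind_mem_range hP]
  simp_rw [sum_ind_mem_range hQ, dotProduct_mulVec_transpose, transpose_transpose]
  rw [sum_sum_char hψ]
  simp

theorem sum_ind_range_left_mul_char (hP : Injective P.mulVec) (hψ : ψ ≠ 1)
    (a : Fin D → F) {b : Fin M → F} (hb : b ≠ 0) :
    ∑ u, ∑ v, ind (u ∈ Set.range P.mulVec) * ψ ((a ⬝ᵥ u) * (b ⬝ᵥ v)) =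
      q ^ M * (q ^ k / q + (q ^ k - q ^ k / q) * ind (Pᵀ *ᵥ a = 0)) := by
  simp_rw [← Finset.mul_sum]
  rw [sum_ind_mem_range hP]
  simp_rw [dotProduct_mulVec_transpose]
  rw [sum_sum_char hψ, ind_of_not hb]
  simp

theorem sum_ind_range_right_mul_char (hQ : Injective Qᵀ.mulVec) (hψ : ψ ≠ 1)
    {a : Fin D → F} (ha : a ≠ 0) (b : Fin M → F) :
    ∑ u, ∑ v, ind (v ∈ Set.range Qᵀ.mulVec) * ψ ((a ⬝ᵥ u) * (b ⬝ᵥ v)) =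
      q ^ D * (q ^ k / q + (q ^ k - q ^ k / q) * ind (Q *ᵥ b = 0)) := by
  have h := sum_ind_range_left_mul_char (P := Qᵀ) (M := D) hQ hψ b ha
  rw [Finset.sum_comm]
  rw [transpose_transpose] at h
  rw [← h]
  simp_rw [mul_comm (b ⬝ᵥ _)]

theorem sum_sum_char_of_ne (hψ : ψ ≠ 1) {a : Fin D → F} (ha : a ≠ 0) {b : Fin M → F}
    (hb : b ≠ 0) : ∑ u, ∑ v, ψ ((a ⬝ᵥ u) * (b ⬝ᵥ v)) = q ^ D * q ^ M / q := by
  rw [sum_sum_char hψ, ind_of_not ha, ind_of_not hb]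
  simp
  ring

/-- The coefficients of the Fourier transforms of the cells, up to the factor `q - 1`; here
`A = q ^ D`, `B = q ^ M` and `K = q ^ k`. -/
noncomputable def cellCoeff (r A B K : ℝ) : Fin 6 → Fin 6 → ℝ :=
  ![![K / r * (K / r - 1), K / r * (r - 1), K / r * (K - K / r), K / r * (K - K / r),
      -(K / r * (r - 1)), -(K / r * (K - K / r))],
    ![K / r * (K / r + 2 * (r - 1)) - (2 * K - 1), 0, K / r * (K - K / r), K / r * (K - K / r),
      -(K / r * (r - 1)), -(K / r * (K - K / r))],
    ![K * (K / r) - K / r * (K / r - 1) - K / r * (K / r + 2 * (r - 1)), -(K / r * (r - 1)),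
      K * (K - K / r) - 2 * (K / r * (K - K / r)), K * (K - K / r) - 2 * (K / r * (K - K / r)),
      2 * (K / r * (r - 1)), -(K * (K - K / r) - 2 * (K / r * (K - K / r)))],
    ![B * (K / r) - K * (K / r) - (B - K), 0, B * (K - K / r) - K * (K - K / r),
      -(K * (K - K / r)), 0, K * (K - K / r)],
    ![A * (K / r) - K * (K / r) - (A - K), 0, -(K * (K - K / r)),
      A * (K - K / r) - K * (K - K / r), 0, K * (K - K / r)],
    ![A * B / r - B * (K / r) - A * (K / r) + K * (K / r), 0,
      -(B * (K - K / r)) + K * (K - K / r), -(A * (K - K / r)) + K * (K - K / r), 0,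
      -(K * (K - K / r))]]

/-- The first two cells are level sets of `d ⬝ᵥ c` and come from `sum_sum_ind_dotProduct_mul_char`;
the third is their complement among pairs in both ranges. The other three follow by
inclusion-exclusion from sums with `u`, `v`, both or neither restricted to a range. -/
theorem sum_cellCond (hP : Injective P.mulVec) (hQ : Injective Qᵀ.mulVec) (hψ : ψ ≠ 1)
    {a : Fin D → F} (ha : a ≠ 0) {b : Fin M → F} (hb : b ≠ 0) (i : Fin 6) :
    ∑ u, ∑ v, ind (u ≠ 0) * ind (v ≠ 0) *
        (ind (cellCond P Q u v i) * ψ ((a ⬝ᵥ u) * (b ⬝ᵥ v))) =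
      combo ψ P Q (cellCoeff (Fintype.card F) ((Fintype.card F : ℝ) ^ D)
        ((Fintype.card F : ℝ) ^ M) ((Fintype.card F : ℝ) ^ k) i) (vecMulVec a b) := by
  rw [combo_vecMulVec _ ha hb]
  have h0P : (0 : Fin D → F) ∈ Set.range P.mulVec := ⟨0, mulVec_zero _⟩
  have h0Q : (0 : Fin M → F) ∈ Set.range Qᵀ.mulVec := ⟨0, mulVec_zero _⟩
  have hlev := sum_sum_ind_dotProduct_mul_char hψ (Pᵀ *ᵥ a) (Q *ᵥ b)
  have hall := sum_sum_char hψ (Pᵀ *ᵥ a) (Q *ᵥ b)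
  have hUW := sum_ind_range_mul_char hP hQ hψ a b
  have hU := sum_ind_range_left_mul_char hP hψ a hb
  have hW := sum_ind_range_right_mul_char hQ hψ ha b
  have hA := sum_sum_char_of_ne hψ ha hb
  have h1 := hlev 1
  have h2 := hlev 0
  have hcU := sum_ind_mem_range_mulVec hP
  have hcW := sum_ind_mem_range_mulVec hQ
  rw [ind_of_not one_ne_zero, mul_one] at h1
  rw [ind_of (p := (0 : F) = 0) rfl, mul_zero, AddChar.map_zero_eq_one] at h2
  rw [Fintype.card_fin] at h1 h2 hall
  fin_cases i
  · refine (sum_pair_char hP hQ (fun t => t = 1) a b).trans ?_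
    rw [h1, ind_of_not zero_ne_one]
    simp [cellCoeff]
    ring
  · refine (sum_pair_char hP hQ (fun t => t = 0) a b).trans ?_
    rw [h2, ind_of rfl]
    simp [cellCoeff]
    ring
  · refine (sum_pair_char hP hQ (fun t => t ≠ 0 ∧ t ≠ 1) a b).trans ?_
    have e : ∀ t : F, ind (t ≠ 0 ∧ t ≠ 1) = 1 - ind (t = 0) - ind (t = 1) := by
      intro t
      rw [ind_and, ind_not, ind_not]
      by_cases h : t = 0
      · rw [ind_of h, ind_of_not (p := t = 1) (by rw [h]; exact zero_ne_one)]
        ring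
      · rw [ind_of_not h]
        ring
    rw [ind_of_not (p := (0 : F) ≠ 0 ∧ (0 : F) ≠ 1) (fun h => h.1 rfl)]
    simp_rw [e, sub_mul, one_mul, Finset.sum_sub_distrib]
    rw [h1, h2, hall]
    simp [cellCoeff]
    ring
  · have e : ∀ u v, ind (u ∈ Set.range P.mulVec ∧ v ∉ Set.range Qᵀ.mulVec) *
        ψ ((a ⬝ᵥ u) * (b ⬝ᵥ v)) = ind (u ∈ Set.range P.mulVec) * ψ ((a ⬝ᵥ u) * (b ⬝ᵥ v)) -
          ind (u ∈ Set.range P.mulVec) * (ind (v ∈ Set.range Qᵀ.mulVec) *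
            ψ ((a ⬝ᵥ u) * (b ⬝ᵥ v))) := by
      intro u v
      rw [ind_and, ind_not]
      ring
    refine (sum_nonzero fun u v => ind (u ∈ Set.range P.mulVec ∧ v ∉ Set.range Qᵀ.mulVec) *
      ψ ((a ⬝ᵥ u) * (b ⬝ᵥ v))).trans ?_
    simp_rw [e, Finset.sum_sub_distrib]
    rw [hUW, hU]
    simp [-Set.mem_range, ind_of h0P, ind_of h0Q, hcW, cellCoeff]
    ring
  · have e : ∀ u v, ind (u ∉ Set.range P.mulVec ∧ v ∈ Set.range Qᵀ.mulVec) *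
        ψ ((a ⬝ᵥ u) * (b ⬝ᵥ v)) = ind (v ∈ Set.range Qᵀ.mulVec) * ψ ((a ⬝ᵥ u) * (b ⬝ᵥ v)) -
          ind (u ∈ Set.range P.mulVec) * (ind (v ∈ Set.range Qᵀ.mulVec) *
            ψ ((a ⬝ᵥ u) * (b ⬝ᵥ v))) := by
      intro u v
      rw [ind_and, ind_not]
      ring
    refine (sum_nonzero fun u v => ind (u ∉ Set.range P.mulVec ∧ v ∈ Set.range Qᵀ.mulVec) *
      ψ ((a ⬝ᵥ u) * (b ⬝ᵥ v))).trans ?_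
    simp_rw [e, Finset.sum_sub_distrib]
    rw [hUW, hW]
    simp [-Set.mem_range, ind_of h0P, ind_of h0Q, hcU, cellCoeff]
    ring
  · have e : ∀ u v, ind (u ∉ Set.range P.mulVec ∧ v ∉ Set.range Qᵀ.mulVec) *
        ψ ((a ⬝ᵥ u) * (b ⬝ᵥ v)) = ψ ((a ⬝ᵥ u) * (b ⬝ᵥ v)) -
          ind (u ∈ Set.range P.mulVec) * ψ ((a ⬝ᵥ u) * (b ⬝ᵥ v)) -
          ind (v ∈ Set.range Qᵀ.mulVec) * ψ ((a ⬝ᵥ u) * (b ⬝ᵥ v)) +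
          ind (u ∈ Set.range P.mulVec) * (ind (v ∈ Set.range Qᵀ.mulVec) *
            ψ ((a ⬝ᵥ u) * (b ⬝ᵥ v))) := by
      intro u v
      rw [ind_and, ind_not, ind_not]
      ring
    refine (sum_nonzero fun u v => ind (u ∉ Set.range P.mulVec ∧ v ∉ Set.range Qᵀ.mulVec) *
      ψ ((a ⬝ᵥ u) * (b ⬝ᵥ v))).trans ?_
    simp_rw [e, Finset.sum_add_distrib, Finset.sum_sub_distrib]
    rw [hUW, hU, hW, hA]
    simp [-Set.mem_range, ind_of h0P, ind_of h0Q, hcU, hcW, cellCoeff]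
    ring

theorem represents_cellVector (hk : 1 ≤ k) (hkD : k < D) (hDM : D < M) (hw : y - x = P * Q)
    (hP : Injective P.mulVec) (hQ : Injective Qᵀ.mulVec) (hψ : ψ ≠ 1) (i : Fin 6) :
    Represents ψ x P Q (cellVector x y i) (((Fintype.card F : ℝ) - 1)⁻¹ •
      cellCoeff (Fintype.card F) ((Fintype.card F : ℝ) ^ D)
        ((Fintype.card F : ℝ) ^ M) ((Fintype.card F : ℝ) ^ k) i) := by
  apply represents_of_forall
  · intro C hC
    rw [cellVector, fourier_idempotent (by omega) (by omega) hψ, ind_of_not hC, zero_mul]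
  · intro a b ha hb
    have hq : q - 1 ≠ 0 := by
      have := one_lt_card (F := F)
      have h2 : ((Fintype.card F : ℝ) - 1 : ℝ) ≠ 0 := by linarith
      exact_mod_cast h2
    rw [cellVector, fourier_idempotent (by omega) (by omega) hψ,
      ind_of (rank_vecMulVec_eq_one ha hb), one_mul, combo_smul, ← sum_cellCond hP hQ hψ ha hb,
      ← fourier_yPartition hk hkD hDM hw hP hQ]
    push_cast
    rw [inv_mul_cancel_left₀ hq]

end Coordinates

/-! ### Norton multiplication by `E x̂` and `E ŷ` on coefficients -/

section Action

variable {F : Type*} [Field F] [Fintype F] {D M k : ℕ} {x y : Matrix (Fin D) (Fin M) F}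
  {P : Matrix (Fin D) (Fin k) F} {Q : Matrix (Fin k) (Fin M) F} {ψ : AddChar F ℂ}

local notation "q" => ((Fintype.card F : ℕ) : ℂ)

theorem pairing_vecMulVec_mul_left (c : Fin D → F) (b : Fin M → F) :
    pairing (vecMulVec c b) (P * Q) = (P *ᵥ (Q *ᵥ b)) ⬝ᵥ c := by
  rw [pairing_vecMulVec_left, ← mulVec_mulVec, dotProduct_comm]

theorem pairing_vecMulVec_mul_right (a : Fin D → F) (d : Fin M → F) :
    pairing (vecMulVec a d) (P * Q) = (Qᵀ *ᵥ (Pᵀ *ᵥ a)) ⬝ᵥ d := by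
  rw [pairing_vecMulVec_mul, dotProduct_mulVec, mulVec_transpose Q]

theorem commonSum_one {a : Fin D → F} {b : Fin M → F} (ha : a ≠ 0) (hb : b ≠ 0) :
    ∑ C, ind (C.rank = 1 ∧ (vecMulVec a b - C).rank = 1) = q ^ D + q ^ M - q - 2 := by
  have h := sum_common_neighbours ha hb fun _ => 1
  simp only [mul_one] at h
  rw [h]
  simp
  ring

/-- The values `s = 1` and `s = -1` serve multiplication by `E x̂` and by `E ŷ`. The scalar survives
only in the last term, since a nonzero multiple vanishes exactly when the vector does. -/
theorem commonSum_char (hP : Injective P.mulVec) (hQ : Injective Qᵀ.mulVec) (hψ : ψ ≠ 1)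
    {a : Fin D → F} {b : Fin M → F} (ha : a ≠ 0) (hb : b ≠ 0) {s : F} (hs : s ≠ 0) :
    ∑ C, ind (C.rank = 1 ∧ (vecMulVec a b - C).rank = 1) * ψ (s * pairing C (P * Q)) =
      q ^ D * ind (Q *ᵥ b = 0) + q ^ M * ind (Pᵀ *ᵥ a = 0) -
        q * ind ((Pᵀ *ᵥ a) ⬝ᵥ (Q *ᵥ b) = 0) - 1 - ψ (s * ((Pᵀ *ᵥ a) ⬝ᵥ (Q *ᵥ b))) := by
  rw [sum_common_neighbours ha hb]
  have e1 : ∀ c, s * pairing (vecMulVec c b) (P * Q) = (s • (P *ᵥ (Q *ᵥ b))) ⬝ᵥ c := fun c => by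
    rw [pairing_vecMulVec_mul_left, smul_dotProduct, smul_eq_mul]
  have e2 : ∀ d, s * pairing (vecMulVec a d) (P * Q) = (s • (Qᵀ *ᵥ (Pᵀ *ᵥ a))) ⬝ᵥ d :=
    fun d => by rw [pairing_vecMulVec_mul_right, smul_dotProduct, smul_eq_mul]
  have e3 : ∀ r, s * pairing (r • vecMulVec a b) (P * Q) =
      r * (s * ((Pᵀ *ᵥ a) ⬝ᵥ (Q *ᵥ b))) := fun r => by
    rw [pairing_smul_left, pairing_vecMulVec_mul]
    ring
  rw [Finset.sum_congr rfl fun c _ => congrArg ψ (e1 c),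
    Finset.sum_congr rfl fun d _ => congrArg ψ (e2 d),
    Finset.sum_congr rfl fun r _ => congrArg ψ (e3 r), sum_char_dotProduct hψ,
    sum_char_dotProduct hψ, sum_char_mul hψ, pairing_zero_left, mul_zero,
    AddChar.map_zero_eq_one, pairing_vecMulVec_mul,
    ind_congr (smul_eq_zero_iff_right hs), ind_congr (smul_eq_zero_iff_right hs),
    ind_congr (mul_eq_zero_iff_left hs), ind_congr (mulVec_eq_zero_iff_of_injective hP),
    ind_congr (mulVec_eq_zero_iff_of_injective hQ)]
  simp

theorem commonSum_left (hP : Injective P.mulVec) {a : Fin D → F} {b : Fin M → F} (ha : a ≠ 0)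
    (hb : b ≠ 0) :
    ∑ C, ind (C.rank = 1 ∧ (vecMulVec a b - C).rank = 1) * ind (Pᵀ * C = 0) =
      q ^ D / q ^ k - 1 + (q ^ M - q - 1) * ind (Pᵀ *ᵥ a = 0) := by
  rw [sum_common_neighbours ha hb]
  simp_rw [← smul_vecMulVec, ind_congr (transpose_mul_vecMulVec_eq_zero _ _), ind_or,
    mulVec_smul, smul_eq_zero_ind, ind_of_not hb]
  simp only [mul_zero, add_zero, sub_zero, Finset.sum_add_distrib, Finset.sum_sub_distrib,
    ← Finset.mul_sum, ← Finset.sum_mul, sum_ind_eq, Matrix.mul_zero]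
  rw [sum_ind_transpose_mulVec_eq_zero hP, ind_of (p := True) trivial]
  simp
  ring

theorem commonSum_right (hQ : Injective Qᵀ.mulVec) {a : Fin D → F} {b : Fin M → F} (ha : a ≠ 0)
    (hb : b ≠ 0) :
    ∑ C, ind (C.rank = 1 ∧ (vecMulVec a b - C).rank = 1) * ind (C * Qᵀ = 0) =
      q ^ M / q ^ k - 1 + (q ^ D - q - 1) * ind (Q *ᵥ b = 0) := by
  have hs := sum_ind_transpose_mulVec_eq_zero hQ
  rw [transpose_transpose] at hs
  rw [sum_common_neighbours ha hb]
  simp_rw [← smul_vecMulVec, ind_congr (vecMulVec_mul_transpose_eq_zero _ _), ind_or,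
    smul_eq_zero_ind, ind_of_not ha]
  simp only [zero_mul, mul_zero, zero_add, add_zero, sub_zero, Finset.sum_add_distrib,
    Finset.sum_sub_distrib, ← Finset.sum_mul, sum_ind_eq, Matrix.zero_mul]
  rw [hs, ind_of (p := True) trivial]
  simp
  ring

theorem commonSum_pairing (hP : Injective P.mulVec) (hQ : Injective Qᵀ.mulVec)
    {a : Fin D → F} {b : Fin M → F} (ha : a ≠ 0) (hb : b ≠ 0) :
    ∑ C, ind (C.rank = 1 ∧ (vecMulVec a b - C).rank = 1) * ind (pairing C (P * Q) = 0) =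
      q ^ D / q + q ^ M / q - 2 + (q ^ M - q ^ M / q) * ind (Pᵀ *ᵥ a = 0) +
        (q ^ D - q ^ D / q) * ind (Q *ᵥ b = 0) -
          q * ind ((Pᵀ *ᵥ a) ⬝ᵥ (Q *ᵥ b) = 0) := by
  rw [sum_common_neighbours ha hb]
  have e3 : ∀ r : F, ind (pairing (r • vecMulVec a b) (P * Q) = 0) = ind (r = 0) +
      ind ((Pᵀ *ᵥ a) ⬝ᵥ (Q *ᵥ b) = 0) - ind (r = 0) * ind ((Pᵀ *ᵥ a) ⬝ᵥ (Q *ᵥ b) = 0) := by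
    intro r
    rw [pairing_smul_left, pairing_vecMulVec_mul, ind_congr mul_eq_zero, ind_or]
  rw [Finset.sum_congr rfl fun c _ => congrArg (fun t => ind (t = 0))
      (pairing_vecMulVec_mul_left (P := P) (Q := Q) c b),
    Finset.sum_congr rfl fun d _ => congrArg (fun t => ind (t = 0))
      (pairing_vecMulVec_mul_right (P := P) (Q := Q) a d),
    Finset.sum_congr rfl fun r _ => e3 r, sum_ind_dotProduct_eq_zero, sum_ind_dotProduct_eq_zero,
    Finset.sum_sub_distrib, Finset.sum_add_distrib, ← Finset.sum_mul,
    sum_ind_eq, pairing_zero_left, pairing_vecMulVec_mul,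
    ind_congr (mulVec_eq_zero_iff_of_injective hP),
    ind_congr (mulVec_eq_zero_iff_of_injective hQ), ind_of (p := (0 : F) = 0) rfl]
  simp
  ring

/-- The action of the Norton product by `E x̂` on coefficients, up to the factor `|X|`. -/
noncomputable def actLeft (r A B K : ℝ) (c : Fin 6 → ℝ) : Fin 6 → ℝ :=
  ![(A + B - r - 2) * c 0 - c 1 + (A / K - 1) * c 2 + (B / K - 1) * c 3 +
      (A / r + B / r - 2) * c 4,
    -c 1,
    B * c 1 + (B - r - 1) * c 2 + (B - B / r) * c 4,
    A * c 1 + (A - r - 1) * c 3 + (A - A / r) * c 4,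
    -(r * c 1) - r * c 4,
    0]

/-- The action of the Norton product by `E ŷ` on coefficients, up to the factor `|X|`. -/
noncomputable def actRight (r A B K : ℝ) (c : Fin 6 → ℝ) : Fin 6 → ℝ :=
  ![-c 0,
    (A + B - r - 2) * c 1 - c 0 + (A / K - 1) * c 2 + (B / K - 1) * c 3 +
      (A / r + B / r - 2) * c 4,
    B * c 0 + (B - r - 1) * c 2 + (B - B / r) * c 4,
    A * c 0 + (A - r - 1) * c 3 + (A - A / r) * c 4,
    -(r * c 0) - r * c 4,
    0]

theorem fourier_norton_of_represents (hD : 0 < D) (hM : 0 < M) (hψ : ψ ≠ 1)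
    {v : Matrix (Fin D) (Fin M) F → ℝ} {c : Fin 6 → ℝ} (hv : Represents ψ x P Q v c)
    (p : Matrix (Fin D) (Fin M) F) {B : Matrix (Fin D) (Fin M) F} (hB : B.rank = 1) :
    fourier ψ x (norton (idempotent F D M) (idempotent F D M *ᵥ hat p) v) B =
      (Fintype.card (Matrix (Fin D) (Fin M) F) : ℂ)⁻¹ *
        ∑ C, ind (C.rank = 1 ∧ (B - C).rank = 1) *
          (ψ (pairing (B - C) (p - x)) * combo ψ P Q c C) := by
  rw [fourier_norton hD hM hψ x p v B hB]
  congr 1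
  refine Finset.sum_congr rfl fun C _ => ?_
  rw [hv, ind_and]
  ring

theorem fourier_norton_of_rank_ne (hD : 0 < D) (hM : 0 < M) (hψ : ψ ≠ 1)
    (u v : Matrix (Fin D) (Fin M) F → ℝ) {B : Matrix (Fin D) (Fin M) F} (hB : B.rank ≠ 1) :
    fourier ψ x (norton (idempotent F D M) u v) B = 0 := by
  rw [norton, fourier_idempotent hD hM hψ, ind_of_not hB, zero_mul]

theorem ind_mul_char_pairing (a : Fin D → F) (b : Fin M → F) :
    ψ ((Pᵀ *ᵥ a) ⬝ᵥ (Q *ᵥ b)) * ind (Pᵀ *ᵥ a = 0) = ind (Pᵀ *ᵥ a = 0) ∧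
    ψ ((Pᵀ *ᵥ a) ⬝ᵥ (Q *ᵥ b)) * ind (Q *ᵥ b = 0) = ind (Q *ᵥ b = 0) ∧
    ψ ((Pᵀ *ᵥ a) ⬝ᵥ (Q *ᵥ b)) * ind ((Pᵀ *ᵥ a) ⬝ᵥ (Q *ᵥ b) = 0) =
      ind ((Pᵀ *ᵥ a) ⬝ᵥ (Q *ᵥ b) = 0) := by
  refine ⟨?_, ?_, ?_⟩
  · by_cases h : Pᵀ *ᵥ a = 0
    · simp [h]
    · simp [ind_of_not h]
  · by_cases h : Q *ᵥ b = 0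
    · simp [h]
    · simp [ind_of_not h]
  · by_cases h : (Pᵀ *ᵥ a) ⬝ᵥ (Q *ᵥ b) = 0
    · simp [h]
    · simp [ind_of_not h]

/-- Centring the transform at `x` makes the phase trivial, so the five functions are just summed
over common neighbours. None of these sums creates the product of the two indicators, so the last
coefficient stays zero. -/
theorem Represents.norton_left (hD : 0 < D) (hM : 0 < M) (hP : Injective P.mulVec)
    (hQ : Injective Qᵀ.mulVec) (hψ : ψ ≠ 1) {v : Matrix (Fin D) (Fin M) F → ℝ} {c : Fin 6 → ℝ}
    (hc : c 5 = 0) (hv : Represents ψ x P Q v c) :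
    Represents ψ x P Q (norton (idempotent F D M) (idempotent F D M *ᵥ hat x) v)
      ((Fintype.card (Matrix (Fin D) (Fin M) F) : ℝ)⁻¹ • actLeft (Fintype.card F)
        ((Fintype.card F : ℝ) ^ D) ((Fintype.card F : ℝ) ^ M) ((Fintype.card F : ℝ) ^ k) c) := by
  apply represents_of_forall
  · exact fun C hC => fourier_norton_of_rank_ne hD hM hψ _ _ hC
  intro a b ha hb
  rw [fourier_norton_of_represents hD hM hψ hv x (rank_vecMulVec_eq_one ha hb), combo_smul]
  push_cast
  congr 1
  have e : ∀ C, ind (C.rank = 1 ∧ (vecMulVec a b - C).rank = 1) *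
      (ψ (pairing (vecMulVec a b - C) (x - x)) * combo ψ P Q c C) =
      c 0 * ind (C.rank = 1 ∧ (vecMulVec a b - C).rank = 1) +
      c 1 * (ind (C.rank = 1 ∧ (vecMulVec a b - C).rank = 1) * ψ (1 * pairing C (P * Q))) +
      c 2 * (ind (C.rank = 1 ∧ (vecMulVec a b - C).rank = 1) * ind (Pᵀ * C = 0)) +
      c 3 * (ind (C.rank = 1 ∧ (vecMulVec a b - C).rank = 1) * ind (C * Qᵀ = 0)) +
      c 4 * (ind (C.rank = 1 ∧ (vecMulVec a b - C).rank = 1) *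
        ind (pairing C (P * Q) = 0)) := by
    intro C
    rw [sub_self, pairing_zero_right, AddChar.map_zero_eq_one, combo, hc, one_mul, one_mul]
    push_cast
    ring
  rw [Finset.sum_congr rfl fun C _ => e C]
  simp only [Finset.sum_add_distrib, ← Finset.mul_sum]
  rw [commonSum_one ha hb, commonSum_char hP hQ hψ ha hb one_ne_zero, commonSum_left hP ha hb,
    commonSum_right hQ ha hb, commonSum_pairing hP hQ ha hb, combo_vecMulVec _ ha hb]
  simp [actLeft]
  ring

/-- The phase splits as `ψ(t) ψ(-⟨C, PQ⟩)`. The second factor exchanges the roles of `1` and `ψ(⟨C,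
PQ⟩)` and is absorbed by each indicator, since the pairing vanishes on their supports; `ψ(t)` is
absorbed likewise after summation. -/
theorem Represents.norton_right (hD : 0 < D) (hM : 0 < M) (hw : y - x = P * Q)
    (hP : Injective P.mulVec) (hQ : Injective Qᵀ.mulVec) (hψ : ψ ≠ 1)
    {v : Matrix (Fin D) (Fin M) F → ℝ} {c : Fin 6 → ℝ} (hc : c 5 = 0)
    (hv : Represents ψ x P Q v c) :
    Represents ψ x P Q (norton (idempotent F D M) (idempotent F D M *ᵥ hat y) v)
      ((Fintype.card (Matrix (Fin D) (Fin M) F) : ℝ)⁻¹ • actRight (Fintype.card F)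
        ((Fintype.card F : ℝ) ^ D) ((Fintype.card F : ℝ) ^ M) ((Fintype.card F : ℝ) ^ k) c) := by
  apply represents_of_forall
  · exact fun C hC => fourier_norton_of_rank_ne hD hM hψ _ _ hC
  intro a b ha hb
  rw [fourier_norton_of_represents hD hM hψ hv y (rank_vecMulVec_eq_one ha hb), combo_smul, hw]
  push_cast
  congr 1
  set t := (Pᵀ *ᵥ a) ⬝ᵥ (Q *ᵥ b) with ht
  have e : ∀ C, ind (C.rank = 1 ∧ (vecMulVec a b - C).rank = 1) *
      (ψ (pairing (vecMulVec a b - C) (P * Q)) * combo ψ P Q c C) =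
      ψ t * (c 0 * (ind (C.rank = 1 ∧ (vecMulVec a b - C).rank = 1) *
        ψ (-1 * pairing C (P * Q))) +
      c 1 * ind (C.rank = 1 ∧ (vecMulVec a b - C).rank = 1) +
      c 2 * (ind (C.rank = 1 ∧ (vecMulVec a b - C).rank = 1) * ind (Pᵀ * C = 0)) +
      c 3 * (ind (C.rank = 1 ∧ (vecMulVec a b - C).rank = 1) * ind (C * Qᵀ = 0)) +
      c 4 * (ind (C.rank = 1 ∧ (vecMulVec a b - C).rank = 1) *
        ind (pairing C (P * Q) = 0))) := by
    intro C
    rw [pairing_sub_left, pairing_vecMulVec_mul, ← ht, sub_eq_add_neg t, AddChar.map_add_eq_mul,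
      neg_one_mul, combo, hc]
    have h1 : ψ (-pairing C (P * Q)) * ψ (pairing C (P * Q)) = 1 := by
      rw [← AddChar.map_add_eq_mul, neg_add_cancel, AddChar.map_zero_eq_one]
    have h2 : ψ (-pairing C (P * Q)) * ind (Pᵀ * C = 0) = ind (Pᵀ * C = 0) := by
      by_cases h : Pᵀ * C = 0
      · simp [pairing_eq_zero_of_transpose_mul h]
      · simp [ind_of_not h]
    have h3 : ψ (-pairing C (P * Q)) * ind (C * Qᵀ = 0) = ind (C * Qᵀ = 0) := by
      by_cases h : C * Qᵀ = 0
      · simp [pairing_eq_zero_of_mul_transpose h]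
      · simp [ind_of_not h]
    have h4 : ψ (-pairing C (P * Q)) * ind (pairing C (P * Q) = 0) =
        ind (pairing C (P * Q) = 0) := by
      by_cases h : pairing C (P * Q) = 0
      · simp [h]
      · simp [ind_of_not h]
    push_cast
    linear_combination (ind (C.rank = 1 ∧ (vecMulVec a b - C).rank = 1) * ψ t) *
      (c 1 * h1 + c 2 * h2 + c 3 * h3 + c 4 * h4)
  rw [Finset.sum_congr rfl fun C _ => e C]
  simp only [Finset.sum_add_distrib, ← Finset.mul_sum]
  rw [commonSum_one ha hb, commonSum_char hP hQ hψ ha hb (neg_ne_zero.2 one_ne_zero),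
    commonSum_left hP ha hb,
    commonSum_right hQ ha hb, commonSum_pairing hP hQ ha hb, combo_vecMulVec _ ha hb, ← ht]
  obtain ⟨h1, h2, h3⟩ := ind_mul_char_pairing (ψ := ψ) (P := P) (Q := Q) a b
  rw [← ht] at h1 h2 h3
  have h4 : ψ t * ψ (-t) = 1 := by
    rw [← AddChar.map_add_eq_mul, add_neg_cancel, AddChar.map_zero_eq_one]
  simp [actRight]
  linear_combination (c 0 * q ^ M + c 2 * (q ^ M - q - 1) + c 4 * (q ^ M - q ^ M / q)) * h1 +
    (c 0 * q ^ D + c 3 * (q ^ D - q - 1) + c 4 * (q ^ D - q ^ D / q)) * h2 -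
    (c 0 * q + c 4 * q) * h3 - c 0 * h4

theorem represents_hat_left (hD : 0 < D) (hM : 0 < M) (hψ : ψ ≠ 1) :
    Represents ψ x P Q (idempotent F D M *ᵥ hat x) ![1, 0, 0, 0, 0, 0] := fun C => by
  rw [fourier_idempotent hD hM hψ, fourier_hat, sub_self, pairing_zero_right]
  simp [combo]

theorem represents_hat_right (hD : 0 < D) (hM : 0 < M) (hψ : ψ ≠ 1) (hw : y - x = P * Q) :
    Represents ψ x P Q (idempotent F D M *ᵥ hat y) ![0, 1, 0, 0, 0, 0] := fun C => by
  rw [fourier_idempotent hD hM hψ, fourier_hat, hw]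
  simp [combo]

end Action

/-! ### Inner products via Parseval -/

section Inner

variable {F : Type*} [Field F] [Fintype F] {D M k : ℕ} {x y : Matrix (Fin D) (Fin M) F}
  {P : Matrix (Fin D) (Fin k) F} {Q : Matrix (Fin k) (Fin M) F} {ψ : AddChar F ℂ}

local notation "q" => ((Fintype.card F : ℕ) : ℂ)

theorem sum_nonzero_ind_left (hP : Injective P.mulVec) :
    ∑ a : Fin D → F, ∑ b : Fin M → F, ind (a ≠ 0) * ind (b ≠ 0) * ind (Pᵀ *ᵥ a = 0) =
      (q ^ D / q ^ k - 1) * (q ^ M - 1) := by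
  rw [sum_nonzero fun a _ => ind (Pᵀ *ᵥ a = 0)]
  simp [← Finset.mul_sum, sum_ind_transpose_mulVec_eq_zero hP, ind_of]
  ring

theorem sum_nonzero_ind_right (hQ : Injective Qᵀ.mulVec) :
    ∑ a : Fin D → F, ∑ b : Fin M → F, ind (a ≠ 0) * ind (b ≠ 0) * ind (Q *ᵥ b = 0) =
      (q ^ D - 1) * (q ^ M / q ^ k - 1) := by
  have hs := sum_ind_transpose_mulVec_eq_zero hQ
  rw [transpose_transpose] at hs
  rw [sum_nonzero fun _ b => ind (Q *ᵥ b = 0)]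
  simp [hs, ind_of]
  ring

theorem sum_nonzero_ind_both (hP : Injective P.mulVec) (hQ : Injective Qᵀ.mulVec) :
    ∑ a : Fin D → F, ∑ b : Fin M → F, ind (a ≠ 0) * ind (b ≠ 0) *
      (ind (Pᵀ *ᵥ a = 0) * ind (Q *ᵥ b = 0)) = (q ^ D / q ^ k - 1) * (q ^ M / q ^ k - 1) := by
  have hs := sum_ind_transpose_mulVec_eq_zero hQ
  rw [transpose_transpose] at hs
  rw [sum_nonzero fun a b => ind (Pᵀ *ᵥ a = 0) * ind (Q *ᵥ b = 0)]
  simp [← Finset.mul_sum, ← Finset.sum_mul, hs, sum_ind_transpose_mulVec_eq_zero hP, ind_of]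
  ring

theorem sum_nonzero_ind_pairing (hP : Injective P.mulVec) (hQ : Injective Qᵀ.mulVec) :
    ∑ a : Fin D → F, ∑ b : Fin M → F, ind (a ≠ 0) * ind (b ≠ 0) *
      ind ((Pᵀ *ᵥ a) ⬝ᵥ (Q *ᵥ b) = 0) =
        q ^ D * q ^ M / q + (q ^ M - q ^ M / q) * (q ^ D / q ^ k) - q ^ D - q ^ M + 1 := by
  rw [sum_nonzero fun a b => ind ((Pᵀ *ᵥ a) ⬝ᵥ (Q *ᵥ b) = 0)]
  have e : ∀ a b, (Pᵀ *ᵥ a) ⬝ᵥ (Q *ᵥ b) = (Qᵀ *ᵥ (Pᵀ *ᵥ a)) ⬝ᵥ b := fun a b => by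
    rw [dotProduct_mulVec, mulVec_transpose Q]
  simp_rw [e, sum_ind_dotProduct_eq_zero, ind_congr (mulVec_eq_zero_iff_of_injective hQ)]
  simp [Finset.sum_add_distrib, ← Finset.mul_sum, sum_ind_transpose_mulVec_eq_zero hP, ind_of]
  ring

/-- Parseval evaluates one transform at `-B`; only the character term could notice the sign. -/
theorem combo_neg {o : Fin 6 → ℝ} (h1 : o 1 = 0) (C : Matrix (Fin D) (Fin M) F) :
    combo ψ P Q o (-C) = combo ψ P Q o C := by
  simp [combo, h1, pairing_neg_left]

/-- As `o 0 = o 1 = 0`, every term of the first transform carries an indicator forcing `⟨C, PQ⟩ =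
0`. There `1`, `ψ(⟨C, PQ⟩)` and the indicator of zero pairing all equal `1`, hence the grouping `c 0
+ c 1 + c 4`; only four counts of pairs remain. -/
theorem dotProduct_of_represents (hP : Injective P.mulVec) (hQ : Injective Qᵀ.mulVec)
    (hψ : ψ ≠ 1) {u v : Matrix (Fin D) (Fin M) F → ℝ} {o c : Fin 6 → ℝ} (h0 : o 0 = 0)
    (h1 : o 1 = 0) (hu : Represents ψ x P Q u o) (hv : Represents ψ x P Q v c) :
    (q - 1) * (Fintype.card (Matrix (Fin D) (Fin M) F) * ((u ⬝ᵥ v : ℝ) : ℂ)) =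
      ((c 0 + c 1 + c 4) * o 2 + c 2 * (o 2 + o 4)) * ((q ^ D / q ^ k - 1) * (q ^ M - 1)) +
      ((c 0 + c 1 + c 4) * o 3 + c 3 * (o 3 + o 4)) * ((q ^ D - 1) * (q ^ M / q ^ k - 1)) +
      ((c 0 + c 1 + c 4) * o 4) * (q ^ D * q ^ M / q + (q ^ M - q ^ M / q) * (q ^ D / q ^ k) -
        q ^ D - q ^ M + 1) +
      ((c 0 + c 1 + c 4) * o 5 + c 2 * (o 3 + o 5) + c 3 * (o 2 + o 5) +
        c 5 * (o 2 + o 3 + o 4 + o 5)) * ((q ^ D / q ^ k - 1) * (q ^ M / q ^ k - 1)) := by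
  rw [parseval x hψ, mul_inv_cancel_left₀ card_matrix_ne_zero]
  have e : ∀ C, fourier ψ x u (-C) * fourier ψ x v C =
      ind (C.rank = 1) * (combo ψ P Q o C * combo ψ P Q c C) := by
    intro C
    rw [hu, hv, rank_neg, combo_neg h1]
    linear_combination combo ψ P Q o C * combo ψ P Q c C * ind_mul_self (C.rank = 1)
  simp_rw [e]
  rw [← sum_nonzero_pairs]
  have e' : ∀ a b, ind (a ≠ 0) * ind (b ≠ 0) *
      (combo ψ P Q o (vecMulVec a b) * combo ψ P Q c (vecMulVec a b)) =
      ((c 0 + c 1 + c 4) * o 2 + c 2 * (o 2 + o 4)) *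
        (ind (a ≠ 0) * ind (b ≠ 0) * ind (Pᵀ *ᵥ a = 0)) +
      ((c 0 + c 1 + c 4) * o 3 + c 3 * (o 3 + o 4)) *
        (ind (a ≠ 0) * ind (b ≠ 0) * ind (Q *ᵥ b = 0)) +
      ((c 0 + c 1 + c 4) * o 4) *
        (ind (a ≠ 0) * ind (b ≠ 0) * ind ((Pᵀ *ᵥ a) ⬝ᵥ (Q *ᵥ b) = 0)) +
      ((c 0 + c 1 + c 4) * o 5 + c 2 * (o 3 + o 5) + c 3 * (o 2 + o 5) +
        c 5 * (o 2 + o 3 + o 4 + o 5)) *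
          (ind (a ≠ 0) * ind (b ≠ 0) * (ind (Pᵀ *ᵥ a = 0) * ind (Q *ᵥ b = 0))) := by
    intro a b
    by_cases ha : a = 0
    · simp [ind_of_not (p := a ≠ 0) (not_not.2 ha)]
    by_cases hb : b = 0
    · simp [ind_of_not (p := b ≠ 0) (not_not.2 hb)]
    rw [combo_vecMulVec _ ha hb, combo_vecMulVec _ ha hb, h0, h1]
    by_cases hα : Pᵀ *ᵥ a = 0
    · by_cases hβ : Q *ᵥ b = 0
      · simp [hα, hβ, ind_of, ha, hb]
        ring
      · simp [hα, ind_of_not hβ, ind_of, ha, hb]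
        ring
    · by_cases hβ : Q *ᵥ b = 0
      · simp [ind_of_not hα, hβ, ind_of, ha, hb]
        ring
      · by_cases ht : (Pᵀ *ᵥ a) ⬝ᵥ (Q *ᵥ b) = 0
        · simp [ind_of_not hα, ind_of_not hβ, ht, ind_of, ha, hb]
          ring
        · simp [ind_of_not hα, ind_of_not hβ, ind_of_not ht]
  simp_rw [e', Finset.sum_add_distrib, ← Finset.mul_sum, sum_nonzero_ind_left hP,
    sum_nonzero_ind_right hQ, sum_nonzero_ind_both hP hQ, sum_nonzero_ind_pairing hP hQ]

end Inner

/-! ### Linear algebra in the six coefficients -/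

section CoefficientAlgebra

variable {r A B K : ℝ}

theorem cellCoeff_span (hr : 1 < r) (hK : r ≤ K) (hA : 2 * r < A) (hB : 2 * r < B)
    (C : Submodule ℝ (Fin 6 → ℝ)) (hC : ∀ i, cellCoeff r A B K i ∈ C) (c : Fin 6 → ℝ) : c ∈ C := by
  have hr0 : r ≠ 0 := by linarith
  have hr1 : r - 1 ≠ 0 := by linarith
  have hK0 : K ≠ 0 := by linarith
  have h01 := C.add_mem (hC 0) (hC 1)
  have h012 := C.add_mem h01 (hC 2)
  -- The six cells together exhaust all pairs of nonzero vectors, and that character sum is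
  -- constant.
  have e0 : (![1, 0, 0, 0, 0, 0] : Fin 6 → ℝ) ∈ C := by
    have h : A * B / r - A - B + 1 ≠ 0 := by
      have : A * B / r - A - B + 1 = ((A - 2 * r) * (B - r) + r * (B - 2 * r) + r) / r := by
        field_simp
        ring
      rw [this]
      have : 0 < (A - 2 * r) * (B - r) := mul_pos (by linarith) (by linarith)
      have : 0 < r * (B - 2 * r) := mul_pos (by linarith) (by linarith)
      positivity
    rw [← C.smul_mem_iff h]
    have := C.add_mem (C.add_mem (C.add_mem h012 (hC 3)) (hC 4)) (hC 5)
    convert this using 1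
    ext i
    fin_cases i <;> simp [cellCoeff] <;> field_simp <;> ring
  have hL : K - K / r ≠ 0 := by
    have : K - K / r = K * (r - 1) / r := by field_simp
    rw [this]
    exact div_ne_zero (mul_ne_zero hK0 hr1) hr0
  -- The first four cells are all pairs with `u` in the range of `P`, whose sum involves only `1`
  -- and the indicator of `Pᵀ C = 0`.
  have e2 : (![0, 0, 1, 0, 0, 0] : Fin 6 → ℝ) ∈ C := by
    have h : B * (K - K / r) ≠ 0 := mul_ne_zero (by linarith) hL
    rw [← C.smul_mem_iff h]
    have := C.sub_mem (C.add_mem h012 (hC 3)) (C.smul_mem (B * (K / r) - B - K + 1) e0)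
    convert this using 1
    ext i
    fin_cases i <;> simp [cellCoeff] <;> field_simp <;> ring
  have e3 : (![0, 0, 0, 1, 0, 0] : Fin 6 → ℝ) ∈ C := by
    have h : A * (K - K / r) ≠ 0 := mul_ne_zero (by linarith) hL
    rw [← C.smul_mem_iff h]
    have := C.sub_mem (C.add_mem h012 (hC 4)) (C.smul_mem (A * (K / r) - A - K + 1) e0)
    convert this using 1
    ext i
    fin_cases i <;> simp [cellCoeff] <;> field_simp <;> ring
  -- The first three cells are the pairs with both vectors in the ranges; their sum involves the
  -- union of the two indicators, hence the product.
  have e5 : (![0, 0, 0, 0, 0, 1] : Fin 6 → ℝ) ∈ C := by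
    have h : K * (K - K / r) ≠ 0 := mul_ne_zero hK0 hL
    rw [← C.smul_mem_iff h]
    have := C.sub_mem (C.add_mem (C.smul_mem (K * (K / r) - 2 * K + 1) e0)
      (C.smul_mem (K * (K - K / r)) (C.add_mem e2 e3))) h012
    convert this using 1
    ext i
    fin_cases i <;> simp [cellCoeff] <;> field_simp <;> ring
  -- This is the indicator-union part common to the first two rows. With it removed, row 1 isolates
  -- the fifth coordinate and then row 0 the second.
  have hun := C.smul_mem (K / r * (K - K / r)) (C.sub_mem (C.add_mem e2 e3) e5)
  have hk : K / r * (r - 1) ≠ 0 := mul_ne_zero (div_ne_zero hK0 hr0) hr1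
  have e4 : (![0, 0, 0, 0, 1, 0] : Fin 6 → ℝ) ∈ C := by
    rw [← C.smul_mem_iff hk]
    have := C.sub_mem (C.add_mem
      (C.smul_mem (K / r * (K / r + 2 * (r - 1)) - (2 * K - 1)) e0) hun) (hC 1)
    convert this using 1
    ext i
    fin_cases i <;> simp [cellCoeff]
  have e1 : (![0, 1, 0, 0, 0, 0] : Fin 6 → ℝ) ∈ C := by
    rw [← C.smul_mem_iff hk]
    have := C.add_mem (C.sub_mem (C.sub_mem (hC 0) (C.smul_mem (K / r * (K / r - 1)) e0)) hun)
      (C.smul_mem (K / r * (r - 1)) e4)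
    convert this using 1
    ext i
    fin_cases i <;> simp [cellCoeff]
  have := C.add_mem (C.add_mem (C.add_mem (C.add_mem (C.add_mem (C.smul_mem (c 0) e0)
    (C.smul_mem (c 1) e1)) (C.smul_mem (c 2) e2)) (C.smul_mem (c 3) e3)) (C.smul_mem (c 4) e4))
    (C.smul_mem (c 5) e5)
  convert this using 1
  ext i
  fin_cases i <;> simp

/-- Modulo the first basis vector, the action on coordinates 2, 3, 4 is triangular with distinct
diagonal entries `B - r - 1`, `A - r - 1`, `-r`. The vector `g1`, extracted from the image of the
second basis vector, is cyclic for it, so `g1`, `g2`, `g3` generate all three coordinates. -/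
theorem actLeft_span (hr : 1 < r) (hA : r < A) (hAB : A < B)
    (C : Submodule ℝ (Fin 6 → ℝ)) (e0 : ![1, 0, 0, 0, 0, 0] ∈ C) (e1 : ![0, 1, 0, 0, 0, 0] ∈ C)
    (hC : ∀ c ∈ C, c 5 = 0 → actLeft r A B K c ∈ C) (c : Fin 6 → ℝ) (hc : c 5 = 0) : c ∈ C := by
  have hr0 : r ≠ 0 := by linarith
  have g1 : ![0, 0, B, A, -r, 0] ∈ C := by
    have := C.add_mem (C.add_mem (hC _ e1 (by simp)) e0) e1
    convert this using 1
    ext i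
    fin_cases i <;> simp [actLeft]
  have g2 : ![0, 0, B * (B - 2 * r), A * (A - 2 * r), r ^ 2, 0] ∈ C := by
    have h := hC _ g1 (by simp)
    have := C.sub_mem h (C.smul_mem (actLeft r A B K ![0, 0, B, A, -r, 0] 0) e0)
    convert this using 1
    ext i
    fin_cases i <;> simp [actLeft] <;> field_simp <;> ring
  have g3 : ![0, 0, B * (B ^ 2 - (3 * r + 1) * (B - r)), A * (A ^ 2 - (3 * r + 1) * (A - r)),
      -r ^ 3, 0] ∈ C := by
    have h := hC _ g2 (by simp)
    have := C.sub_mem h (C.smul_mem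
      (actLeft r A B K ![0, 0, B * (B - 2 * r), A * (A - 2 * r), r ^ 2, 0] 0) e0)
    convert this using 1
    ext i
    fin_cases i <;> simp [actLeft] <;> field_simp <;> ring
  -- Adding `r` to the operator kills coordinate 4. Subtracting `A - r - 1` or `B - r - 1` times
  -- `h1` from `h2` then isolates one of the other two coordinates, which uses `A ≠ B`.
  have h1 := C.add_mem g2 (C.smul_mem r g1)
  have h2 := C.add_mem g3 (C.smul_mem r g2)
  have e2 : ![0, 0, 1, 0, 0, 0] ∈ C := by
    have h : B * (B - r) * (B - A) ≠ 0 :=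
      mul_ne_zero (mul_ne_zero (by linarith) (by linarith)) (by linarith)
    rw [← C.smul_mem_iff h]
    have := C.sub_mem h2 (C.smul_mem (A - r - 1) h1)
    convert this using 1
    ext i
    fin_cases i <;> simp <;> ring
  have e3 : ![0, 0, 0, 1, 0, 0] ∈ C := by
    have h : A * (A - r) * (A - B) ≠ 0 :=
      mul_ne_zero (mul_ne_zero (by linarith) (by linarith)) (by linarith)
    rw [← C.smul_mem_iff h]
    have := C.sub_mem h2 (C.smul_mem (B - r - 1) h1)
    convert this using 1
    ext i
    fin_cases i <;> simp <;> ring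
  have e4 : ![0, 0, 0, 0, 1, 0] ∈ C := by
    rw [← C.smul_mem_iff hr0]
    have := C.sub_mem (C.add_mem (C.smul_mem B e2) (C.smul_mem A e3)) g1
    convert this using 1
    ext i
    fin_cases i <;> simp
  have := C.add_mem (C.add_mem (C.add_mem (C.add_mem (C.smul_mem (c 0) e0)
    (C.smul_mem (c 1) e1)) (C.smul_mem (c 2) e2)) (C.smul_mem (c 3) e3)) (C.smul_mem (c 4) e4)
  convert this using 1
  ext i
  fin_cases i <;> simp [hc]

/-- The coefficients of the Fourier transform of `ω`, up to the factor `(q - 1) ^ 2`. -/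
noncomputable def omegaVec (r A B K : ℝ) : Fin 6 → ℝ :=
  ![0, 0, (K - K / r) * (B - K) * (A / r - 1), (K - K / r) * (A - K) * (B / r - 1),
    -((K - K / r) * (A - K) * (B - K) / K),
    -((K - K / r) * A * B * (K - 1) * (K - r) / (r * K)) -
      (K - K / r) * (B - K) * (A / r - 1) - (K - K / r) * (A - K) * (B / r - 1) +
        (K - K / r) * (A - K) * (B - K) / K]

/-- The weights `ω_i` cancel the coefficients of `1` and of `ψ(⟨C, PQ⟩)`, which is what
`dotProduct_of_represents` requires of its first vector. -/
theorem sum_omegaCoeff (hr : 1 < r) {D M k : ℕ} (hk : 1 ≤ k) :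
    ∑ i, omegaCoeff r D M k i • ((r - 1)⁻¹ • cellCoeff r (r ^ D) (r ^ M) (r ^ k) i) =
      ((r - 1)⁻¹ * (r - 1)⁻¹) • omegaVec r (r ^ D) (r ^ M) (r ^ k) := by
  have hr0 : r ≠ 0 := by linarith
  have hr1 : r - 1 ≠ 0 := by linarith
  -- Expressing everything through `L = r ^ (k - 1)` removes the natural subtraction and leaves a
  -- rational identity in `r, L, A, B`.
  have hkr : r ^ k = r * r ^ (k - 1) := by
    rw [← pow_succ', Nat.sub_add_cancel hk]
  have hk1 : r ^ (k - 1) ≠ 0 := pow_ne_zero _ hr0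
  unfold omegaCoeff
  rw [hkr]
  generalize r ^ (k - 1) = L at *
  generalize r ^ D = A
  generalize r ^ M = B
  ext i
  rw [Finset.sum_apply, Fin.sum_univ_six]
  fin_cases i <;> simp [cellCoeff, omegaVec] <;> field_simp <;> ring

end CoefficientAlgebra

/-! ### Comparison of the two subspaces -/

section Main

variable {F : Type*} [Field F] [Fintype F] {D M k : ℕ} {x y : Matrix (Fin D) (Fin M) F}
  {P : Matrix (Fin D) (Fin k) F} {Q : Matrix (Fin k) (Fin M) F} {ψ : AddChar F ℂ}

/-- The coefficient vectors represented by elements of `T`. -/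
def representedCoeff (ψ : AddChar F ℂ) (x : Matrix (Fin D) (Fin M) F)
    (P : Matrix (Fin D) (Fin k) F) (Q : Matrix (Fin k) (Fin M) F)
    (T : Submodule ℝ (Matrix (Fin D) (Fin M) F → ℝ)) : Submodule ℝ (Fin 6 → ℝ) where
  carrier := {c | ∃ v ∈ T, Represents ψ x P Q v c}
  zero_mem' := ⟨0, T.zero_mem, Represents.zero⟩
  add_mem' := by
    rintro c d ⟨v, hv, hvc⟩ ⟨w, hw, hwd⟩
    exact ⟨v + w, T.add_mem hv hw, hvc.add hwd⟩
  smul_mem' := by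
    rintro r c ⟨v, hv, hvc⟩
    exact ⟨r • v, T.smul_mem r hv, hvc.smul r⟩

theorem represents_omega (hk : 1 ≤ k) (hkD : k < D) (hDM : D < M) (hw : y - x = P * Q)
    (hP : Injective P.mulVec) (hQ : Injective Qᵀ.mulVec) (hψ : ψ ≠ 1) :
    Represents ψ x P Q (omega x y)
      ((((Fintype.card F : ℝ) - 1)⁻¹ * ((Fintype.card F : ℝ) - 1)⁻¹) •
        omegaVec (Fintype.card F) ((Fintype.card F : ℝ) ^ D)
          ((Fintype.card F : ℝ) ^ M) ((Fintype.card F : ℝ) ^ k)) := by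
  have hd : (graph F D M).dist x y = k := by
    rw [dist_eq_rank, rank_sub_comm, hw, rank_mul_of_injective hP hQ, Fintype.card_fin]
  rw [← sum_omegaCoeff one_lt_card hk, omega, hd]
  exact Represents.sum fun i _ =>
    (represents_cellVector hk hkD hDM hw hP hQ hψ i).smul _

/-- For the coefficients of `ω`, the contributions of `c 0`, …, `c 4` to the inner product cancel,
leaving an explicit multiple of `c 5`. -/
theorem omega_dotProduct_eq_zero_iff (hk : 2 ≤ k) (hkD : k < D) (hDM : D < M)
    (hw : y - x = P * Q) (hP : Injective P.mulVec) (hQ : Injective Qᵀ.mulVec) (hψ : ψ ≠ 1)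
    {v : Matrix (Fin D) (Fin M) F → ℝ} {c : Fin 6 → ℝ} (hv : Represents ψ x P Q v c) :
    omega x y ⬝ᵥ v = 0 ↔ c 5 = 0 := by
  have hq := one_lt_card (F := F)
  have h := dotProduct_of_represents hP hQ hψ (by simp [omegaVec]) (by simp [omegaVec])
    (represents_omega (by omega) hkD hDM hw hP hQ hψ) hv
  set r : ℝ := ((Fintype.card F : ℕ) : ℝ) with hr
  have hKr : r < r ^ k := by
    calc r = r ^ 1 := (pow_one r).symm
      _ < r ^ k := pow_lt_pow_right₀ hq (by omega)
  have hAK : r ^ k < r ^ D := pow_lt_pow_right₀ hq hkD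
  have hBK : r ^ k < r ^ M := pow_lt_pow_right₀ hq (by omega)
  have h' : (r - 1) * (Fintype.card (Matrix (Fin D) (Fin M) F) * (omega x y ⬝ᵥ v)) =
      -(c 5 * (((r - 1)⁻¹ * (r - 1)⁻¹) * ((r ^ k - r ^ k / r) * r ^ D * r ^ M * (r ^ k - 1) *
        (r ^ k - r) / (r * r ^ k)) * ((r ^ D / r ^ k - 1) * (r ^ M / r ^ k - 1)))) := by
    have hcast : (((Fintype.card F : ℕ) : ℂ)) = ((r : ℝ) : ℂ) := by rw [hr]; simp
    rw [hcast] at h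
    have h2 := (show ((_ : ℝ) : ℂ) = ((_ : ℝ) : ℂ) by exact_mod_cast h)
    have h3 := Complex.ofReal_injective h2
    rw [h3]
    have hr0 : r ≠ 0 := by linarith
    have hr1 : r - 1 ≠ 0 := by linarith
    have hK0 : r ^ k ≠ 0 := by linarith
    generalize r ^ k = K at *
    generalize r ^ D = A at *
    generalize r ^ M = B at *
    simp [omegaVec]
    field_simp
    ring
  have hK1 : r ^ k - r ^ k / r ≠ 0 := by
    have hr0 : r ≠ 0 := by linarith
    have : r ^ k - r ^ k / r = r ^ k * (r - 1) / r := by field_simp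
    rw [this]
    exact div_ne_zero (mul_ne_zero (by linarith) (by linarith)) hr0
  -- The factor `r ^ k - r` is nonzero because `k ≥ 2`; the last two factors are nonzero because `k
  -- < D < M`.
  have hne : ((r - 1)⁻¹ * (r - 1)⁻¹) * ((r ^ k - r ^ k / r) * r ^ D * r ^ M * (r ^ k - 1) *
        (r ^ k - r) / (r * r ^ k)) * ((r ^ D / r ^ k - 1) * (r ^ M / r ^ k - 1)) ≠ 0 := by
    have hA1 : r ^ D / r ^ k - 1 ≠ 0 := by
      rw [sub_ne_zero, Ne, div_eq_one_iff_eq (by linarith)]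
      exact hAK.ne'
    have hB1 : r ^ M / r ^ k - 1 ≠ 0 := by
      rw [sub_ne_zero, Ne, div_eq_one_iff_eq (by linarith)]
      exact hBK.ne'
    have h1 : r - 1 ≠ 0 := by linarith
    have h2 : r ^ k - 1 ≠ 0 := by linarith
    have h3 : r ^ k - r ≠ 0 := by linarith
    have h4 : r ≠ 0 := by linarith
    simp [hA1, hB1, h1, h2, h3, h4, hK1]
  have hr1 : r - 1 ≠ 0 := by linarith
  have hX : (Fintype.card (Matrix (Fin D) (Fin M) F) : ℝ) ≠ 0 := by simp
  constructor
  · intro h0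
    rw [h0, mul_zero, mul_zero, zero_eq_neg] at h'
    exact (mul_eq_zero.1 h').resolve_right hne
  · intro h0
    rw [h0, zero_mul, neg_zero] at h'
    exact (mul_eq_zero.1 ((mul_eq_zero.1 h').resolve_left hr1)).resolve_left hX

theorem norton_add (E : Matrix (Matrix (Fin D) (Fin M) F) (Matrix (Fin D) (Fin M) F) ℝ)
    (u v w : Matrix (Fin D) (Fin M) F → ℝ) :
    norton E u (v + w) = norton E u v + norton E u w := by
  rw [norton, mul_add, mulVec_add, norton, norton]

theorem norton_smul (E : Matrix (Matrix (Fin D) (Fin M) F) (Matrix (Fin D) (Fin M) F) ℝ)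
    (r : ℝ) (u v : Matrix (Fin D) (Fin M) F → ℝ) :
    norton E u (r • v) = r • norton E u v := by
  rw [norton, mul_smul_comm, mulVec_smul, norton]

/-- The span of the right-nested Norton products of `E x̂` and `E ŷ`. -/
def nestedSpan (x y : Matrix (Fin D) (Fin M) F) :
    Submodule ℝ (Matrix (Fin D) (Fin M) F → ℝ) :=
  Submodule.span ℝ {v | ∃ (z : Matrix (Fin D) (Fin M) F) (l : List (Matrix (Fin D) (Fin M) F)),
    (∀ w ∈ z :: l, w = x ∨ w = y) ∧ v = nestedNorton (idempotent F D M) z l}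

theorem norton_mem_nestedSpan {v : Matrix (Fin D) (Fin M) F → ℝ} (hv : v ∈ nestedSpan x y) :
    norton (idempotent F D M) (idempotent F D M *ᵥ hat x) v ∈ nestedSpan x y := by
  induction hv using Submodule.span_induction with
  | mem v hv =>
    obtain ⟨z, l, hl, rfl⟩ := hv
    refine Submodule.subset_span ⟨x, z :: l, ?_, rfl⟩
    intro w hw
    rcases List.mem_cons.1 hw with rfl | hw
    · exact Or.inl rfl
    · exact hl w hw
  | zero => 
    have : norton (idempotent F D M) (idempotent F D M *ᵥ hat x) 0 = 0 := by
      rw [norton, mul_zero, mulVec_zero]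
    rw [this]
    exact Submodule.zero_mem _
  | add u v _ _ hu hv =>
    rw [norton_add]
    exact Submodule.add_mem _ hu hv
  | smul r v _ hv =>
    rw [norton_smul]
    exact Submodule.smul_mem _ r hv

theorem exists_represents_nestedNorton (hD : 0 < D) (hM : 0 < M) (hw : y - x = P * Q)
    (hP : Injective P.mulVec) (hQ : Injective Qᵀ.mulVec) (hψ : ψ ≠ 1)
    (l : List (Matrix (Fin D) (Fin M) F)) : ∀ z, (∀ w ∈ z :: l, w = x ∨ w = y) →
      ∃ c, c 5 = 0 ∧ Represents ψ x P Q (nestedNorton (idempotent F D M) z l) c := by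
  induction l with
  | nil =>
    intro z hz
    rcases hz z (by simp) with rfl | rfl
    · exact ⟨_, by simp, represents_hat_left hD hM hψ⟩
    · exact ⟨_, by simp, represents_hat_right hD hM hψ hw⟩
  | cons z' l ih =>
    intro z hz
    obtain ⟨c, hc, hv⟩ := ih z' fun w hw => hz w (List.mem_cons_of_mem _ hw)
    rcases hz z (by simp) with rfl | rfl
    · exact ⟨_, by simp [actLeft], hv.norton_left hD hM hP hQ hψ hc⟩
    · exact ⟨_, by simp [actRight], hv.norton_right hD hM hw hP hQ hψ hc⟩

theorem omegaPerp_eq_nestedSpan (hDM : D < M) (hk : 2 ≤ (graph F D M).dist x y)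
    (hkD : (graph F D M).dist x y < D) : omegaPerp x y = nestedSpan x y := by
  obtain ⟨ψ, hψ⟩ := exists_char_ne_one (F := F)
  rw [dist_eq_rank, rank_sub_comm] at hk hkD
  obtain ⟨P, Q, hw, hP, hQ⟩ := exists_rank_factorization (y - x)
  -- The sizes of `P` and `Q` mention the rank, so it is replaced by a free `k` to match the lemmas
  -- above.
  generalize (y - x).rank = k at *
  have hD : 0 < D := by omega
  have hM : 0 < M := by omega
  have hq := one_lt_card (F := F)
  have hq2 : (2 : ℝ) ≤ Fintype.card F := by exact_mod_cast Fintype.one_lt_card (α := F)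
  have hK : (Fintype.card F : ℝ) ≤ (Fintype.card F : ℝ) ^ k := le_self_pow₀ hq.le (by omega)
  have h2 : ∀ N, 3 ≤ N → 2 * (Fintype.card F : ℝ) < (Fintype.card F : ℝ) ^ N := by
    intro N hN
    calc 2 * (Fintype.card F : ℝ) ≤ (Fintype.card F : ℝ) ^ 2 := by rw [pow_two]; gcongr
      _ < _ := pow_lt_pow_right₀ hq (by omega)
  have hAB : (Fintype.card F : ℝ) ^ D < (Fintype.card F : ℝ) ^ M := pow_lt_pow_right₀ hq hDM
  have hX : ((Fintype.card (Matrix (Fin D) (Fin M) F) : ℝ)⁻¹) ≠ 0 := inv_ne_zero (by simp)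
  have hS : ∀ v ∈ S x y, ∃ c, Represents ψ x P Q v c := by
    intro v hv
    induction hv using Submodule.span_induction with
    | mem v hv =>
      obtain ⟨i, rfl⟩ := hv
      exact ⟨_, represents_cellVector (by omega) hkD hDM hw hP hQ hψ i⟩
    | zero => exact ⟨0, Represents.zero⟩
    | add u v _ _ hu hv =>
      obtain ⟨c, hc⟩ := hu
      obtain ⟨d, hd⟩ := hv
      exact ⟨_, hc.add hd⟩
    | smul r v _ hv =>
      obtain ⟨c, hc⟩ := hv
      exact ⟨_, hc.smul r⟩
  have hS' : ∀ c, c ∈ representedCoeff ψ x P Q (S x y) := by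
    refine cellCoeff_span hq hK (h2 D (by omega)) (h2 M (by omega)) _ fun i => ?_
    have hr1 : ((Fintype.card F : ℝ) - 1)⁻¹ ≠ 0 := inv_ne_zero (by linarith)
    rw [← Submodule.smul_mem_iff _ hr1]
    exact ⟨_, Submodule.subset_span ⟨i, rfl⟩,
      represents_cellVector (by omega) hkD hDM hw hP hQ hψ i⟩
  -- The represented coefficients contain those of `E x̂` and `E ŷ` and are stable under `actLeft`
  -- on the hyperplane, so `actLeft_span` applies.
  have hT' : ∀ c, c 5 = 0 → c ∈ representedCoeff ψ x P Q (nestedSpan x y) := by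
    refine actLeft_span (K := (Fintype.card F : ℝ) ^ k) hq
      (by have := h2 D (by omega); linarith) hAB _ ?_ ?_ ?_
    · exact ⟨_, Submodule.subset_span ⟨x, [], by simp, rfl⟩, represents_hat_left hD hM hψ⟩
    · exact ⟨_, Submodule.subset_span ⟨y, [], by simp, rfl⟩, represents_hat_right hD hM hψ hw⟩
    · rintro c ⟨v, hv, hvc⟩ hc
      rw [← Submodule.smul_mem_iff _ hX]
      exact ⟨_, norton_mem_nestedSpan hv, hvc.norton_left hD hM hP hQ hψ hc⟩
  apply le_antisymm
  · rintro v ⟨hv, hv0⟩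
    obtain ⟨c, hc⟩ := hS v hv
    have hc5 := (omega_dotProduct_eq_zero_iff hk hkD hDM hw hP hQ hψ hc).1 hv0
    obtain ⟨v', hv', hc'⟩ := hT' c hc5
    rwa [hc.unique hψ hc']
  · refine Submodule.span_le.2 ?_
    rintro _ ⟨z, l, hl, rfl⟩
    obtain ⟨c, hc5, hc⟩ := exists_represents_nestedNorton hD hM hw hP hQ hψ l z hl
    obtain ⟨v', hv', hc'⟩ := hS' c
    refine ⟨?_, (omega_dotProduct_eq_zero_iff hk hkD hDM hw hP hQ hψ hc).2 hc5⟩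
    rwa [hc.unique hψ hc']

end Main
end BilinearForms

theorem proposition12p8 {F : Type*} [Field F] [Fintype F] (hq : Fintype.card F ≠ 2)
    (D N : ℕ) (hD : 6 ≤ 2 * D) (hN : 2 * D < N)
    (x y : Matrix (Fin D) (Fin (N - D)) F)
    (hk : 2 ≤ (BilinearForms.graph F D (N - D)).dist x y)
    (hk' : (BilinearForms.graph F D (N - D)).dist x y ≤ D - 1) :
    BilinearForms.omegaPerp x y =
      Submodule.span ℝ
        {v | ∃ (z : Matrix (Fin D) (Fin (N - D)) F) (l : List (Matrix (Fin D) (Fin (N - D)) F)),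
          (∀ w ∈ z :: l, w = x ∨ w = y) ∧
          v = BilinearForms.nestedNorton (BilinearForms.idempotent F D (N - D)) z l} :=
  BilinearForms.omegaPerp_eq_nestedSpan (by omega) hk (by omega)
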